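/- **Notation.** Work in $\mathbb R^2$ with $\hat f(\xi)=\int f(x)e^{-ix\cdot\xi}\,dx$. Write $N_\rho(E)$ for the $\rho$-neighbourhood and $|E|$ for the Lebesgue measure of $E$. An $r$-ball (or cube) is a closed disc of radius $r$ or an axis-parallel half-open square of side $r$; the dyadic $r$-cubes are the squares $r(m+[0,1)^2)$, $m\in\mathbb Z^2$; an $r^{1/2}\times r$ tube is a rectangle of these dimensions in any position and direction. Let $A\ge 1$ be a constant (it bounds all implied constants in the hypotheses). *Regular sets.* For $\kappa\in[r^{-1/2},1]$, a subset $E$ of an $r$-ball or cube $B$ is *$\kappa$ regular in $B$* if (1) $|N_{r^{1/2}}(E)\cap T|\le A\kappa|T|$ for every $r^{1/2}\times r$ tube $T$, and (2) $E$ is covered by at most $A\,|N_{r^{1/2}}(E)|/(\kappa r^{3/2})$ tubes of dimensions $r^{1/2}\times r$. Let $n\ge1$, $R>1$, $K=R^{2^{-n}}$, $r_n=R$, $r_{k-1}=r_k^{1/2}$ (so $r_0=K$). A set $E$ is *regular with factors $(\kappa_{r_1},\dots,\kappa_{r_n})$*, $\kappa_{r_k}\in[r_k^{-1/2},1]$,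 if for every $1\le k\le n$: (1) $E\cap Q$ is $\kappa_{r_k}$ regular in $Q$ for every dyadic $r_k$-cube $Q$ that meets $E$; (2) $|N_{r_{k-1}}(E)\cap Q|\le A\,|N_{r_{k-1}}(E)\cap Q'|$ for any two dyadic $r_k$-cubes $Q,Q'$ that meet $E$. *Operators and broad norm.* Let $a$ be a smooth function on $\mathbb R$ supported in $[-1,1]$ and $\widehat{Sf}(\xi)=a(R(1-|\xi|))\hat f(\xi)$. Let $c>0$ and $N\in\mathbb N$, and let $\Sigma$ be a finite collection of arcs $\sigma$ of the unit circle, of lengths between $A^{-1}(\log R)^{-1}$ and $A(\log R)^{-1}$, which is finitely overlapping in the following sense: for every unit vector $e$, at most $N$ of the arcs $\sigma\in\Sigma$ contain a point at distance less than $c(\log R)^{-1}$ from $e$ or $-e$. For $\sigma\in\Sigma$ let $\widehat{S_\sigma f}=a_\sigma\widehat{Sf}$, where $a_\sigma$ takes values in $[0,1]$, is smooth away from the origin and vanishes outside $\{\xi:\xi/|\xi|\in\sigma\}$. Put $$\|Sf\|_{L^2_{\mathrm{br}_M}(E)}=\max_{\Sigma'\subset\Sigma,\ \#\Sigma'=M}\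 \min_{\sigma\in\Sigma'}\|S_\sigma f\|_{L^2(E)}$$ (which is $0$ if $\#\Sigma<M$). **Proposition.** For all $A\ge1$, $c>0$ and $N\in\mathbb N$ there are constants $C\ge 1$ and $K_0>1$, depending only on $A,c,N$, such that the following holds whenever $n\ge1$, $R>1$ and $K=R^{2^{-n}}\ge K_0$. Let $\mathcal B$ be a finite family of $K$-balls (or cubes) such that every point lies in at most $A$ of them, and suppose that $F=\bigcup_{B\in\mathcal B}B$ is contained in an $R$-ball (or cube) and is regular with factors $(\kappa_{r_1},\dots,\kappa_{r_n})$. Let $M\ge (N+1)n$ (that is, $M\ge 3n$ if $N=2$). Then for all $a$, $\Sigma$, $(a_\sigma)_{\sigma\in\Sigma}$ as above and every $f\in L^2(\mathbb R^2)$, $$\sum_{B\in\mathcal B}\|Sf\|^2_{L^2_{\mathrm{br}_M}(B)}\le C(\log R)^{5n}\prod_{k=1}^n\kappa_{r_k}^{-1}\Big(\frac{|F|}{R^2}\Big)\|Sf\|_2^2,$$ $$\|Sf\|^2_{L^2(F)}\le C^n\prod_{k=1}^n\kappa_{r_k}\,\|Sf\|_2^2,$$ $$\sum_{B\in\mathcal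 B}\|Sf\|^2_{L^2_{\mathrm{br}_M}(B)}\le C(\log R)^{5n}\Big(\frac{|F|}{R^2}\Big)^{1/2}\|Sf\|_2^2.$$ -/

import Mathlib

open MeasureTheory Set
open scoped FourierTransform ENNReal ContDiff

noncomputable section

/-- The Euclidean plane. -/
abbrev Plane : Type := EuclideanSpace ℝ (Fin 2)

/-! ### Balls, squares, grids, tubes -/

/-- The half-open axis-parallel square with lower left corner `c` and side length `r`. -/
def square (c : Plane) (r : ℝ) : Set Plane :=
  {x | ∀ i, c i ≤ x i ∧ x i < c i + r}

/-- `B` is an `r`-ball (or cube): a disc of radius `r` or a square of side length `r`. -/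
def IsBallOrCube (r : ℝ) (B : Set Plane) : Prop :=
  ∃ c : Plane, B = Metric.closedBall c r ∨ B = square c r

/-- The dyadic `r`-cube with index `m`, i.e. the cell of the partition of the plane into the
squares `r (m + [0,1)²)`, `m ∈ ℤ²`. -/
def gridCube (r : ℝ) (m : Fin 2 → ℤ) : Set Plane :=
  {x | ∀ i, r * (m i : ℝ) ≤ x i ∧ x i < r * ((m i : ℝ) + 1)}

/-- The vector `e` rotated by a right angle. -/
def perp (e : Plane) : Plane := !₂[-(e 1), e 0]

/-- The `r^{1/2} × r` tube centred at `x` whose long side has the direction `e`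
(`e` is a unit vector wherever this is used). -/
def tube (r : ℝ) (x e : Plane) : Set Plane :=
  {y | |inner ℝ (y - x) e| ≤ r / 2 ∧ |inner ℝ (y - x) (perp e)| ≤ Real.sqrt r / 2}

/-- `T` is an `r^{1/2} × r` tube, of any position and direction. -/
def IsTube (r : ℝ) (T : Set Plane) : Prop :=
  ∃ x e : Plane, ‖e‖ = 1 ∧ T = tube r x e

/-! ### Regular sets -/

/-- `E` is a `κ` regular subset of `B` (an `r`-ball or cube); `A` is the implied constant.
`Metric.thickening ρ E` is the `ρ`-neighbourhood `N_ρ(E)`. -/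
structure IsKappaRegular (A r κ : ℝ) (B E : Set Plane) : Prop where
  kappa_mem : κ ∈ Icc (r ^ (-(1 / 2) : ℝ)) 1
  subset : E ⊆ B
  tube_bound : ∀ T, IsTube r T →
    volume.real (Metric.thickening (Real.sqrt r) E ∩ T) ≤ A * (κ * volume.real T)
  tube_cover : ∃ 𝕋 : Finset (Set Plane), (∀ T ∈ 𝕋, IsTube r T) ∧
    (𝕋.card : ℝ) ≤
      A * (volume.real (Metric.thickening (Real.sqrt r) E) / (κ * r ^ (3 / 2 : ℝ))) ∧
    E ⊆ ⋃ T ∈ 𝕋, T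

/-- The scales `r_0 < r_1 < ⋯ < r_n = R`, `r_k = R^{2^{-(n-k)}}` for `k ≤ n`. -/
def scale (R : ℝ) (n k : ℕ) : ℝ := R ^ ((2 : ℝ)⁻¹ ^ (n - k))

theorem scale_self (R : ℝ) (n : ℕ) : scale R n n = R := by
  simp [scale]

theorem scale_eq_sqrt {R : ℝ} (hR : 0 ≤ R) {n k : ℕ} (hk : k < n) :
    scale R n k = Real.sqrt (scale R n (k + 1)) := by
  have h : n - k = (n - (k + 1)) + 1 := by omega
  rw [scale, scale, Real.sqrt_eq_rpow, ← Real.rpow_mul hR, h, pow_succ]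
  norm_num

/-- `E` is regular with factors `(κ 1, …, κ n)`, with implied constants at most `A`, where
`r_n = R` and `r_{k-1} = r_k^{1/2}`. The cubes `B_{r_k}` are the cells of the `r_k`-grid.
The uniformity of `|N_{r_{k-1}}(E) ∩ Q|` is asked only of the cells `Q` that meet `E` itself,
which is weaker than asking it of all the cells that meet `N_{r_{k-1}}(E)`. -/
structure IsRegularWithFactors (A R : ℝ) (n : ℕ) (κ : ℕ → ℝ) (E : Set Plane) : Prop where
  kappa_regular : ∀ k ∈ Finset.Icc 1 n, ∀ m : Fin 2 → ℤ,
    (gridCube (scale R n k) m ∩ E).Nonempty →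
      IsKappaRegular A (scale R n k) (κ k) (gridCube (scale R n k) m)
        (E ∩ gridCube (scale R n k) m)
  kappa_mem : ∀ k ∈ Finset.Icc 1 n, κ k ∈ Icc (scale R n k ^ (-(1 / 2) : ℝ)) 1
  uniform : ∀ k ∈ Finset.Icc 1 n, ∀ m m' : Fin 2 → ℤ,
    (gridCube (scale R n k) m ∩ E).Nonempty → (gridCube (scale R n k) m' ∩ E).Nonempty →
      volume.real (Metric.thickening (scale R n (k - 1)) E ∩ gridCube (scale R n k) m) ≤
        A * volume.real (Metric.thickening (scale R n (k - 1)) E ∩ gridCube (scale R n k) m')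

/-! ### Fourier multipliers on `L²(ℝ²)` -/

/-- The Fourier multiplier operator `f ↦ T_m f` on `L²(ℝ²)`, `(T_m f)^(ξ) = m(ξ) f^(ξ)`, in the
normalization `f^(ξ) = ∫ f(x) e^{-i x·ξ} dx`. As `𝓕 f (ξ) = ∫ f(x) e^{-2πi x·ξ} dx`, the symbol
is evaluated at `2πξ`. The side condition holds for every bounded measurable symbol, see
`fourier_multiplierOp`; the value `0` in the other case is never used. -/
def multiplierOp (m : Plane → ℝ) (f : Lp ℂ 2 (volume : Measure Plane)) :
    Lp ℂ 2 (volume : Measure Plane) :=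
  open Classical in
  if h : MemLp (fun ξ : Plane => (m ((2 * Real.pi) • ξ) : ℂ) * (𝓕 f) ξ) 2 volume then
    𝓕⁻ (h.toLp _)
  else 0

theorem fourier_multiplierOp {m : Plane → ℝ} (hm : Measurable m) {C : ℝ}
    (hC : ∀ ξ, |m ξ| ≤ C) (f : Lp ℂ 2 (volume : Measure Plane)) :
    ((𝓕 (multiplierOp m f) : Lp ℂ 2 (volume : Measure Plane)) : Plane → ℂ) =ᵐ[volume]
      fun ξ => (m ((2 * Real.pi) • ξ) : ℂ) * (𝓕 f) ξ := by
  have h : MemLp (fun ξ : Plane => (m ((2 * Real.pi) • ξ) : ℂ) * (𝓕 f) ξ) 2 volume := by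
    refine MemLp.of_le_mul (c := C) (Lp.memLp (𝓕 f)) ?_ ?_
    · refine AEStronglyMeasurable.mul ?_ (Lp.aestronglyMeasurable (𝓕 f))
      exact (Complex.measurable_ofReal.comp
        (hm.comp (measurable_const_smul (2 * Real.pi)))).aestronglyMeasurable
    · filter_upwards with ξ
      rw [norm_mul, Complex.norm_real, Real.norm_eq_abs]
      exact mul_le_mul_of_nonneg_right (hC _) (norm_nonneg _)
  rw [multiplierOp, dif_pos h, FourierTransform.fourier_fourierInv_eq]
  exact h.coeFn_toLp

/-- `a` is a bump function on `[-1,1]`. -/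
structure IsBump (a : ℝ → ℝ) : Prop where
  smooth : ContDiff ℝ ∞ a
  support : tsupport a ⊆ Icc (-1) 1

/-- The smooth restriction `S = S_{1,R}` to the `R⁻¹`-neighbourhood of the unit circle:
`(Sf)^(ξ) = a(R(1 - |ξ|)) f^(ξ)`. -/
def opS (a : ℝ → ℝ) (R : ℝ) (f : Lp ℂ 2 (volume : Measure Plane)) :
    Lp ℂ 2 (volume : Measure Plane) :=
  multiplierOp (fun ξ => a (R * (1 - ‖ξ‖))) f

/-! ### Caps and the broad norm -/

/-- `σ` is a `ρ`-cap: an arc of the unit circle of length `ℓ ∼ ρ` (implied constant `A`). -/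
def IsCap (A ρ : ℝ) (σ : Set Plane) : Prop :=
  ∃ s ℓ : ℝ, A⁻¹ * ρ ≤ ℓ ∧ ℓ ≤ A * ρ ∧ ℓ ≤ 2 * Real.pi ∧
    σ = {x | ∃ t ∈ Icc s (s + ℓ), x = !₂[Real.cos t, Real.sin t]}

/-- The conic region determined by `σ`. -/
def conicRegion (σ : Set Plane) : Set Plane := {ξ | ‖ξ‖⁻¹ • ξ ∈ σ}

/-- `b` is a smooth bump function on the conic region of `σ`. No bounds on derivatives are
imposed, so the constants in a theorem cannot depend on them. -/
structure IsConicBump (σ : Set Plane) (b : Plane → ℝ) : Prop where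
  smooth : ContDiffOn ℝ ∞ b {0}ᶜ
  range : ∀ ξ, b ξ ∈ Icc (0 : ℝ) 1
  support : Function.support b ⊆ conicRegion σ

/-- `σ` comes within distance `δ` of the line spanned by the unit vector `e`, i.e. of `e` or
of `-e`. -/
def IsNearLine (δ : ℝ) (e : Plane) (σ : Set Plane) : Prop :=
  ∃ w ∈ σ, ‖w - e‖ < δ ∨ ‖w + e‖ < δ

/-- `Sig` is a finitely overlapping collection of `ρ`-caps, quantitatively: every line through
the origin is within distance `c ρ` of at most `N` of the caps. -/
structure IsCapFamily (A c : ℝ) (N : ℕ) (ρ : ℝ) (Sig : Finset (Set Plane)) : Prop where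
  isCap : ∀ σ ∈ Sig, IsCap A ρ σ
  overlap : ∀ e : Plane, ‖e‖ = 1 → {σ ∈ (Sig : Set (Set Plane)) | IsNearLine (c * ρ) e σ}.ncard ≤ N

/-- The broad norm `‖g‖_{L²_{br_M}(E)}`, where `g_σ` is the multiplier operator with symbol
`b σ` applied to `g`: the maximum over the subcollections `Σ' ⊆ Σ` with `M` elements of the
minimum over `σ ∈ Σ'` of `‖g_σ‖_{L²(E)}` (it is `0` if `Σ` has fewer than `M` elements). -/
def broadNorm (Sig : Finset (Set Plane)) (b : Set Plane → Plane → ℝ) (M : ℕ)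
    (g : Lp ℂ 2 (volume : Measure Plane)) (E : Set Plane) : ℝ≥0∞ :=
  (Sig.powersetCard M).sup fun Sig' =>
    Sig'.inf fun σ => eLpNorm (multiplierOp (b σ) g) 2 (volume.restrict E)

end

noncomputable section

/-! ### The Fourier transform of square integrable functions -/

section Fourier

open scoped Convolution

variable {E : Type*} [NormedAddCommGroup E] [InnerProductSpace ℝ E] [FiniteDimensional ℝ E]
  [MeasurableSpace E] [BorelSpace E]

/-! Localizing a function to a ball of radius `r` blurs its frequencies by about `1/r`. So the part
of `Sf` seen in an `r_k`-cube has frequencies in an annulus of width `O(1/r_k)`. The proof passes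
from each scale `r` to the scale `√r`: for a function with frequencies in the annulus of width
`O(1/r)`, its mass on those `√r`-cubes inside one `r`-cube that meet `F` is compared with its total
mass. Localization is multiplication by band-limited bumps, and the gains of the single steps
multiply (`sum_setLIntegral_le_prod`).

There are two one-step estimates.

Density (`sum_lintegral_gridBump_le_of_density`): on `√r`-cubes the frequency pieces of side
`r^{-1/2}` are almost orthogonal. Each piece of the annulus lies in an `r^{-1/2} × r^{-1}` rectangle
up to constants, so its inverse transform is essentially constant on the dual `r^{1/2} × r` tubes,
and only the density of the set in tubes matters. The gain is `O(κ)`; the product over the scales is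
the second inequality, and it bounds the broad sums as well.

Transversality (`sum_lintegral_gridBump_le_of_transversal`): if the frequencies make an angle at
least `δ` with a tube, then frequency lines perpendicular to the tube meet the annulus in length
`O(1/(rδ))`. Cauchy-Schwarz on these lines and Plancherel in one variable bound the mass on a strip
of width `O(√r)` by the fraction `O(1/(δ√r))`. Summed over the covering tubes this gives
`O(|N_{√r}(E)| / (δ κ r²))`.

The broad norm makes the second estimate available. Fix for each ball `B` and each scale a covering
tube through `B`. At most `N` caps are near the direction of each of these `n` tubes, so among `M >
N n` caps one is transversal to all of them, with `δ = c / log R`. Finite overlap controls the sum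
over caps. By uniformity the relative volumes telescope over the scales to `|F|/R²` up to `C^n`
(`exists_volume_bounds`), which gives the first inequality. The third is the geometric mean of the
two bounds for the broad sum, in which the `κ` cancel; powers `C^n` are absorbed by powers of `log
R`. -/

theorem integral_fourierInv_mul_eq_flip {f g : E → ℂ} (hf : Integrable f) (hg : Integrable g) :
    ∫ x, 𝓕⁻ f x * g x = ∫ x, f x * 𝓕⁻ g x := by
  have h := VectorFourier.integral_fourierIntegral_smul_eq_flip (μ := (volume : Measure E))
    (ν := (volume : Measure E)) (L := innerₗ E) (f := f) (g := fun x => g (-x))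
    Real.continuous_fourierChar continuous_inner hf hg.comp_neg
  simp only [flip_innerₗ, smul_eq_mul] at h
  calc ∫ x, 𝓕⁻ f x * g x = ∫ x, 𝓕 f x * g (-x) := by
        rw [← integral_neg_eq_self]
        simp [Real.fourierInv_eq_fourier_neg]
    _ = ∫ x, f x * 𝓕 (fun y => g (-y)) x := h
    _ = ∫ x, f x * 𝓕⁻ g x := by rw [← Real.fourierInv_eq_fourier_comp_neg]

theorem continuous_fourierInv_of_integrable {f : E → ℂ} (hf : Integrable f) :
    Continuous (𝓕⁻ f) := by
  rw [Real.fourierInv_eq_fourier_comp_neg]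
  exact VectorFourier.fourierIntegral_continuous Real.continuous_fourierChar
    continuous_inner hf.comp_neg

/-- Both sides have the same integral against every smooth compactly supported function, so they
agree almost everywhere. This links the abstract `L²` transform with the integral formula on which
all later estimates rest. -/
theorem fourierInv_toLp_ae_eq {h : E → ℂ} (h2 : MemLp h 2 volume) (h1 : Integrable h) :
    ((𝓕⁻ (h2.toLp h) : Lp ℂ 2 (volume : Measure E)) : E → ℂ) =ᵐ[volume] 𝓕⁻ h := by
  have key : ((𝓕⁻ (h2.toLp h) : Lp ℂ 2 (volume : Measure E)) : E → ℂ) - 𝓕⁻ h =ᵐ[volume] 0 := by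
    have hloc1 := (Lp.memLp (𝓕⁻ (h2.toLp h) : Lp ℂ 2 (volume : Measure E))).locallyIntegrable
      (by norm_num)
    have hloc2 : LocallyIntegrable (𝓕⁻ h) volume :=
      (continuous_fourierInv_of_integrable h1).locallyIntegrable
    apply ae_eq_zero_of_integral_contDiff_smul_eq_zero (hloc1.sub hloc2)
    intro g g_smooth g_cpt
    have hg₁ : HasCompactSupport (Complex.ofRealCLM ∘ g) := g_cpt.comp_left rfl
    have hg₂ : ContDiff ℝ ∞ (Complex.ofRealCLM ∘ g) := by fun_prop
    set G := hg₁.toSchwartzMap hg₂ with hG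
    have hGv : ∀ x, G x = (g x : ℂ) := fun x => by simp [hG]
    -- Read as a tempered distribution, the `L²` transform can be moved onto the Schwartz function
    -- `G`; the multiplication formula then moves it onto the integrable `h`.
    have e1 : ∫ x, G x • (𝓕⁻ (h2.toLp h) : Lp ℂ 2 (volume : Measure E)) x = ∫ x, G x * 𝓕⁻ h x := by
      rw [← Lp.toTemperedDistribution_apply, ← Lp.fourierInv_toTemperedDistribution_eq,
        TemperedDistribution.fourierInv_apply, Lp.toTemperedDistribution_apply,
        ← integral_fourierInv_mul_eq_flip G.integrable h1]
      refine integral_congr_ae ?_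
      filter_upwards [h2.coeFn_toLp] with x hx
      rw [hx, SchwartzMap.fourierInv_coe, smul_eq_mul]
    simp only [Pi.sub_apply, smul_sub]
    rw [integral_sub]
    · simp only [hGv, smul_eq_mul] at e1
      simp only [Complex.real_smul]
      rw [e1, sub_self]
    · exact hloc1.integrable_smul_left_of_hasCompactSupport g_smooth.continuous g_cpt
    · exact hloc2.integrable_smul_left_of_hasCompactSupport g_smooth.continuous g_cpt
  filter_upwards [key] with x hx
  simpa [sub_eq_zero] using hx

theorem eLpNorm_two_sq {α F : Type*} [MeasurableSpace α] [NormedAddCommGroup F] (f : α → F)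
    (μ : Measure α) : eLpNorm f 2 μ ^ 2 = ∫⁻ x, ‖f x‖ₑ ^ 2 ∂μ := by
  have := eLpNorm_nnreal_pow_eq_lintegral (f := f) (μ := μ) (p := 2) (by norm_num)
  simp only [NNReal.coe_ofNat, ENNReal.rpow_ofNat] at this
  exact_mod_cast this

theorem eLpNorm_fourierInv_Lp (u : Lp ℂ 2 (volume : Measure E)) :
    eLpNorm (𝓕⁻ u : Lp ℂ 2 (volume : Measure E)) 2 volume = eLpNorm u 2 volume := by
  have h : ‖(𝓕⁻ u : Lp ℂ 2 (volume : Measure E))‖ = ‖u‖ := by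
    rw [← Lp.norm_fourier_eq, FourierTransform.fourier_fourierInv_eq]
  rw [Lp.norm_def, Lp.norm_def] at h
  exact (ENNReal.toReal_eq_toReal_iff' (Lp.eLpNorm_ne_top _) (Lp.eLpNorm_ne_top _)).1 h

/-- Plancherel's theorem for functions in `L¹ ∩ L²`. -/
theorem lintegral_enorm_sq_fourierInv {h : E → ℂ} (h2 : MemLp h 2 volume) (h1 : Integrable h) :
    ∫⁻ x, ‖𝓕⁻ h x‖ₑ ^ 2 = ∫⁻ x, ‖h x‖ₑ ^ 2 := by
  rw [← eLpNorm_two_sq, ← eLpNorm_two_sq, ← eLpNorm_congr_ae (fourierInv_toLp_ae_eq h2 h1),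
    eLpNorm_fourierInv_Lp, eLpNorm_congr_ae h2.coeFn_toLp]

theorem integrable_of_memLp_two_of_support {h : E → ℂ} (h2 : MemLp h 2 volume) {s : Set E}
    (hs : Bornology.IsBounded s) (hsupp : Function.support h ⊆ s) : Integrable h := by
  obtain ⟨r, hr⟩ := hs.subset_closedBall 0
  rw [← integrableOn_iff_integrable_of_support_subset (hsupp.trans hr)]
  have : IsFiniteMeasure (volume.restrict (Metric.closedBall (0 : E) r)) :=
    ⟨by simpa using measure_closedBall_lt_top⟩
  exact (h2.restrict _).integrable (by norm_num)

theorem fourierInv_convolution {f g : E → ℂ} (hf : Integrable f) (hg : Integrable g) (x : E) :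
    𝓕⁻ (f ⋆[ContinuousLinearMap.mul ℂ ℂ] g) x = 𝓕⁻ f x * 𝓕⁻ g x := by
  simp only [Real.fourierInv_eq_fourier_neg]
  exact Real.fourier_mul_convolution_eq hf hg _

end Fourier

/-! ### Grids in the plane -/

/-- The factor `3 / 2` is a rational substitute for `√2`; it is the diameter constant of squares
throughout. -/
theorem Plane.norm_le_of_abs_le {x : Plane} {a : ℝ} (ha : ∀ i, |x i| ≤ a) :
    ‖x‖ ≤ 3 / 2 * a := by
  have h0 := ha 0
  have h1 := ha 1
  have ha0 : 0 ≤ a := (abs_nonneg _).trans h0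
  rw [EuclideanSpace.norm_eq, Fin.sum_univ_two, Real.norm_eq_abs, Real.norm_eq_abs]
  apply Real.sqrt_le_iff.2 ⟨by positivity, ?_⟩
  have := pow_le_pow_left₀ (abs_nonneg _) h0 2
  have := pow_le_pow_left₀ (abs_nonneg _) h1 2
  nlinarith

theorem Plane.abs_apply_le_norm (x : Plane) (i : Fin 2) : |x i| ≤ ‖x‖ := by
  simpa using PiLp.norm_apply_le x i

/-- The lower left corner of a grid cube. -/
def gridCorner (ρ : ℝ) (m : Fin 2 → ℤ) : Plane := WithLp.toLp 2 fun i => ρ * (m i : ℝ)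

@[simp]
theorem gridCorner_apply (ρ : ℝ) (m : Fin 2 → ℤ) (i : Fin 2) :
    gridCorner ρ m i = ρ * (m i : ℝ) := rfl

theorem gridCorner_mem {ρ : ℝ} (hρ : 0 < ρ) (m : Fin 2 → ℤ) : gridCorner ρ m ∈ gridCube ρ m :=
  fun i => ⟨le_rfl, by simp only [gridCorner_apply]; nlinarith⟩

theorem gridCube_eq_square (ρ : ℝ) (m : Fin 2 → ℤ) :
    gridCube ρ m = square (gridCorner ρ m) ρ := by
  ext x
  simp [gridCube, square, mul_add]

theorem exists_mem_gridCube {ρ : ℝ} (hρ : 0 < ρ) (x : Plane) : ∃ m, x ∈ gridCube ρ m := by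
  refine ⟨fun i => ⌊x i / ρ⌋, fun i => ⟨?_, ?_⟩⟩
  · have := Int.floor_le (x i / ρ)
    rw [le_div_iff₀ hρ] at this
    linarith
  · have := Int.lt_floor_add_one (x i / ρ)
    rw [div_lt_iff₀ hρ] at this
    linarith

theorem eq_floor_of_mem_gridCube {ρ : ℝ} (hρ : 0 < ρ) {x : Plane} {m : Fin 2 → ℤ}
    (hx : x ∈ gridCube ρ m) (i : Fin 2) : m i = ⌊x i / ρ⌋ := by
  symm
  rw [Int.floor_eq_iff, le_div_iff₀ hρ, div_lt_iff₀ hρ]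
  have := hx i
  constructor <;> linarith

theorem gridCube_index_unique {ρ : ℝ} (hρ : 0 < ρ) {x : Plane} {m m' : Fin 2 → ℤ}
    (hx : x ∈ gridCube ρ m) (hx' : x ∈ gridCube ρ m') : m = m' :=
  funext fun i => by rw [eq_floor_of_mem_gridCube hρ hx, eq_floor_of_mem_gridCube hρ hx']

theorem pairwise_disjoint_gridCube {ρ : ℝ} (hρ : 0 < ρ) :
    Pairwise (Function.onFun Disjoint (gridCube ρ)) := by
  intro m m' hne
  rw [Function.onFun, Set.disjoint_left]
  exact fun x hx hx' => hne (gridCube_index_unique hρ hx hx')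

theorem measurableSet_square (c : Plane) (r : ℝ) : MeasurableSet (square c r) := by
  rw [square, ofPred_forall]
  refine MeasurableSet.iInter fun i => ?_
  have h : Measurable fun x : Plane => x i := by fun_prop
  exact (measurableSet_le measurable_const h).inter (measurableSet_lt h measurable_const)

theorem measurableSet_gridCube (ρ : ℝ) (m : Fin 2 → ℤ) : MeasurableSet (gridCube ρ m) := by
  rw [gridCube_eq_square]
  exact measurableSet_square _ _

theorem volume_square (c : Plane) {r : ℝ} (hr : 0 ≤ r) :
    volume (square c r) = ENNReal.ofReal (r ^ 2) := by
  have h := (EuclideanSpace.volume_preserving_symm_measurableEquiv_toLp (Fin 2)).measure_preimage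
    (s := Set.univ.pi fun i => Ico (c i) (c i + r))
    (MeasurableSet.univ_pi fun i => measurableSet_Ico).nullMeasurableSet
  rw [Real.volume_pi_Ico] at h
  have e : square c r = (MeasurableEquiv.toLp 2 (Fin 2 → ℝ)).symm ⁻¹'
      (Set.univ.pi fun i => Ico (c i) (c i + r)) := by
    ext x
    simp [square, Set.mem_pi]
  rw [e, h]
  simp [← ENNReal.ofReal_mul hr, sq]

theorem dist_le_of_mem_square {c : Plane} {r : ℝ} {x y : Plane} (hx : x ∈ square c r)
    (hy : y ∈ square c r) : ‖x - y‖ ≤ 3 / 2 * r := by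
  refine Plane.norm_le_of_abs_le fun i => ?_
  have := hx i
  have := hy i
  rw [PiLp.sub_apply, abs_le]
  constructor <;> linarith

theorem dist_le_of_mem_gridCube {ρ : ℝ} {m : Fin 2 → ℤ} {x y : Plane} (hx : x ∈ gridCube ρ m)
    (hy : y ∈ gridCube ρ m) : ‖x - y‖ ≤ 3 / 2 * ρ := by
  rw [gridCube_eq_square] at hx hy
  exact dist_le_of_mem_square hx hy

/-- The indices of the cubes of the grid near a ball. -/
def nearbyIndices (ρ : ℝ) (x : Plane) (t : ℝ) : Finset (Fin 2 → ℤ) :=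
  Fintype.piFinset fun i => Finset.Icc ⌊(x i - t) / ρ⌋ ⌊(x i + t) / ρ⌋

theorem mem_nearbyIndices {ρ : ℝ} (hρ : 0 < ρ) {x y : Plane} {t : ℝ} {m : Fin 2 → ℤ}
    (hy : y ∈ gridCube ρ m) (hxy : ‖y - x‖ ≤ t) : m ∈ nearbyIndices ρ x t := by
  rw [nearbyIndices, Fintype.mem_piFinset]
  intro i
  have h := (Plane.abs_apply_le_norm (y - x) i).trans hxy
  rw [PiLp.sub_apply, abs_le] at h
  rw [Finset.mem_Icc, eq_floor_of_mem_gridCube hρ hy i]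
  constructor <;> apply Int.floor_le_floor <;> gcongr <;> linarith

theorem card_nearbyIndices_le {ρ : ℝ} (hρ : 0 < ρ) (x : Plane) :
    (nearbyIndices ρ x (2 * ρ)).card ≤ 36 := by
  rw [nearbyIndices, Fintype.card_piFinset, Fin.prod_univ_two]
  have key : ∀ i, (Finset.Icc ⌊(x i - 2 * ρ) / ρ⌋ ⌊(x i + 2 * ρ) / ρ⌋).card ≤ 6 := by
    intro i
    have h1 : (x i - 2 * ρ) / ρ = x i / ρ - (2 : ℤ) := by
      push_cast
      field_simp
    have h2 : (x i + 2 * ρ) / ρ = x i / ρ + (2 : ℤ) := by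
      push_cast
      field_simp
    rw [Int.card_Icc, h1, h2, Int.floor_sub_intCast, Int.floor_add_intCast]
    omega
  exact Nat.mul_le_mul (key 0) (key 1)

theorem finite_setOf_gridCube_inter_nonempty {ρ : ℝ} (hρ : 0 < ρ) {s : Set Plane}
    (hs : Bornology.IsBounded s) : {m | (gridCube ρ m ∩ s).Nonempty}.Finite := by
  obtain ⟨t, ht⟩ := hs.subset_closedBall 0
  refine (nearbyIndices ρ 0 t).finite_toSet.subset ?_
  rintro m ⟨y, hy, hys⟩
  exact mem_nearbyIndices hρ hy (by simpa using ht hys)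

/-- In each coordinate one steps from `x` towards the far side of the cube, so a square with corner
near the boundary still fits. -/
theorem exists_square_subset_gridCube_inter_ball {ρ r : ℝ} (hρ : 0 < ρ) (hr : ρ ≤ r) {x : Plane}
    {m : Fin 2 → ℤ} (hx : x ∈ gridCube r m) :
    ∃ c, square c (ρ / 2) ⊆ gridCube r m ∩ Metric.ball x ρ := by
  refine ⟨WithLp.toLp 2 fun i => if x i - r * m i < r / 2 then x i else x i - ρ / 2,
    fun y hy => ⟨fun i => ?_, ?_⟩⟩
  · have h1 := hy i
    have h2 := hx i
    simp only at h1
    split_ifs at h1 <;> constructor <;> linarith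
  · rw [Metric.mem_ball, dist_eq_norm]
    have : ‖y - x‖ ≤ 3 / 2 * (ρ / 2) := by
      refine Plane.norm_le_of_abs_le fun i => ?_
      have h1 := hy i
      simp only at h1
      rw [PiLp.sub_apply, abs_le]
      split_ifs at h1 <;> constructor <;> linarith
    linarith

theorem le_volume_gridCube_inter_ball {ρ r : ℝ} (hρ : 0 < ρ) (hr : ρ ≤ r) {x : Plane}
    {m : Fin 2 → ℤ} (hx : x ∈ gridCube r m) :
    ENNReal.ofReal (ρ ^ 2 / 4) ≤ volume (gridCube r m ∩ Metric.ball x ρ) := by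
  obtain ⟨c, hc⟩ := exists_square_subset_gridCube_inter_ball hρ hr hx
  refine le_trans (le_of_eq ?_) (measure_mono hc)
  rw [volume_square c (by positivity)]
  congr 1
  ring

/-- A cube that meets `E` contains a fixed proportion of a ball around a point of `E`. With `r = ρ`
this is the mass hypothesis under which sums of bumps over such cubes are estimated. -/
theorem le_volume_thickening_inter_gridCube {ρ r : ℝ} (hρ : 0 < ρ) (hr : ρ ≤ r) {E : Set Plane}
    {m : Fin 2 → ℤ} (h : (gridCube r m ∩ E).Nonempty) :
    ENNReal.ofReal (ρ ^ 2 / 4) ≤ volume (Metric.thickening ρ E ∩ gridCube r m) := by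
  obtain ⟨x, hx, hxE⟩ := h
  refine (le_volume_gridCube_inter_ball hρ hr hx).trans (measure_mono ?_)
  rw [inter_comm]
  exact inter_subset_inter_left _ (Metric.ball_subset_thickening hxE ρ)

/-- If a set `S` has mass at least `α` in every ball of radius `ρ` centred at a point of `P`,
then the volume of `P` is controlled by that of `S`. -/
theorem mul_volume_le_of_le_volume_inter_ball {P S : Set Plane} (hP : MeasurableSet P)
    {α : ℝ≥0∞} {ρ : ℝ}
    (h : ∀ z ∈ P, α ≤ volume (S ∩ Metric.ball z ρ)) :
    α * volume P ≤ volume (Metric.ball (0 : Plane) ρ) * volume S := by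
  calc α * volume P = ∫⁻ _ in P, α := by simp
    _ ≤ ∫⁻ z in P, volume (S ∩ Metric.ball z ρ) := setLIntegral_mono' hP h
    _ ≤ ∫⁻ z, volume (S ∩ Metric.ball z ρ) := setLIntegral_le_lintegral _ _
    _ = ∫⁻ z, ∫⁻ y in S, {p : Plane × Plane | dist p.2 p.1 < ρ}.indicator 1 (z, y) := by
        congr with z
        rw [inter_comm, ← Measure.restrict_apply Metric.isOpen_ball.measurableSet,
          ← lintegral_indicator_one Metric.isOpen_ball.measurableSet]
        rfl
    _ = ∫⁻ y in S, ∫⁻ z, {p : Plane × Plane | dist p.2 p.1 < ρ}.indicator 1 (z, y) := by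
        refine lintegral_lintegral_swap (Measurable.aemeasurable ?_)
        exact measurable_one.indicator
          (measurableSet_lt (by fun_prop) measurable_const)
    _ = ∫⁻ y in S, volume (Metric.ball (0 : Plane) ρ) := by
        congr with y
        rw [← Measure.addHaar_ball_center volume y,
          ← lintegral_indicator_one Metric.isOpen_ball.measurableSet]
        congr with z
        simp [indicator, dist_comm]
    _ = volume (Metric.ball (0 : Plane) ρ) * volume S := by simp

theorem volume_ball_le (x : Plane) {r : ℝ} (hr : 0 ≤ r) :
    volume (Metric.ball x r) ≤ ENNReal.ofReal (4 * r ^ 2) := by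
  rw [EuclideanSpace.volume_ball_fin_two, ← ENNReal.ofReal_pow hr,
    ← ENNReal.ofReal_mul (by positivity)]
  apply ENNReal.ofReal_le_ofReal
  nlinarith [Real.pi_lt_four, sq_nonneg r]

/-! ### Sums of bumps adapted to grid cubes -/

/-- The rapidly decaying weight `(1 + ‖x‖)⁻⁴`. -/
def tailWeight (x : Plane) : ℝ≥0∞ := ENNReal.ofReal ((1 + ‖x‖) ^ (-4 : ℝ))

/-- The total mass of `tailWeight`. -/
def tailMass : ℝ≥0∞ := ∫⁻ x, tailWeight x

theorem tailMass_lt_top : tailMass < ⊤ :=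
  finite_integral_one_add_norm (by simp; norm_num)

theorem measurable_tailWeight : Measurable tailWeight := by
  unfold tailWeight
  fun_prop

theorem lintegral_comp_inv_smul {f : Plane → ℝ≥0∞} (hf : Measurable f) {ρ : ℝ} (hρ : 0 < ρ) :
    ∫⁻ x, f (ρ⁻¹ • x) = ENNReal.ofReal (ρ ^ 2) * ∫⁻ x, f x := by
  rw [← lintegral_map hf (measurable_const_smul _),
    Measure.map_addHaar_smul _ (inv_ne_zero hρ.ne'), lintegral_smul_measure]
  simp [abs_of_pos hρ]

theorem tailWeight_le_of_norm_sub_le {x y : Plane} (h : ‖x - y‖ ≤ 3 / 2) :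
    tailWeight x ≤ 81 * tailWeight y := by
  have h1 : (1 + ‖y‖) / 3 ≤ 1 + ‖x‖ := by
    have : ‖y‖ ≤ ‖x‖ + ‖x - y‖ := by
      rw [norm_sub_rev]
      simpa using norm_add_le x (y - x)
    linarith [norm_nonneg x]
  have h2 : (1 + ‖x‖) ^ (-4 : ℝ) ≤ ((1 + ‖y‖) / 3) ^ (-4 : ℝ) :=
    Real.rpow_le_rpow_of_nonpos (by positivity) h1 (by norm_num)
  have h3 : ((1 + ‖y‖) / 3) ^ (-4 : ℝ) = 81 * (1 + ‖y‖) ^ (-4 : ℝ) := by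
    rw [Real.div_rpow (by positivity) (by norm_num), Real.rpow_neg (by norm_num : (0 : ℝ) ≤ 3)]
    norm_num
    ring
  calc tailWeight x ≤ ENNReal.ofReal (81 * (1 + ‖y‖) ^ (-4 : ℝ)) :=
        ENNReal.ofReal_le_ofReal (h2.trans h3.le)
    _ = 81 * tailWeight y := by
        rw [ENNReal.ofReal_mul (by norm_num), tailWeight]
        norm_num

/-- The function `φ` adapted to the cube of side `ρ` with index `m`. -/
def gridBump (φ : Plane → ℂ) (ρ : ℝ) (m : Fin 2 → ℤ) (x : Plane) : ℂ :=
  φ (ρ⁻¹ • (x - gridCorner ρ m))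

/-- A sum of rapidly decaying bumps adapted to grid cubes in which `P` has large density has an
integral controlled by the measures of the translates of `P`. -/
theorem lintegral_sum_gridBump_le {φ : Plane → ℂ} {D : ℝ≥0∞}
    (hφ : ∀ x, ‖φ x‖ₑ ^ 2 ≤ D * tailWeight x) {ρ : ℝ} (hρ : 0 < ρ) {P : Set Plane}
    (hP : MeasurableSet P) (S : Finset (Fin 2 → ℤ))
    (hS : ∀ m ∈ S, ENNReal.ofReal (ρ ^ 2 / 4) ≤ volume (P ∩ gridCube ρ m))
    (μ : Measure Plane) [SFinite μ] {Λ : ℝ≥0∞} (hΛ : ∀ z, μ {x | x - z ∈ P} ≤ Λ) :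
    ∫⁻ x, ∑ m ∈ S, ‖gridBump φ ρ m x‖ₑ ^ 2 ∂μ ≤ 324 * D * tailMass * Λ := by
  set a : ℝ≥0∞ := ENNReal.ofReal (ρ ^ 2 / 4) with ha
  have ha0 : a ≠ 0 := by
    rw [ha, Ne, ENNReal.ofReal_eq_zero, not_le]
    positivity
  have hat : a ≠ ⊤ := ENNReal.ofReal_ne_top
  -- `P` has mass at least `ρ² / 4` in each cube of `S` and the weight varies by a bounded factor
  -- over a cube, so each bump is dominated by an average of weights centred in `P`. The cubes are
  -- disjoint, so the averages add up to one integral over `P`.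
  have step1 : ∀ x, a * ∑ m ∈ S, ‖gridBump φ ρ m x‖ₑ ^ 2 ≤
      81 * D * ∫⁻ y in P, tailWeight (ρ⁻¹ • (x - y)) := by
    intro x
    have hm : ∀ m ∈ S, a * ‖gridBump φ ρ m x‖ₑ ^ 2 ≤
        81 * D * ∫⁻ y in P ∩ gridCube ρ m, tailWeight (ρ⁻¹ • (x - y)) := by
      intro m hmS
      have hmeas : MeasurableSet (P ∩ gridCube ρ m) := hP.inter (measurableSet_gridCube ρ m)
      calc a * ‖gridBump φ ρ m x‖ₑ ^ 2
          ≤ volume (P ∩ gridCube ρ m) * (D * tailWeight (ρ⁻¹ • (x - gridCorner ρ m))) :=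
            mul_le_mul' (hS m hmS) (hφ _)
        _ = ∫⁻ y in P ∩ gridCube ρ m, D * tailWeight (ρ⁻¹ • (x - gridCorner ρ m)) := by
            rw [setLIntegral_const, mul_comm]
        _ ≤ ∫⁻ y in P ∩ gridCube ρ m, 81 * D * tailWeight (ρ⁻¹ • (x - y)) := by
            refine setLIntegral_mono' hmeas fun y hy => ?_
            have : tailWeight (ρ⁻¹ • (x - gridCorner ρ m)) ≤ 81 * tailWeight (ρ⁻¹ • (x - y)) := by
              apply tailWeight_le_of_norm_sub_le
              rw [← smul_sub, sub_sub_sub_cancel_left, norm_smul, norm_inv, Real.norm_eq_abs,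
                abs_of_pos hρ, inv_mul_le_iff₀ hρ, mul_comm]
              exact dist_le_of_mem_gridCube hy.2 (gridCorner_mem hρ m)
            calc _ ≤ D * (81 * tailWeight (ρ⁻¹ • (x - y))) := by gcongr
              _ = _ := by ring
        _ = _ := lintegral_const_mul _ (measurable_tailWeight.comp (by fun_prop))
    calc a * ∑ m ∈ S, ‖gridBump φ ρ m x‖ₑ ^ 2
        ≤ ∑ m ∈ S, 81 * D * ∫⁻ y in P ∩ gridCube ρ m, tailWeight (ρ⁻¹ • (x - y)) := by
          rw [Finset.mul_sum]
          exact Finset.sum_le_sum hm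
      _ = 81 * D * ∫⁻ y in ⋃ m ∈ S, P ∩ gridCube ρ m, tailWeight (ρ⁻¹ • (x - y)) := by
          rw [← Finset.mul_sum, lintegral_biUnion_finset]
          · intro m _ m' _ hne
            exact (pairwise_disjoint_gridCube hρ hne).mono inter_subset_right inter_subset_right
          · exact fun m _ => hP.inter (measurableSet_gridCube ρ m)
      _ ≤ _ := by
          gcongr
          exact iUnion₂_subset fun m _ => inter_subset_left
  -- With `z = x - y` the inner integral becomes a weighted integral over `z` of indicators of the
  -- sets `{x | x - z ∈ P}`, whose measures are at most `Λ`.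
  have step2 : ∫⁻ x, (∫⁻ y in P, tailWeight (ρ⁻¹ • (x - y))) ∂μ ≤
      ENNReal.ofReal (ρ ^ 2) * tailMass * Λ := by
    have hmeas : MeasurableSet {p : Plane × Plane | p.1 - p.2 ∈ P} :=
      measurableSet_preimage (by fun_prop) hP
    calc ∫⁻ x, (∫⁻ y in P, tailWeight (ρ⁻¹ • (x - y))) ∂μ
        = ∫⁻ x, (∫⁻ z, {p : Plane × Plane | p.1 - p.2 ∈ P}.indicator 1 (x, z) *
            tailWeight (ρ⁻¹ • z)) ∂μ := by
          congr with x
          rw [← lintegral_indicator hP, ← lintegral_sub_left_eq_self _ x]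
          congr with z
          by_cases hz : x - z ∈ P <;> simp [hz]
      _ = ∫⁻ z, (∫⁻ x, {p : Plane × Plane | p.1 - p.2 ∈ P}.indicator 1 (x, z) *
            tailWeight (ρ⁻¹ • z) ∂μ) := by
          refine lintegral_lintegral_swap (Measurable.aemeasurable ?_)
          exact (measurable_one.indicator hmeas).mul
            (measurable_tailWeight.comp (by fun_prop))
      _ ≤ ∫⁻ z, Λ * tailWeight (ρ⁻¹ • z) := by
          refine lintegral_mono fun z => ?_
          have hmz : MeasurableSet {x | x - z ∈ P} := measurableSet_preimage (by fun_prop) hP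
          rw [lintegral_mul_const]
          · gcongr
            refine le_trans (le_of_eq ?_) (hΛ z)
            rw [← lintegral_indicator_one hmz]
            rfl
          · exact (measurable_one.indicator hmeas).comp (by fun_prop)
      _ = _ := by
          rw [lintegral_const_mul _ (f := fun z : Plane => tailWeight (ρ⁻¹ • z))
              (measurable_tailWeight.comp (by fun_prop)),
            lintegral_comp_inv_smul measurable_tailWeight hρ, tailMass]
          ring
  have h4 : ENNReal.ofReal (ρ ^ 2) = a * 4 := by
    rw [ha, ← ENNReal.ofReal_ofNat 4, ← ENNReal.ofReal_mul (by positivity)]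
    congr 1
    ring
  have step3 : a * ∫⁻ x, ∑ m ∈ S, ‖gridBump φ ρ m x‖ₑ ^ 2 ∂μ ≤
      a * (324 * D * tailMass * Λ) := by
    calc a * ∫⁻ x, ∑ m ∈ S, ‖gridBump φ ρ m x‖ₑ ^ 2 ∂μ
        = ∫⁻ x, a * ∑ m ∈ S, ‖gridBump φ ρ m x‖ₑ ^ 2 ∂μ := (lintegral_const_mul' _ _ hat).symm
      _ ≤ ∫⁻ x, 81 * D * (∫⁻ y in P, tailWeight (ρ⁻¹ • (x - y))) ∂μ := lintegral_mono step1
      _ = 81 * D * ∫⁻ x, (∫⁻ y in P, tailWeight (ρ⁻¹ • (x - y))) ∂μ := by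
          refine lintegral_const_mul _ ?_
          refine Measurable.lintegral_prod_right' (f := fun p : Plane × Plane =>
            tailWeight (ρ⁻¹ • (p.1 - p.2))) (measurable_tailWeight.comp (by fun_prop))
      _ ≤ 81 * D * (ENNReal.ofReal (ρ ^ 2) * tailMass * Λ) := by gcongr
      _ = a * (324 * D * tailMass * Λ) := by
          rw [h4]
          ring
  exact (ENNReal.mul_le_mul_iff_right ha0 hat).1 step3

/-! ### Localization by band-limited bumps -/

/-- Where the phase is at most `1`, the real part of the exponential is at least `1 - 1/2`, so there
is little cancellation. -/
theorem half_integral_le_norm_integral_exp {α : Type*} [MeasurableSpace α] {μ : Measure α}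
    {θ u : α → ℝ} (hu : Integrable u μ) (hu0 : ∀ x, 0 ≤ u x) (hθm : AEStronglyMeasurable θ μ)
    (hθ : ∀ x, u x ≠ 0 → |θ x| ≤ 1) :
    (∫ x, u x ∂μ) / 2 ≤ ‖∫ x, Complex.exp (θ x * Complex.I) * (u x : ℂ) ∂μ‖ := by
  have hint : Integrable (fun x => Complex.exp (θ x * Complex.I) * (u x : ℂ)) μ := by
    refine Integrable.bdd_mul (c := 1) hu.ofReal ?_ ?_
    · exact Complex.continuous_exp.comp_aestronglyMeasurable
        ((Complex.continuous_ofReal.comp_aestronglyMeasurable hθm).mul_const _)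
    · exact Filter.Eventually.of_forall fun x => (Complex.norm_exp_ofReal_mul_I _).le
  calc (∫ x, u x ∂μ) / 2 = ∫ x, u x / 2 ∂μ := (integral_div _ _).symm
    _ ≤ ∫ x, (Complex.exp (θ x * Complex.I) * (u x : ℂ)).re ∂μ := by
        refine integral_mono (hu.div_const 2) hint.re fun x => ?_
        simp only [Complex.re_mul_ofReal, Complex.exp_ofReal_mul_I_re]
        by_cases h0 : u x = 0
        · simp [h0]
        · have h1 := Real.one_sub_sq_div_two_le_cos (x := θ x)
          have h2 : θ x ^ 2 ≤ 1 := (sq_le_one_iff_abs_le_one _).2 (hθ x h0)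
          nlinarith [hu0 x]
    _ = (∫ x, Complex.exp (θ x * Complex.I) * (u x : ℂ) ∂μ).re := integral_re hint
    _ ≤ _ := Complex.re_le_norm _

/-- There is a function with Fourier support in a small ball which is at least one on a large
ball and decays rapidly. -/
theorem exists_bandlimited_bump : ∃ Φ : Plane → ℂ, Continuous Φ ∧ HasCompactSupport Φ ∧
    Function.support Φ ⊆ Metric.closedBall 0 (1 / 100) ∧
    (∀ x, ‖x‖ ≤ 10 → 1 ≤ ‖𝓕⁻ Φ x‖ₑ ^ 2) ∧
    ∃ D : ℝ≥0∞, D ≠ ⊤ ∧ ∀ x, ‖𝓕⁻ Φ x‖ₑ ^ 2 ≤ D * tailWeight x := by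
  -- The radius `1 / 100` keeps the phase below `1` for `‖x‖ ≤ 10`, and leaves room for the
  -- frequency enlargements of successive localizations, see `inv_add_inv_sqrt_le`.
  let f : ContDiffBump (0 : Plane) := ⟨1 / 200, 1 / 100, by norm_num, by norm_num⟩
  set J := ∫ x, f x with hJ
  have hJ0 : 0 < J := f.integral_pos
  -- The total mass is `2`, so that half of it, the lower bound for the inverse transform, is `1`.
  set u : Plane → ℝ := fun x => 2 / J * f x with hu
  have hu0 : ∀ x, 0 ≤ u x := fun x => mul_nonneg (by positivity) f.nonneg
  have hui : Integrable u := (f.continuous.integrable_of_hasCompactSupport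
    f.hasCompactSupport).const_mul _
  have hus : ∀ x, u x ≠ 0 → ‖x‖ ≤ 1 / 100 := by
    intro x hx
    have : x ∈ Function.support f := fun h => hx (by simp [hu, h])
    rw [f.support_eq, mem_ball_zero_iff] at this
    exact this.le
  set Φ : Plane → ℂ := fun x => (u x : ℂ) with hΦ
  have hucont : ContDiff ℝ ∞ u := contDiff_const.mul f.contDiff
  have hcomp : HasCompactSupport Φ := by
    apply HasCompactSupport.comp_left (g := fun t : ℝ => ((2 / J * t : ℝ) : ℂ))
      f.hasCompactSupport
    simp
  have hsmooth : ContDiff ℝ ∞ Φ := Complex.ofRealCLM.contDiff.comp hucont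
  refine ⟨Φ, hsmooth.continuous, hcomp, ?_, ?_, ?_⟩
  · intro x hx
    rw [mem_closedBall_zero_iff]
    exact hus x fun h => hx (by simp [hΦ, h])
  · intro x hx
    have h := half_integral_le_norm_integral_exp (μ := volume)
      (θ := fun v : Plane => 2 * Real.pi * inner ℝ v x) hui hu0
      (by fun_prop) fun v hv => by
        have h1 := abs_real_inner_le_norm v x
        have h2 : ‖v‖ * ‖x‖ ≤ 1 / 100 * 10 :=
          mul_le_mul (hus v hv) hx (norm_nonneg _) (by norm_num)
        rw [abs_mul, abs_of_pos (by positivity : 0 < 2 * Real.pi)]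
        nlinarith [Real.pi_pos, Real.pi_lt_four]
    have hJu : ∫ v, u v = 2 := by
      rw [hu, integral_const_mul, ← hJ]
      field_simp
    rw [hJu] at h
    have h3 : (1 : ℝ) ≤ ‖𝓕⁻ Φ x‖ := by
      rw [Real.fourierInv_eq']
      simpa using h
    rw [← ofReal_norm]
    exact one_le_pow₀ (ENNReal.one_le_ofReal.2 h3)
  · set G := hcomp.toSchwartzMap hsmooth with hG
    have hGΦ : 𝓕⁻ Φ = (𝓕⁻ G : SchwartzMap Plane ℂ) := by
      rw [SchwartzMap.fourierInv_coe]
      rfl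
    set B := 2 ^ 2 * ((Finset.Iic (2, 0)).sup fun m => SchwartzMap.seminorm ℝ m.1 m.2)
      (𝓕⁻ G : SchwartzMap Plane ℂ) with hB
    refine ⟨ENNReal.ofReal (B ^ 2), ENNReal.ofReal_ne_top, fun x => ?_⟩
    have h := SchwartzMap.one_add_le_sup_seminorm_apply (𝕜 := ℝ) (m := (2, 0)) (k := 2) (n := 0)
      le_rfl le_rfl (𝓕⁻ G : SchwartzMap Plane ℂ) x
    rw [norm_iteratedFDeriv_zero] at h
    rw [hGΦ, tailWeight, ← ENNReal.ofReal_mul (by positivity), ← ofReal_norm,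
      ← ENNReal.ofReal_pow (norm_nonneg _)]
    apply ENNReal.ofReal_le_ofReal
    have hp : (0 : ℝ) < 1 + ‖x‖ := by positivity
    rw [Real.rpow_neg hp.le, ← div_eq_mul_inv, le_div_iff₀ (by positivity)]
    have := pow_le_pow_left₀ (by positivity) h 2
    calc _ = ((1 + ‖x‖) ^ 2 * ‖(𝓕⁻ G : SchwartzMap Plane ℂ) x‖) ^ 2 := by
          norm_cast
          ring
      _ ≤ _ := this

/-- A function supported in a small ball whose inverse Fourier transform is large near `0`. -/
def bumpFreq : Plane → ℂ := exists_bandlimited_bump.choose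

/-- The inverse Fourier transform of `bumpFreq`. -/
def bumpPhys : Plane → ℂ := 𝓕⁻ bumpFreq

theorem continuous_bumpFreq : Continuous bumpFreq := exists_bandlimited_bump.choose_spec.1

theorem hasCompactSupport_bumpFreq : HasCompactSupport bumpFreq :=
  exists_bandlimited_bump.choose_spec.2.1

theorem support_bumpFreq : Function.support bumpFreq ⊆ Metric.closedBall 0 (1 / 100) :=
  exists_bandlimited_bump.choose_spec.2.2.1

theorem one_le_enorm_bumpPhys {x : Plane} (hx : ‖x‖ ≤ 10) : 1 ≤ ‖bumpPhys x‖ₑ ^ 2 :=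
  exists_bandlimited_bump.choose_spec.2.2.2.1 x hx

/-- The constant in the decay estimate for `bumpPhys`. -/
def bumpDecay : ℝ≥0∞ := exists_bandlimited_bump.choose_spec.2.2.2.2.choose

theorem bumpDecay_ne_top : bumpDecay ≠ ⊤ :=
  exists_bandlimited_bump.choose_spec.2.2.2.2.choose_spec.1

theorem enorm_bumpPhys_sq_le (x : Plane) : ‖bumpPhys x‖ₑ ^ 2 ≤ bumpDecay * tailWeight x :=
  exists_bandlimited_bump.choose_spec.2.2.2.2.choose_spec.2 x

theorem continuous_bumpPhys : Continuous bumpPhys :=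
  continuous_fourierInv_of_integrable
    (continuous_bumpFreq.integrable_of_hasCompactSupport hasCompactSupport_bumpFreq)

/-- The function whose inverse Fourier transform is the bump adapted to a grid cube. -/
def gridFreq (ρ : ℝ) (m : Fin 2 → ℤ) (η : Plane) : ℂ :=
  (ρ ^ 2 : ℝ) • (Complex.exp (↑(-(2 * Real.pi * inner ℝ η (gridCorner ρ m))) * Complex.I) *
    bumpFreq (ρ • η))

theorem continuous_gridFreq (ρ : ℝ) (m : Fin 2 → ℤ) : Continuous (gridFreq ρ m) := by
  have := continuous_bumpFreq
  unfold gridFreq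
  fun_prop

theorem support_gridFreq {ρ : ℝ} (hρ : 0 < ρ) (m : Fin 2 → ℤ) :
    Function.support (gridFreq ρ m) ⊆ Metric.closedBall 0 (1 / 100 / ρ) := by
  intro η hη
  have : ρ • η ∈ Function.support bumpFreq := fun h => hη (by simp [gridFreq, h])
  have := support_bumpFreq this
  rw [mem_closedBall_zero_iff, norm_smul, Real.norm_eq_abs, abs_of_pos hρ] at this
  rw [mem_closedBall_zero_iff, le_div_iff₀ hρ]
  linarith

theorem hasCompactSupport_gridFreq {ρ : ℝ} (hρ : 0 < ρ) (m : Fin 2 → ℤ) :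
    HasCompactSupport (gridFreq ρ m) :=
  HasCompactSupport.of_support_subset_isCompact (isCompact_closedBall _ _) (support_gridFreq hρ m)

theorem integrable_gridFreq {ρ : ℝ} (hρ : 0 < ρ) (m : Fin 2 → ℤ) : Integrable (gridFreq ρ m) :=
  (continuous_gridFreq ρ m).integrable_of_hasCompactSupport (hasCompactSupport_gridFreq hρ m)

theorem fourierInv_gridFreq {ρ : ℝ} (hρ : 0 < ρ) (m : Fin 2 → ℤ) (x : Plane) :
    𝓕⁻ (gridFreq ρ m) x = gridBump bumpPhys ρ m x := by
  rw [gridBump, bumpPhys, Real.fourierInv_eq', Real.fourierInv_eq']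
  set F : Plane → ℂ := fun v =>
    Complex.exp (↑(2 * Real.pi * inner ℝ v (ρ⁻¹ • (x - gridCorner ρ m))) * Complex.I) •
      bumpFreq v with hF
  have h := Measure.integral_comp_smul (volume : Measure Plane) F ρ
  have hd : Module.finrank ℝ Plane = 2 := by simp
  rw [hd, abs_of_pos (by positivity)] at h
  have h2 : ∫ v, F v = (ρ ^ 2) • ∫ v, F (ρ • v) := by
    rw [h, smul_smul, mul_inv_cancel₀ (by positivity), one_smul]
  rw [h2, ← integral_smul]
  congr with v
  simp only [hF, gridFreq, smul_eq_mul, Complex.real_smul]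
  rw [inner_smul_left, inner_smul_right, inner_sub_right]
  have e : (2 * Real.pi * inner ℝ v x : ℝ) + -(2 * Real.pi * inner ℝ v (gridCorner ρ m)) =
      2 * Real.pi * ((starRingEnd ℝ) ρ * (ρ⁻¹ * (inner ℝ v x - inner ℝ v (gridCorner ρ m)))) := by
    simp only [conj_trivial]
    field_simp
    ring
  rw [← e, Complex.ofReal_add, add_mul, Complex.exp_add]
  ring

/-! ### Functions with bounded frequency support, and localization on the frequency side. -/

/-- The points at distance at most `δ` from `Ω`. -/
def fatten (δ : ℝ) (Ω : Set Plane) : Set Plane := {ξ | ∃ ζ ∈ Ω, ‖ξ - ζ‖ ≤ δ}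

theorem subset_fatten {δ : ℝ} (hδ : 0 ≤ δ) (Ω : Set Plane) : Ω ⊆ fatten δ Ω :=
  fun ξ hξ => ⟨ξ, hξ, by simpa using hδ⟩

theorem isBounded_fatten {δ : ℝ} {Ω : Set Plane} (hΩ : Bornology.IsBounded Ω) :
    Bornology.IsBounded (fatten δ Ω) := by
  obtain ⟨r, hr⟩ := hΩ.subset_closedBall 0
  refine (Metric.isBounded_closedBall (x := (0 : Plane)) (r := r + δ)).subset ?_
  rintro ξ ⟨ζ, hζ, h⟩
  have h1 := hr hζ
  rw [mem_closedBall_zero_iff] at h1 ⊢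
  have := norm_add_le ζ (ξ - ζ)
  rw [add_sub_cancel] at this
  linarith

theorem fatten_fatten_subset (δ ε : ℝ) (Ω : Set Plane) :
    fatten δ (fatten ε Ω) ⊆ fatten (δ + ε) Ω := by
  rintro ξ ⟨ζ, ⟨ζ', h', h2⟩, h1⟩
  refine ⟨ζ', h', ?_⟩
  rw [← sub_add_sub_cancel ξ ζ ζ']
  exact (norm_add_le _ _).trans (add_le_add h1 h2)

theorem fatten_mono {δ ε : ℝ} (h : δ ≤ ε) (Ω : Set Plane) : fatten δ Ω ⊆ fatten ε Ω :=
  fun _ ⟨ζ, hζ, h'⟩ => ⟨ζ, hζ, h'.trans h⟩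

theorem fatten_subset_fatten {δ : ℝ} {Ω Ω' : Set Plane} (h : Ω ⊆ Ω') :
    fatten δ Ω ⊆ fatten δ Ω' :=
  fun _ ⟨ζ, hζ, h'⟩ => ⟨ζ, h hζ, h'⟩

/-- `h` is square integrable and supported in `Ω`. -/
structure SupportedIn (Ω : Set Plane) (h : Plane → ℂ) : Prop where
  memLp : MemLp h 2 volume
  support_subset : Function.support h ⊆ Ω

theorem SupportedIn.mono {Ω Ω' : Set Plane} {h : Plane → ℂ} (hh : SupportedIn Ω h) (hs : Ω ⊆ Ω') :
    SupportedIn Ω' h := ⟨hh.memLp, hh.support_subset.trans hs⟩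

theorem SupportedIn.integrable {Ω : Set Plane} {h : Plane → ℂ} (hh : SupportedIn Ω h)
    (hΩ : Bornology.IsBounded Ω) : Integrable h :=
  integrable_of_memLp_two_of_support hh.memLp hΩ hh.support_subset

theorem SupportedIn.plancherel {Ω : Set Plane} {h : Plane → ℂ} (hh : SupportedIn Ω h)
    (hΩ : Bornology.IsBounded Ω) : ∫⁻ x, ‖𝓕⁻ h x‖ₑ ^ 2 = ∫⁻ x, ‖h x‖ₑ ^ 2 :=
  lintegral_enorm_sq_fourierInv hh.memLp (hh.integrable hΩ)

open scoped Convolution in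
/-- The frequency side of multiplication by the bump adapted to a grid cube. -/
def localize (ρ : ℝ) (m : Fin 2 → ℤ) (h : Plane → ℂ) : Plane → ℂ :=
  gridFreq ρ m ⋆[ContinuousLinearMap.mul ℂ ℂ] h

theorem fourierInv_localize {ρ : ℝ} (hρ : 0 < ρ) (m : Fin 2 → ℤ) {h : Plane → ℂ}
    (hh : Integrable h) (x : Plane) :
    𝓕⁻ (localize ρ m h) x = gridBump bumpPhys ρ m x * 𝓕⁻ h x := by
  rw [localize, fourierInv_convolution (integrable_gridFreq hρ m) hh, fourierInv_gridFreq hρ]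

theorem support_localize {ρ : ℝ} (hρ : 0 < ρ) (m : Fin 2 → ℤ) (h : Plane → ℂ) :
    Function.support (localize ρ m h) ⊆ fatten (1 / 100 / ρ) (Function.support h) := by
  intro ξ hξ
  obtain ⟨η, hη, ζ, hζ, rfl⟩ := support_convolution_subset _ hξ
  refine ⟨ζ, hζ, ?_⟩
  simpa using support_gridFreq hρ m hη

theorem SupportedIn.localize {ρ : ℝ} (hρ : 0 < ρ) (m : Fin 2 → ℤ) {Ω : Set Plane} {h : Plane → ℂ}
    (hh : SupportedIn Ω h) (hΩ : Bornology.IsBounded Ω) :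
    SupportedIn (fatten (1 / 100 / ρ) Ω) (localize ρ m h) := by
  have hs := (support_localize hρ m h).trans (fatten_subset_fatten hh.support_subset)
  refine ⟨?_, hs⟩
  have hcont : Continuous (_root_.localize ρ m h) :=
    (hasCompactSupport_gridFreq hρ m).continuous_convolution_left _ (continuous_gridFreq ρ m)
      (hh.integrable hΩ).locallyIntegrable
  refine hcont.memLp_of_hasCompactSupport ?_
  obtain ⟨r, hr⟩ := (isBounded_fatten (δ := 1 / 100 / ρ) hΩ).subset_closedBall 0
  exact HasCompactSupport.of_support_subset_isCompact (isCompact_closedBall _ _) (hs.trans hr)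

theorem localize_finset_sum {ι : Type*} {ρ : ℝ} (hρ : 0 < ρ) (m : Fin 2 → ℤ) (s : Finset ι)
    {h : ι → Plane → ℂ} (hh : ∀ i ∈ s, Integrable (h i)) (ξ : Plane) :
    localize ρ m (fun x => ∑ i ∈ s, h i x) ξ = ∑ i ∈ s, localize ρ m (h i) ξ := by
  simp only [localize, convolution_def, ContinuousLinearMap.mul_apply', Finset.mul_sum]
  refine integral_finsetSum s fun i hi => ?_
  have := (hasCompactSupport_gridFreq hρ m).convolutionExists_left
    (ContinuousLinearMap.mul ℂ ℂ) (μ := (volume : Measure Plane)) (continuous_gridFreq ρ m)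
    (hh i hi).locallyIntegrable ξ
  exact this

/-! ### Averaging over small dual sets -/

theorem sq_lintegral_le {α : Type*} [MeasurableSpace α] {μ : Measure α} {f : α → ℝ≥0∞}
    (hf : AEMeasurable f μ) : (∫⁻ x, f x ∂μ) ^ 2 ≤ μ univ * ∫⁻ x, f x ^ 2 ∂μ := by
  have h := ENNReal.lintegral_mul_le_Lp_mul_Lq μ (p := 2) (q := 2)
    (Real.HolderConjugate.two_two) (f := 1) (g := f) aemeasurable_const hf
  simp only [one_mul, Pi.one_apply, ENNReal.one_rpow, lintegral_one] at h
  have h2 := pow_le_pow_left' h 2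
  rw [mul_pow, ← ENNReal.rpow_mul_natCast, ← ENNReal.rpow_mul_natCast] at h2
  norm_num at h2
  exact h2

/-- If `T` is dual to `Ω`, then `𝓕⁻ h` is, up to a modulation, an integral over `T` of translates of
another function `𝓕⁻ h'` with frequencies in `Ω` and `‖h'‖₂ ≤ 2 ‖h‖₂ / |T|`. After Cauchy-Schwarz
and Fubini the averaging falls on `V`, so only the averages of `V` over translates of the reflected
set `-T` matter. -/
theorem lintegral_mul_enorm_fourierInv_sq_le {T : Set Plane} (hTm : MeasurableSet T)
    (hT0 : volume T ≠ 0) (hTt : volume T ≠ ⊤) {Ω : Set Plane} (hΩ : Bornology.IsBounded Ω)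
    {ξ₀ : Plane} (hphase : ∀ ξ ∈ Ω, ∀ y ∈ T, |2 * Real.pi * inner ℝ (ξ - ξ₀) y| ≤ 1)
    {h : Plane → ℂ} (hh : SupportedIn Ω h) {V : Plane → ℝ≥0∞} (hV : Measurable V) {Λ : ℝ≥0∞}
    (hΛ : ∀ z, ∫⁻ y in T, V (z - y) ≤ Λ * volume T) :
    ∫⁻ x, V x * ‖𝓕⁻ h x‖ₑ ^ 2 ≤ 4 * Λ * ∫⁻ ξ, ‖h ξ‖ₑ ^ 2 := by
  have : IsFiniteMeasure (volume.restrict T) := ⟨by simpa using hTt.lt_top⟩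
  set e : Plane → Plane → ℂ := fun ξ y =>
    Complex.exp (↑(2 * Real.pi * inner ℝ (ξ - ξ₀) y) * Complex.I) with he
  have hecont : Continuous (Function.uncurry e) := by
    simp only [he, Function.uncurry_def]
    fun_prop
  set k : Plane → ℂ := fun ξ => ∫ y in T, e ξ y with hk
  have hkm : StronglyMeasurable k := hecont.stronglyMeasurable.integral_prod_right
  have ht : 0 < volume.real T := ENNReal.toReal_pos hT0 hTt
  have hklow : ∀ ξ ∈ Ω, volume.real T / 2 ≤ ‖k ξ‖ := by
    intro ξ hξ
    have h1 := half_integral_le_norm_integral_exp (μ := volume)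
      (θ := fun y : Plane => 2 * Real.pi * inner ℝ (ξ - ξ₀) y) (u := T.indicator 1)
      ((integrable_indicator_iff hTm).2 (integrableOn_const hTt))
      (fun y => indicator_nonneg (fun _ _ => zero_le_one) y) (by fun_prop) fun y hy =>
        hphase ξ hξ y (by by_contra hyT; simp [hyT] at hy)
    rw [integral_indicator_one hTm] at h1
    refine h1.trans (le_of_eq ?_)
    simp only [hk]
    rw [← integral_indicator hTm]
    congr 2 with y
    by_cases hy : y ∈ T <;> simp [hy, he]
  have hk0 : ∀ ξ ∈ Ω, k ξ ≠ 0 := fun ξ hξ h0 => by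
    have := hklow ξ hξ
    rw [h0, norm_zero] at this
    linarith
  have hout : ∀ ξ, ξ ∉ Ω → h ξ = 0 := fun ξ hξ => by
    by_contra h0
    exact hξ (hh.support_subset h0)
  -- The integral of the exponentials over `T` has the multiplier `k`, which is at least `|T| / 2`
  -- in modulus on `Ω` because the phases are at most `1`; hence it can be divided out.
  set h' : Plane → ℂ := fun ξ => h ξ / k ξ with hh'
  have hbound : ∀ ξ, ‖h' ξ‖ ≤ 2 / volume.real T * ‖h ξ‖ := by
    intro ξ
    by_cases hξ : ξ ∈ Ω
    · have := hklow ξ hξ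
      have hkpos : 0 < ‖k ξ‖ := by linarith
      rw [hh', norm_div, div_mul_eq_mul_div, div_le_div_iff₀ hkpos ht]
      nlinarith [norm_nonneg (h ξ)]
    · simp [hh', hout ξ hξ]
  have hm' : AEStronglyMeasurable h' volume := hh.memLp.1.div₀ hkm.aestronglyMeasurable
  have hS' : SupportedIn Ω h' := by
    refine ⟨hh.memLp.of_le_mul hm' (Filter.Eventually.of_forall hbound), fun ξ hξ => ?_⟩
    exact hh.support_subset fun h0 => hξ (by simp [hh', h0])
  have hi' : Integrable h' := hS'.integrable hΩ
  have hrep : ∀ x, 𝓕⁻ h x = ∫ y in T,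
      Complex.exp (↑(-(2 * Real.pi * inner ℝ ξ₀ y)) * Complex.I) * 𝓕⁻ h' (x + y) := by
    intro x
    have e1 : 𝓕⁻ h x = ∫ ξ, ∫ y in T,
        Complex.exp (↑(2 * Real.pi * inner ℝ ξ x) * Complex.I) * e ξ y * h' ξ := by
      rw [Real.fourierInv_eq']
      congr with ξ
      rw [integral_mul_const, integral_const_mul, smul_eq_mul]
      change _ = _ * k ξ * (h ξ / k ξ)
      by_cases hξ : ξ ∈ Ω
      · rw [mul_assoc _ (k ξ), mul_div_cancel₀ _ (hk0 ξ hξ)]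
      · simp [hout ξ hξ]
    rw [e1, integral_integral_swap]
    · congr with y
      rw [Real.fourierInv_eq', ← integral_const_mul]
      congr with ξ
      rw [smul_eq_mul, ← mul_assoc, ← Complex.exp_add, ← Complex.exp_add]
      congr 2
      rw [inner_sub_left, inner_add_right]
      push_cast
      ring
    · have hi2 : Integrable (fun p : Plane × Plane => h' p.1)
          (volume.prod (volume.restrict T)) := hi'.comp_fst _
      refine hi2.bdd_mul (c := 1) ?_ ?_
      · refine Continuous.aestronglyMeasurable ?_
        simp only [he]
        fun_prop
      · refine Filter.Eventually.of_forall fun p => ?_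
        simp only [he]
        rw [norm_mul, Complex.norm_exp_ofReal_mul_I, Complex.norm_exp_ofReal_mul_I, one_mul]
  have hgc : Continuous (𝓕⁻ h') := continuous_fourierInv_of_integrable hi'
  have hpt : ∀ x, ‖𝓕⁻ h x‖ₑ ^ 2 ≤ volume T * ∫⁻ y in T, ‖𝓕⁻ h' (x + y)‖ₑ ^ 2 := by
    intro x
    have e1 : ‖𝓕⁻ h x‖ₑ ≤ ∫⁻ y in T, ‖𝓕⁻ h' (x + y)‖ₑ := by
      rw [hrep x]
      refine (enorm_integral_le_lintegral_enorm _).trans (le_of_eq ?_)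
      congr with y
      rw [enorm_mul, ← ofReal_norm, Complex.norm_exp_ofReal_mul_I]
      simp
    refine (pow_le_pow_left' e1 2).trans ?_
    have hm : Measurable fun y => ‖𝓕⁻ h' (x + y)‖ₑ :=
      (hgc.comp (continuous_const.add continuous_id)).enorm.measurable
    simpa using sq_lintegral_le (μ := volume.restrict T) hm.aemeasurable
  have hgm : Measurable fun z => ‖𝓕⁻ h' z‖ₑ ^ 2 := (hgc.enorm.measurable).pow_const 2
  calc ∫⁻ x, V x * ‖𝓕⁻ h x‖ₑ ^ 2
      ≤ ∫⁻ x, volume T * ∫⁻ y in T, V x * ‖𝓕⁻ h' (x + y)‖ₑ ^ 2 := by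
        refine lintegral_mono fun x => ?_
        rw [lintegral_const_mul _ (f := fun y => ‖𝓕⁻ h' (x + y)‖ₑ ^ 2)
          (hgm.comp (measurable_const_add x)), mul_left_comm]
        exact mul_le_mul_right (hpt x) _
    _ = volume T * ∫⁻ x, ∫⁻ y in T, V x * ‖𝓕⁻ h' (x + y)‖ₑ ^ 2 :=
        lintegral_const_mul' _ _ hTt
    _ = volume T * ∫⁻ y in T, ∫⁻ x, V x * ‖𝓕⁻ h' (x + y)‖ₑ ^ 2 := by
        rw [lintegral_lintegral_swap]
        refine Measurable.aemeasurable ?_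
        exact (hV.comp measurable_fst).mul (hgm.comp (measurable_fst.add measurable_snd))
    _ = volume T * ∫⁻ y in T, ∫⁻ z, V (z - y) * ‖𝓕⁻ h' z‖ₑ ^ 2 := by
        congr 2 with y
        rw [← lintegral_add_right_eq_self (fun z => V (z - y) * ‖𝓕⁻ h' z‖ₑ ^ 2) y]
        simp
    _ = volume T * ∫⁻ z, (∫⁻ y in T, V (z - y)) * ‖𝓕⁻ h' z‖ₑ ^ 2 := by
        rw [lintegral_lintegral_swap]
        · congr 2 with z
          rw [lintegral_mul_const _ (f := fun y => V (z - y)) (hV.comp (by fun_prop))]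
        · refine Measurable.aemeasurable ?_
          exact (hV.comp (measurable_snd.sub measurable_fst)).mul (hgm.comp measurable_snd)
    _ ≤ volume T * ∫⁻ z, Λ * volume T * ‖𝓕⁻ h' z‖ₑ ^ 2 := by
        gcongr with z
        exact hΛ z
    _ = Λ * ∫⁻ ξ, (volume T * ‖h' ξ‖ₑ) ^ 2 := by
        rw [lintegral_const_mul _ hgm, hS'.plancherel hΩ]
        simp only [mul_pow]
        rw [lintegral_const_mul' _ _ (ENNReal.pow_ne_top hTt)]
        ring
    _ ≤ Λ * ∫⁻ ξ, 4 * ‖h ξ‖ₑ ^ 2 := by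
        gcongr with ξ
        have e1 : volume T * ‖h' ξ‖ₑ ≤ 2 * ‖h ξ‖ₑ := by
          rw [← ENNReal.ofReal_toReal hTt, ← ofReal_norm, ← ofReal_norm,
            ← ENNReal.ofReal_mul ENNReal.toReal_nonneg,
            show (2 : ℝ≥0∞) * ENNReal.ofReal ‖h ξ‖ = ENNReal.ofReal (2 * ‖h ξ‖) by
              rw [ENNReal.ofReal_mul (by norm_num), ENNReal.ofReal_ofNat]]
          apply ENNReal.ofReal_le_ofReal
          have := hbound ξ
          rw [div_mul_eq_mul_div, le_div_iff₀ ht, mul_comm] at this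
          exact this
        refine (pow_le_pow_left' e1 2).trans (le_of_eq ?_)
        ring
    _ = 4 * Λ * ∫⁻ ξ, ‖h ξ‖ₑ ^ 2 := by
        rw [lintegral_const_mul' _ _ (by norm_num)]
        ring

/-! ### Orthonormal frames and tubes -/

/-- The coordinates with respect to the frame `e`, `perp e`, as a linear map. -/
def frameMap (e : Plane) : Plane →ₗ[ℝ] Plane where
  toFun y := !₂[inner ℝ y e, inner ℝ y (perp e)]
  map_add' x y := by
    ext i
    fin_cases i <;> simp [inner_add_left]
  map_smul' c x := by
    ext i
    fin_cases i <;> simp [inner_smul_left]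

theorem Plane.norm_sq (x : Plane) : ‖x‖ ^ 2 = x 0 ^ 2 + x 1 ^ 2 := by
  rw [EuclideanSpace.norm_sq_eq, Fin.sum_univ_two]
  simp

theorem Plane.inner_eq (x y : Plane) : inner ℝ x y = x 0 * y 0 + x 1 * y 1 := by
  simp [PiLp.inner_apply, mul_comm]

@[simp] theorem perp_zero (e : Plane) : perp e 0 = -e 1 := rfl
@[simp] theorem perp_one (e : Plane) : perp e 1 = e 0 := rfl

theorem inner_sq_add_inner_perp_sq {e : Plane} (he : ‖e‖ = 1) (y : Plane) :
    inner ℝ y e ^ 2 + inner ℝ y (perp e) ^ 2 = ‖y‖ ^ 2 := by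
  have h : e 0 ^ 2 + e 1 ^ 2 = 1 := by rw [← Plane.norm_sq, he, one_pow]
  rw [Plane.inner_eq, Plane.inner_eq, Plane.norm_sq, perp_zero, perp_one]
  linear_combination (y 0 ^ 2 + y 1 ^ 2) * h

theorem norm_perp {e : Plane} (he : ‖e‖ = 1) : ‖perp e‖ = 1 := by
  rw [← sq_eq_sq₀ (norm_nonneg _) zero_le_one, Plane.norm_sq, perp_zero, perp_one, neg_sq,
    add_comm, ← Plane.norm_sq, he]

/-- The coordinates with respect to the frame `e`, `perp e`. -/
def frame {e : Plane} (he : ‖e‖ = 1) : Plane ≃ₗᵢ[ℝ] Plane :=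
  LinearIsometry.toLinearIsometryEquiv
    ⟨frameMap e, fun y => by
      rw [← sq_eq_sq₀ (norm_nonneg _) (norm_nonneg _), ← inner_sq_add_inner_perp_sq he y,
        Plane.norm_sq]
      rfl⟩ rfl

@[simp] theorem frame_zero {e : Plane} (he : ‖e‖ = 1) (y : Plane) :
    frame he y 0 = inner ℝ y e := rfl
@[simp] theorem frame_one {e : Plane} (he : ‖e‖ = 1) (y : Plane) :
    frame he y 1 = inner ℝ y (perp e) := rfl

theorem inner_eq_frame {e : Plane} (he : ‖e‖ = 1) (x y : Plane) :
    inner ℝ x y = inner ℝ x e * inner ℝ y e + inner ℝ x (perp e) * inner ℝ y (perp e) := by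
  rw [← (frame he).inner_map_map, Plane.inner_eq]
  simp

/-- The rectangle of side lengths `2a`, `2b` with the given centre and direction. -/
def rectangle (x e : Plane) (a b : ℝ) : Set Plane :=
  {y | |inner ℝ (y - x) e| ≤ a ∧ |inner ℝ (y - x) (perp e)| ≤ b}

theorem tube_eq_rectangle (r : ℝ) (x e : Plane) :
    tube r x e = rectangle x e (r / 2) (Real.sqrt r / 2) := rfl

theorem isClosed_rectangle (x e : Plane) (a b : ℝ) : IsClosed (rectangle x e a b) := by
  have h : ∀ v : Plane, Continuous fun y : Plane => |inner ℝ (y - x) v| := fun v => by fun_prop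
  exact (isClosed_le (h e) continuous_const).inter (isClosed_le (h (perp e)) continuous_const)

theorem volume_rectangle {e : Plane} (he : ‖e‖ = 1) (x : Plane) {a b : ℝ} (ha : 0 ≤ a) :
    volume (rectangle x e a b) = ENNReal.ofReal (4 * a * b) := by
  have e1 : rectangle x e a b = (fun y => y - x) ⁻¹' (frame he ⁻¹'
      ((MeasurableEquiv.toLp 2 (Fin 2 → ℝ)).symm ⁻¹' (Icc ![-a, -b] ![a, b]))) := by
    ext y
    simp only [rectangle, abs_le, mem_ofPred_eq, mem_preimage, mem_Icc, Pi.le_def,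
      Fin.forall_fin_two]
    change _ ↔ (-a ≤ inner ℝ (y - x) e ∧ -b ≤ inner ℝ (y - x) (perp e)) ∧
      inner ℝ (y - x) e ≤ a ∧ inner ℝ (y - x) (perp e) ≤ b
    tauto
  rw [e1, (measurePreserving_sub_right volume x).measure_preimage_emb
      (measurableEmbedding_subRight x),
    (frame he).measurePreserving.measure_preimage_emb
      (frame he).toMeasurableEquiv.measurableEmbedding,
    (EuclideanSpace.volume_preserving_symm_measurableEquiv_toLp (Fin 2)).measure_preimage_equiv,
    Real.volume_Icc_pi, Fin.prod_univ_two, ← ENNReal.ofReal_mul (by simp; linarith)]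
  congr 1
  simp
  ring

/-! ### Local orthogonality -/

theorem enorm_sum_sq_le {ι : Type*} (s : Finset ι) (f : ι → ℂ) :
    ‖∑ i ∈ s, f i‖ₑ ^ 2 ≤ s.card * ∑ i ∈ s, ‖f i‖ₑ ^ 2 := by
  have h := ENNReal.rpow_sum_le_const_mul_sum_rpow s (fun i => ‖f i‖ₑ) (p := 2) (by norm_num)
  norm_num at h
  exact (pow_le_pow_left' (enorm_sum_le s f) 2).trans h

/-- The restriction of `h` to a grid cube. -/
def piece (s : ℝ) (j : Fin 2 → ℤ) (h : Plane → ℂ) : Plane → ℂ := (gridCube s j).indicator h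

theorem SupportedIn.piece {Ω : Set Plane} {h : Plane → ℂ} (hh : SupportedIn Ω h) (s : ℝ)
    (j : Fin 2 → ℤ) : SupportedIn (Ω ∩ gridCube s j) (piece s j h) := by
  refine ⟨hh.memLp.indicator (measurableSet_gridCube s j), ?_⟩
  rw [_root_.piece, support_indicator, inter_comm]
  exact inter_subset_inter_left _ hh.support_subset

theorem sum_lintegral_piece_le {s : ℝ} (hs : 0 < s) (J : Finset (Fin 2 → ℤ)) (h : Plane → ℂ) :
    ∑ j ∈ J, ∫⁻ ξ, ‖piece s j h ξ‖ₑ ^ 2 ≤ ∫⁻ ξ, ‖h ξ‖ₑ ^ 2 := by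
  have e : ∀ j, ∫⁻ ξ, ‖piece s j h ξ‖ₑ ^ 2 = ∫⁻ ξ in gridCube s j, ‖h ξ‖ₑ ^ 2 := by
    intro j
    rw [← lintegral_indicator (measurableSet_gridCube s j)]
    congr with ξ
    by_cases hξ : ξ ∈ gridCube s j <;> simp [piece, hξ]
  simp only [e]
  rw [← lintegral_biUnion_finset (fun j _ j' _ hne => pairwise_disjoint_gridCube hs hne)
    fun j _ => measurableSet_gridCube s j]
  exact setLIntegral_le_lintegral _ _

theorem eq_sum_piece {s : ℝ} (hs : 0 < s) {J : Finset (Fin 2 → ℤ)} {Ω : Set Plane}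
    (hJ : ∀ j, (gridCube s j ∩ Ω).Nonempty → j ∈ J) {h : Plane → ℂ}
    (hh : Function.support h ⊆ Ω) : h = fun ξ => ∑ j ∈ J, piece s j h ξ := by
  funext ξ
  by_cases h0 : h ξ = 0
  · rw [h0]
    symm
    refine Finset.sum_eq_zero fun j _ => ?_
    by_cases hξ : ξ ∈ gridCube s j <;> simp [piece, hξ, h0]
  · obtain ⟨j, hj⟩ := exists_mem_gridCube hs ξ
    rw [Finset.sum_eq_single_of_mem j (hJ j ⟨ξ, hj, hh h0⟩)]
    · simp [piece, hj]
    · intro j' _ hne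
      have : ξ ∉ gridCube s j' := fun h' => hne (gridCube_index_unique hs h' hj)
      simp [piece, this]

/-- On a cube of side `ρ`, the parts of a function with frequencies in different cubes of side
`ρ⁻¹` are almost orthogonal. -/
theorem lintegral_gridBump_mul_sq_le {ρ : ℝ} (hρ : 0 < ρ) (m : Fin 2 → ℤ) {Ω : Set Plane}
    (hΩ : Bornology.IsBounded Ω) {J : Finset (Fin 2 → ℤ)}
    (hJ : ∀ j, (gridCube ρ⁻¹ j ∩ Ω).Nonempty → j ∈ J) {h : Plane → ℂ} (hh : SupportedIn Ω h) :
    ∫⁻ x, ‖gridBump bumpPhys ρ m x‖ₑ ^ 2 * ‖𝓕⁻ h x‖ₑ ^ 2 ≤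
      36 * ∑ j ∈ J, ∫⁻ x, ‖gridBump bumpPhys ρ m x‖ₑ ^ 2 * ‖𝓕⁻ (piece ρ⁻¹ j h) x‖ₑ ^ 2 := by
  have hs : 0 < ρ⁻¹ := inv_pos.2 hρ
  have hb : ∀ j, Bornology.IsBounded (Ω ∩ gridCube ρ⁻¹ j) := fun j =>
    hΩ.subset inter_subset_left
  have hplan : ∀ {Ω' : Set Plane} {u : Plane → ℂ}, Bornology.IsBounded Ω' → SupportedIn Ω' u →
      ∫⁻ x, ‖gridBump bumpPhys ρ m x‖ₑ ^ 2 * ‖𝓕⁻ u x‖ₑ ^ 2 =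
        ∫⁻ ξ, ‖localize ρ m u ξ‖ₑ ^ 2 := by
    intro Ω' u hΩ' hu
    rw [← (hu.localize hρ m hΩ').plancherel (isBounded_fatten hΩ')]
    congr with x
    rw [fourierInv_localize hρ m (hu.integrable hΩ'), enorm_mul, mul_pow]
  rw [hplan hΩ hh]
  simp_rw [hplan (hb _) (hh.piece ρ⁻¹ _)]
  have hmeas : ∀ j, AEMeasurable (fun ξ => ‖localize ρ m (piece ρ⁻¹ j h) ξ‖ₑ ^ 2) volume :=
    fun j => ((hh.piece ρ⁻¹ j).localize hρ m (hb j)).memLp.1.enorm.pow_const 2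
  rw [← lintegral_finsetSum' _ fun j _ => hmeas j, ← lintegral_const_mul' _ _ (by norm_num)]
  refine lintegral_mono fun ξ => ?_
  have e1 : localize ρ m h ξ = ∑ j ∈ J, localize ρ m (piece ρ⁻¹ j h) ξ := by
    rw [← localize_finset_sum hρ m J
      (fun j _ => (hh.piece ρ⁻¹ j).integrable (hb j)) ξ, ← eq_sum_piece hs hJ hh.support_subset]
  -- Localization moves frequencies by at most `1 / (100 ρ)`, so at a given `ξ` only the pieces from
  -- cubes near `ξ` contribute. There are at most `36`, and Cauchy-Schwarz loses only this factor.
  have e2 : ∑ j ∈ J, localize ρ m (piece ρ⁻¹ j h) ξ =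
      ∑ j ∈ J ∩ nearbyIndices ρ⁻¹ ξ (2 * ρ⁻¹), localize ρ m (piece ρ⁻¹ j h) ξ := by
    symm
    refine Finset.sum_subset Finset.inter_subset_left fun j hjJ hj => ?_
    by_contra h0
    obtain ⟨ζ, hζ, hd⟩ := support_localize hρ m _ h0
    refine hj (Finset.mem_inter.2 ⟨hjJ, mem_nearbyIndices hs
      ((hh.piece ρ⁻¹ j).support_subset hζ).2 ?_⟩)
    rw [norm_sub_rev]
    refine hd.trans ?_
    rw [div_eq_mul_inv]
    nlinarith
  rw [e1, e2]
  refine (enorm_sum_sq_le _ _).trans ?_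
  gcongr
  · have := (Finset.card_le_card (Finset.inter_subset_right (s₁ := J))).trans
      (card_nearbyIndices_le hs ξ)
    exact_mod_cast this
  · exact Finset.inter_subset_left

/-! ### The estimate for sets of small density in tubes -/

/-- The `ε/2π`-neighbourhood of the circle of radius `1/2π`. -/
def annulus (ε : ℝ) : Set Plane := {ξ | |2 * Real.pi * ‖ξ‖ - 1| ≤ ε}

theorem mem_annulus {ε : ℝ} {ξ : Plane} : ξ ∈ annulus ε ↔ |2 * Real.pi * ‖ξ‖ - 1| ≤ ε := Iff.rfl

theorem isBounded_annulus (ε : ℝ) : Bornology.IsBounded (annulus ε) := by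
  refine (Metric.isBounded_closedBall (x := (0 : Plane)) (r := 1 + ε)).subset fun ξ hξ => ?_
  rw [mem_closedBall_zero_iff]
  have h := (abs_le.1 (mem_annulus.1 hξ)).2
  nlinarith [Real.pi_gt_three, norm_nonneg ξ]

/-- This is the curvature of the circle. By `2⟪ξ - ξ₀, ξ₀⟫ = ‖ξ‖² - ‖ξ₀‖² - ‖ξ - ξ₀‖²`, the radial
part of `ξ - ξ₀` is governed by the thickness of the annulus and by the square of the chord, and
both are `O(1/r)`. -/
theorem abs_inner_le_of_mem_annulus {r : ℝ} (hr : 4 ≤ r) {ξ ξ₀ : Plane}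
    (hξ : ξ ∈ annulus (2 / r)) (hξ₀ : ξ₀ ∈ annulus (2 / r))
    (hd : ‖ξ - ξ₀‖ ≤ 3 / 2 * (Real.sqrt r)⁻¹) :
    |2 * Real.pi * inner ℝ (ξ - ξ₀) (‖ξ₀‖⁻¹ • ξ₀)| ≤ 160 / r := by
  have hr0 : 0 < r := by linarith
  have hsq : Real.sqrt r ^ 2 = r := Real.sq_sqrt hr0.le
  have hε : 2 / r ≤ 1 / 2 := by
    rw [div_le_div_iff₀ hr0 (by norm_num)]
    linarith
  have hpi := Real.pi_pos
  set a := 2 * Real.pi * ‖ξ‖ with ha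
  set b := 2 * Real.pi * ‖ξ₀‖ with hb
  have ha1 := abs_le.1 (mem_annulus.1 hξ)
  have hb1 := abs_le.1 (mem_annulus.1 hξ₀)
  rw [← ha] at ha1
  rw [← hb] at hb1
  have hb0 : 0 < b := by linarith
  have hn0 : 0 < ‖ξ₀‖ := by
    rw [hb] at hb0
    exact pos_of_mul_pos_right hb0 (by positivity)
  have hd2 : ‖ξ - ξ₀‖ ^ 2 ≤ 9 / 4 / r := by
    have := pow_le_pow_left₀ (norm_nonneg _) hd 2
    rw [mul_pow, inv_pow, hsq] at this
    rw [div_eq_mul_inv]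
    linarith
  have hinner : 2 * inner ℝ (ξ - ξ₀) ξ₀ = ‖ξ‖ ^ 2 - ‖ξ₀‖ ^ 2 - ‖ξ - ξ₀‖ ^ 2 := by
    have := norm_add_sq_real (ξ - ξ₀) ξ₀
    rw [sub_add_cancel] at this
    linarith
  have key : 2 * Real.pi * inner ℝ (ξ - ξ₀) (‖ξ₀‖⁻¹ • ξ₀) =
      (a ^ 2 - b ^ 2 - 4 * Real.pi ^ 2 * ‖ξ - ξ₀‖ ^ 2) / (2 * b) := by
    have : inner ℝ (ξ - ξ₀) ξ₀ = (‖ξ‖ ^ 2 - ‖ξ₀‖ ^ 2 - ‖ξ - ξ₀‖ ^ 2) / 2 := by linarith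
    rw [inner_smul_right, this, ha, hb]
    field_simp
    ring
  have hab : |a ^ 2 - b ^ 2| ≤ 12 / r := by
    have h1 : |a - b| ≤ 4 / r := by
      have e4 : 4 / r = 2 / r + 2 / r := by ring
      rw [abs_le]
      constructor <;> linarith
    have h2 : |a + b| ≤ 3 := by
      rw [abs_le]
      constructor <;> linarith
    calc |a ^ 2 - b ^ 2| = |a - b| * |a + b| := by
          rw [← abs_mul]
          congr 1
          ring
      _ ≤ 4 / r * 3 := mul_le_mul h1 h2 (abs_nonneg _) (by positivity)
      _ = 12 / r := by ring
  have hpi2 : Real.pi ^ 2 ≤ 10 := by nlinarith [Real.pi_lt_d2]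
  have hq : 4 * Real.pi ^ 2 * ‖ξ - ξ₀‖ ^ 2 ≤ 90 / r := by
    calc 4 * Real.pi ^ 2 * ‖ξ - ξ₀‖ ^ 2 ≤ 4 * 10 * (9 / 4 / r) := by gcongr
      _ = 90 / r := by ring
  have hq0 : 0 ≤ 4 * Real.pi ^ 2 * ‖ξ - ξ₀‖ ^ 2 := by positivity
  rw [key, abs_div, abs_of_pos (by positivity : 0 < 2 * b), div_le_iff₀ (by positivity)]
  have h3 : |a ^ 2 - b ^ 2 - 4 * Real.pi ^ 2 * ‖ξ - ξ₀‖ ^ 2| ≤ 12 / r + 90 / r := by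
    refine (abs_sub _ _).trans ?_
    rw [abs_of_nonneg hq0]
    exact add_le_add hab hq
  have h4 : 12 / r + 90 / r = 102 / r := by ring
  have h5 : 102 / r ≤ 160 / r * (2 * b) := by
    rw [div_mul_eq_mul_div]
    gcongr
    linarith
  linarith

/-- A function with frequencies in a cube of side `r^{-1/2}` near the circle is essentially
constant on `r^{1/2} × r` tubes. -/
theorem lintegral_mul_enorm_fourierInv_piece_le {r : ℝ} (hr : 4 ≤ r) {h : Plane → ℂ}
    (hh : SupportedIn (annulus (2 / r)) h) (j : Fin 2 → ℤ) {V : Plane → ℝ≥0∞} (hV : Measurable V)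
    {Λ : ℝ≥0∞} (hΛ : ∀ z w : Plane, ‖w‖ = 1 →
      ∫⁻ x in tube r z w, V x ≤ Λ * ENNReal.ofReal (r * Real.sqrt r)) :
    ∫⁻ x, V x * ‖𝓕⁻ (piece (Real.sqrt r)⁻¹ j h) x‖ₑ ^ 2 ≤
      160000 * Λ * ∫⁻ ξ, ‖piece (Real.sqrt r)⁻¹ j h ξ‖ₑ ^ 2 := by
  have hr0 : 0 < r := by linarith
  have hs0 : 0 < Real.sqrt r := Real.sqrt_pos.2 hr0
  rcases (annulus (2 / r) ∩ gridCube (Real.sqrt r)⁻¹ j).eq_empty_or_nonempty with hem | ⟨ξ₀, hξ₀⟩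
  · have hz : piece (Real.sqrt r)⁻¹ j h = 0 := by
      have := (hh.piece (Real.sqrt r)⁻¹ j).support_subset
      rw [hem, subset_empty_iff, Function.support_eq_empty_iff] at this
      exact this
    have : 𝓕⁻ (0 : Plane → ℂ) = 0 := by
      funext x
      simp [Real.fourierInv_eq']
    simp [hz, this]
  have hn0 : ξ₀ ≠ 0 := by
    rintro rfl
    have h1 := (abs_le.1 (mem_annulus.1 hξ₀.1)).1
    have h2 : 2 / r ≤ 1 / 2 := by
      rw [div_le_div_iff₀ hr0 (by norm_num)]
      linarith
    simp only [norm_zero, mul_zero] at h1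
    linarith
  set w : Plane := ‖ξ₀‖⁻¹ • ξ₀ with hw
  have hw1 : ‖w‖ = 1 := norm_smul_inv_norm (𝕜 := ℝ) hn0
  -- The long side of `T` points along `ξ₀`, in which direction the frequencies vary by `O(1/r)`;
  -- across it they vary by `O(r^{-1/2})`. The factor `1 / 400` makes the phase at most `2/5 +
  -- 3/100`.
  set T := rectangle 0 w (r / 400) (Real.sqrt r / 400) with hT
  have hTm : MeasurableSet T := (isClosed_rectangle _ _ _ _).measurableSet
  have hvol : volume T = ENNReal.ofReal (r * Real.sqrt r / 40000) := by
    rw [hT, volume_rectangle hw1 _ (by positivity)]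
    congr 1
    ring
  have hvol' : 40000 * volume T = ENNReal.ofReal (r * Real.sqrt r) := by
    rw [hvol, show (40000 : ℝ≥0∞) = ENNReal.ofReal 40000 by norm_num,
      ← ENNReal.ofReal_mul (by norm_num)]
    congr 1
    ring
  have key := lintegral_mul_enorm_fourierInv_sq_le hTm (Ω := annulus (2 / r) ∩
    gridCube (Real.sqrt r)⁻¹ j) (ξ₀ := ξ₀) (Λ := 40000 * Λ) ?_ ?_
    ((isBounded_annulus _).subset inter_subset_left) ?_ (hh.piece _ j) hV ?_
  · refine key.trans (le_of_eq ?_)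
    ring
  · rw [hvol, Ne, ENNReal.ofReal_eq_zero, not_le]
    positivity
  · rw [hvol]
    exact ENNReal.ofReal_ne_top
  · rintro ξ ⟨hξ, hξj⟩ y ⟨hy1, hy2⟩
    rw [sub_zero] at hy1 hy2
    have hd := dist_le_of_mem_gridCube hξj hξ₀.2
    have h1 := abs_inner_le_of_mem_annulus hr hξ hξ₀.1 hd
    rw [← hw] at h1
    have h2 : |inner ℝ (ξ - ξ₀) (perp w)| ≤ 3 / 2 * (Real.sqrt r)⁻¹ := by
      refine (abs_real_inner_le_norm _ _).trans ?_
      rwa [norm_perp hw1, mul_one]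
    rw [inner_eq_frame hw1, mul_add]
    refine (abs_add_le _ _).trans ?_
    have e1 : |2 * Real.pi * (inner ℝ (ξ - ξ₀) w * inner ℝ y w)| ≤ 160 / r * (r / 400) := by
      rw [← mul_assoc, abs_mul]
      exact mul_le_mul h1 hy1 (abs_nonneg _) (by positivity)
    have e2 : |2 * Real.pi * (inner ℝ (ξ - ξ₀) (perp w) * inner ℝ y (perp w))| ≤
        8 * (3 / 2 * (Real.sqrt r)⁻¹ * (Real.sqrt r / 400)) := by
      rw [abs_mul, abs_mul (inner ℝ _ _), abs_of_pos (by positivity : 0 < 2 * Real.pi)]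
      have := Real.pi_lt_four
      gcongr
      linarith
    have e3 : 160 / r * (r / 400) = 2 / 5 := by
      field_simp
      norm_num
    have e4 : 8 * (3 / 2 * (Real.sqrt r)⁻¹ * (Real.sqrt r / 400)) = 3 / 100 := by
      field_simp
      norm_num
    linarith
  · intro z
    have e1 : ∫⁻ y in T, V (z - y) ≤ ∫⁻ x in tube r z w, V x := by
      rw [← lintegral_indicator hTm, tube_eq_rectangle,
        ← lintegral_indicator (isClosed_rectangle _ _ _ _).measurableSet,
        ← lintegral_sub_left_eq_self _ z]
      refine lintegral_mono fun x => ?_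
      by_cases hx : z - x ∈ T
      · have hx' : x ∈ rectangle z w (r / 2) (Real.sqrt r / 2) := by
          obtain ⟨h1, h2⟩ := hx
          rw [sub_zero, ← neg_sub, inner_neg_left, abs_neg] at h1 h2
          exact ⟨by linarith, by linarith⟩
        rw [indicator_of_mem hx, indicator_of_mem hx', sub_sub_cancel]
      · rw [indicator_of_notMem hx]
        exact zero_le
    refine (e1.trans (hΛ z w hw1)).trans (le_of_eq ?_)
    rw [← hvol']
    ring

theorem measurable_gridBump (ρ : ℝ) (m : Fin 2 → ℤ) : Measurable (gridBump bumpPhys ρ m) := by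
  have := continuous_bumpPhys
  unfold gridBump
  fun_prop

/-- The constant in the estimate for sets of small density in tubes. -/
def densityConst : ℝ≥0∞ := 36 * (160000 * (324 * bumpDecay * tailMass))

theorem densityConst_ne_top : densityConst ≠ ⊤ := by
  have := bumpDecay_ne_top
  have := tailMass_lt_top.ne
  unfold densityConst
  finiteness

/-- If the neighbourhood of `E` has density at most `β` in every tube, then a function with
frequencies near the circle has at most the part `β` of its mass near `E`. -/
theorem sum_lintegral_gridBump_le_of_density {r : ℝ} (hr : 4 ≤ r) {E : Set Plane} {β : ℝ≥0∞}
    (hβ : ∀ T, IsTube r T → volume (Metric.thickening (Real.sqrt r) E ∩ T) ≤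
      β * ENNReal.ofReal (r * Real.sqrt r))
    (S : Finset (Fin 2 → ℤ)) (hS : ∀ m ∈ S, (gridCube (Real.sqrt r) m ∩ E).Nonempty)
    {h : Plane → ℂ} (hh : SupportedIn (annulus (2 / r)) h) :
    ∑ m ∈ S, ∫⁻ x, ‖gridBump bumpPhys (Real.sqrt r) m x‖ₑ ^ 2 * ‖𝓕⁻ h x‖ₑ ^ 2 ≤
      densityConst * β * ∫⁻ ξ, ‖h ξ‖ₑ ^ 2 := by
  have hr0 : 0 < r := by linarith
  set ρ := Real.sqrt r with hρ
  have hρ0 : 0 < ρ := Real.sqrt_pos.2 hr0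
  have hb := isBounded_annulus (2 / r)
  set J := (finite_setOf_gridCube_inter_nonempty (inv_pos.2 hρ0) hb).toFinset with hJ
  have hJmem : ∀ j, (gridCube ρ⁻¹ j ∩ annulus (2 / r)).Nonempty → j ∈ J := fun j hj =>
    (Finite.mem_toFinset _).2 hj
  set V : Plane → ℝ≥0∞ := fun x => ∑ m ∈ S, ‖gridBump bumpPhys ρ m x‖ₑ ^ 2 with hV
  have hVterm : ∀ m, Measurable fun x => ‖gridBump bumpPhys ρ m x‖ₑ ^ 2 := fun m =>
    (measurable_gridBump ρ m).enorm.pow_const 2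
  have hVm : Measurable V := Finset.measurable_fun_sum S fun m _ => hVterm m
  -- The bumps sit on cubes in which the neighbourhood of `E` has large mass, so the tube averages
  -- of `V` are controlled by the density of that neighbourhood in translated tubes.
  have hVtube : ∀ z w : Plane, ‖w‖ = 1 → ∫⁻ x in tube r z w, V x ≤
      324 * bumpDecay * tailMass * β * ENNReal.ofReal (r * ρ) := by
    intro z w hw
    rw [mul_assoc _ β]
    refine lintegral_sum_gridBump_le enorm_bumpPhys_sq_le hρ0
      Metric.isOpen_thickening.measurableSet S
      (fun m hm => le_volume_thickening_inter_gridCube hρ0 le_rfl (hS m hm))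
      (volume.restrict (tube r z w)) fun y => ?_
    refine le_trans (le_of_eq ?_) (hβ (tube r (z - y) w) ⟨_, w, hw, rfl⟩)
    have hm : MeasurableSet {x : Plane | x - y ∈ Metric.thickening ρ E} :=
      measurableSet_preimage (measurable_id.sub_const y) Metric.isOpen_thickening.measurableSet
    rw [Measure.restrict_apply hm, ← (measurePreserving_sub_right volume y).measure_preimage_emb
      (measurableEmbedding_subRight y) (Metric.thickening ρ E ∩ tube r (z - y) w)]
    congr 1
    ext x
    simp only [mem_inter_iff, mem_preimage, mem_ofPred_eq, tube, sub_sub_sub_cancel_right]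
  calc ∑ m ∈ S, ∫⁻ x, ‖gridBump bumpPhys ρ m x‖ₑ ^ 2 * ‖𝓕⁻ h x‖ₑ ^ 2
      ≤ ∑ m ∈ S, 36 * ∑ j ∈ J,
          ∫⁻ x, ‖gridBump bumpPhys ρ m x‖ₑ ^ 2 * ‖𝓕⁻ (piece ρ⁻¹ j h) x‖ₑ ^ 2 :=
        Finset.sum_le_sum fun m _ => lintegral_gridBump_mul_sq_le hρ0 m hb hJmem hh
    _ = 36 * ∑ j ∈ J, ∫⁻ x, V x * ‖𝓕⁻ (piece ρ⁻¹ j h) x‖ₑ ^ 2 := by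
        rw [← Finset.mul_sum, Finset.sum_comm]
        congr 2 with j
        rw [← lintegral_finsetSum]
        · simp only [hV, Finset.sum_mul]
        · intro m _
          have hi := (hh.piece ρ⁻¹ j).integrable (hb.subset inter_subset_left)
          exact (hVterm m).mul
            ((continuous_fourierInv_of_integrable hi).enorm.measurable.pow_const 2)
    _ ≤ 36 * ∑ j ∈ J, 160000 * (324 * bumpDecay * tailMass * β) *
          ∫⁻ ξ, ‖piece ρ⁻¹ j h ξ‖ₑ ^ 2 := by
        gcongr with j
        exact lintegral_mul_enorm_fourierInv_piece_le hr hh j hVm hVtube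
    _ ≤ 36 * (160000 * (324 * bumpDecay * tailMass * β) * ∫⁻ ξ, ‖h ξ‖ₑ ^ 2) := by
        rw [← Finset.mul_sum]
        gcongr
        exact sum_lintegral_piece_le (inv_pos.2 hρ0) J h
    _ = densityConst * β * ∫⁻ ξ, ‖h ξ‖ₑ ^ 2 := by
        unfold densityConst
        ring

/-! ### The estimate for transversal strips -/

/-- The coordinates with respect to the frame `e`, `perp e`, as a measurable equivalence. -/
def frameEquiv {e : Plane} (he : ‖e‖ = 1) : Plane ≃ᵐ ℝ × ℝ :=
  ((frame he).toMeasurableEquiv.trans (MeasurableEquiv.toLp 2 (Fin 2 → ℝ)).symm).trans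
    MeasurableEquiv.finTwoArrow

theorem frameEquiv_apply {e : Plane} (he : ‖e‖ = 1) (x : Plane) :
    frameEquiv he x = (inner ℝ x e, inner ℝ x (perp e)) := rfl

theorem measurePreserving_frameEquiv {e : Plane} (he : ‖e‖ = 1) :
    MeasurePreserving (frameEquiv he) volume (volume.prod volume) :=
  ((frame he).measurePreserving.trans
    (EuclideanSpace.volume_preserving_symm_measurableEquiv_toLp (Fin 2))).trans
    (volume_preserving_finTwoArrow ℝ)

theorem inner_frameEquiv_symm {e : Plane} (he : ‖e‖ = 1) (p : ℝ × ℝ) :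
    inner ℝ ((frameEquiv he).symm p) e = p.1 ∧
      inner ℝ ((frameEquiv he).symm p) (perp e) = p.2 := by
  have h := (frameEquiv he).apply_symm_apply p
  rw [frameEquiv_apply] at h
  exact ⟨congrArg Prod.fst h, congrArg Prod.snd h⟩

/-- If every line of direction `perp e` meets the frequency support in a set of length at most
`L`, then on every line of direction `e` the mass is at most `L` times the total mass. -/
theorem lintegral_line_enorm_fourierInv_sq_le {e : Plane} (he : ‖e‖ = 1) {Ω : Set Plane}
    (hΩ : Bornology.IsBounded Ω) {L : ℝ≥0∞} (hL : L ≠ ⊤)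
    (hslice : ∀ s : ℝ, volume {t : ℝ | (frameEquiv he).symm (s, t) ∈ Ω} ≤ L)
    {h : Plane → ℂ} (hh : SupportedIn Ω h) (t : ℝ) :
    ∫⁻ s : ℝ, ‖𝓕⁻ h ((frameEquiv he).symm (s, t))‖ₑ ^ 2 ≤ L * ∫⁻ ξ, ‖h ξ‖ₑ ^ 2 := by
  set P := frameEquiv he with hP
  have hPm : MeasurePreserving P volume (volume.prod volume) := measurePreserving_frameEquiv he
  have hPs : MeasurePreserving P.symm (volume.prod volume) volume := hPm.symm P
  set H : ℝ × ℝ → ℂ := fun p => h (P.symm p) with hH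
  have hHi : Integrable H (volume.prod volume) :=
    (hPs.integrable_comp_emb P.symm.measurableEmbedding).2 (hh.integrable hΩ)
  set G : ℝ × ℝ → ℂ := fun p => Complex.exp (↑(2 * Real.pi * (p.2 * t)) * Complex.I) * H p with hG
  have hGi : Integrable G (volume.prod volume) := by
    refine hHi.bdd_mul (c := 1) (Continuous.aestronglyMeasurable (by fun_prop)) ?_
    exact Filter.Eventually.of_forall fun p => (Complex.norm_exp_ofReal_mul_I _).le
  -- On the line with `perp e`-coordinate `t`, the function `𝓕⁻ h` is the inverse transform in one
  -- variable of the fibre integrals `Ht`. Cauchy-Schwarz on each fibre costs the length of the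
  -- slice.
  set Ht : ℝ → ℂ := fun s => ∫ τ, G (s, τ) with hHt
  have hHt1 : Integrable Ht := hGi.integral_prod_left
  have hrep : ∀ s, 𝓕⁻ h (P.symm (s, t)) = 𝓕⁻ Ht s := by
    intro s
    rw [Real.fourierInv_eq', Real.fourierInv_eq',
      ← hPs.integral_comp P.symm.measurableEmbedding, integral_prod]
    · congr with σ
      rw [hHt, smul_eq_mul, ← integral_const_mul]
      congr with τ
      obtain ⟨h1, h2⟩ := inner_frameEquiv_symm he (σ, τ)
      obtain ⟨h3, h4⟩ := inner_frameEquiv_symm he (s, t)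
      rw [inner_eq_frame he, h1, h2, h3, h4, smul_eq_mul, hG, ← mul_assoc, ← Complex.exp_add]
      congr 2
      simp only [RCLike.inner_apply, conj_trivial]
      push_cast
      ring
    · simp only [smul_eq_mul]
      refine hHi.bdd_mul (c := 1) (Continuous.aestronglyMeasurable ?_) ?_
      · have e1 : ∀ p, inner ℝ (P.symm p) (P.symm (s, t)) = p.1 * s + p.2 * t := by
          intro p
          rw [inner_eq_frame he, (inner_frameEquiv_symm he _).1, (inner_frameEquiv_symm he _).2,
            (inner_frameEquiv_symm he _).1, (inner_frameEquiv_symm he _).2]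
        simp only [e1]
        fun_prop
      · exact Filter.Eventually.of_forall fun p => (Complex.norm_exp_ofReal_mul_I _).le
  have hHm : AEMeasurable (fun p => ‖H p‖ₑ ^ 2) (volume.prod volume) := hHi.1.enorm.pow_const 2
  have htot : ∫⁻ s, ∫⁻ τ, ‖H (s, τ)‖ₑ ^ 2 = ∫⁻ ξ, ‖h ξ‖ₑ ^ 2 := by
    rw [← lintegral_prod _ hHm,
      ← hPs.lintegral_comp_emb P.symm.measurableEmbedding]
  have hbound : ∫⁻ s, ‖Ht s‖ₑ ^ 2 ≤ L * ∫⁻ ξ, ‖h ξ‖ₑ ^ 2 := by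
    rw [← htot, ← lintegral_const_mul' _ _ hL]
    refine lintegral_mono_ae ?_
    filter_upwards [hHi.1.prodMk_left] with s hs
    -- The slice of `Ω` need not be measurable; its measurable hull has the same measure.
    set A := toMeasurable volume {τ : ℝ | P.symm (s, τ) ∈ Ω} with hA
    have hAm : MeasurableSet A := measurableSet_toMeasurable _ _
    have e1 : ‖Ht s‖ₑ ≤ ∫⁻ τ in A, ‖H (s, τ)‖ₑ := by
      refine (enorm_integral_le_lintegral_enorm _).trans ?_
      rw [← lintegral_indicator hAm]
      refine lintegral_mono fun τ => ?_
      have e2 : ‖G (s, τ)‖ₑ = ‖H (s, τ)‖ₑ := by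
        rw [hG, enorm_mul, ← ofReal_norm, Complex.norm_exp_ofReal_mul_I]
        simp
      rw [e2]
      by_cases hτ : τ ∈ A
      · rw [indicator_of_mem hτ]
      · have : H (s, τ) = 0 := by
          by_contra h0
          exact hτ (subset_toMeasurable _ _ (hh.support_subset h0))
        simp [this]
    calc ‖Ht s‖ₑ ^ 2 ≤ (∫⁻ τ in A, ‖H (s, τ)‖ₑ) ^ 2 := pow_le_pow_left' e1 2
      _ ≤ volume.restrict A univ * ∫⁻ τ in A, ‖H (s, τ)‖ₑ ^ 2 :=
          sq_lintegral_le hs.enorm.restrict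
      _ ≤ L * ∫⁻ τ, ‖H (s, τ)‖ₑ ^ 2 := by
          gcongr
          · rw [Measure.restrict_apply_univ, hA, measure_toMeasurable]
            exact hslice s
          · exact Measure.restrict_le_self
  have hHt2 : MemLp Ht 2 volume := by
    refine ⟨hHt1.1, ?_⟩
    have hfin : eLpNorm h 2 volume ^ 2 < ⊤ := ENNReal.pow_lt_top hh.memLp.2
    rw [eLpNorm_two_sq] at hfin
    have : eLpNorm Ht 2 volume ^ 2 < ⊤ := by
      rw [eLpNorm_two_sq]
      exact hbound.trans_lt (ENNReal.mul_lt_top hL.lt_top hfin)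
    by_contra hc
    rw [not_lt, top_le_iff] at hc
    simp [hc] at this
  simp_rw [hrep]
  rw [lintegral_enorm_sq_fourierInv hHt2 hHt1]
  exact hbound

/-- A strip of width `2w` with direction `e`. -/
def strip (x e : Plane) (w : ℝ) : Set Plane := {y | |inner ℝ (y - x) (perp e)| ≤ w}

theorem measurableSet_strip (x e : Plane) (w : ℝ) : MeasurableSet (strip x e w) := by
  have h : Continuous fun y : Plane => |inner ℝ (y - x) (perp e)| := by fun_prop
  exact (isClosed_le h continuous_const).measurableSet

theorem lintegral_strip_enorm_fourierInv_sq_le {e : Plane} (he : ‖e‖ = 1) {Ω : Set Plane}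
    (hΩ : Bornology.IsBounded Ω) {L : ℝ≥0∞} (hL : L ≠ ⊤)
    (hslice : ∀ s : ℝ, volume {t : ℝ | (frameEquiv he).symm (s, t) ∈ Ω} ≤ L)
    {h : Plane → ℂ} (hh : SupportedIn Ω h) (x : Plane) (w : ℝ) :
    ∫⁻ y in strip x e w, ‖𝓕⁻ h y‖ₑ ^ 2 ≤
      ENNReal.ofReal (2 * w) * (L * ∫⁻ ξ, ‖h ξ‖ₑ ^ 2) := by
  set P := frameEquiv he with hP
  have hPs : MeasurePreserving P.symm (volume.prod volume) volume :=
    (measurePreserving_frameEquiv he).symm P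
  have hgm : Measurable fun y => ‖𝓕⁻ h y‖ₑ ^ 2 :=
    (continuous_fourierInv_of_integrable (hh.integrable hΩ)).enorm.measurable.pow_const 2
  set t₀ : ℝ := inner ℝ x (perp e) with ht₀
  rw [← lintegral_indicator (measurableSet_strip x e w),
    ← hPs.lintegral_comp_emb P.symm.measurableEmbedding, lintegral_prod_symm]
  · calc ∫⁻ t, ∫⁻ s, (strip x e w).indicator (fun y => ‖𝓕⁻ h y‖ₑ ^ 2) (P.symm (s, t))
        ≤ ∫⁻ t, (Icc (t₀ - w) (t₀ + w)).indicator (fun _ => L * ∫⁻ ξ, ‖h ξ‖ₑ ^ 2) t := by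
          refine lintegral_mono fun t => ?_
          have hmem : ∀ s, P.symm (s, t) ∈ strip x e w ↔ t ∈ Icc (t₀ - w) (t₀ + w) := by
            intro s
            change |_| ≤ w ↔ _
            rw [inner_sub_left, (inner_frameEquiv_symm he _).2, ← ht₀, abs_le, mem_Icc]
            constructor <;> rintro ⟨h1, h2⟩ <;> constructor <;> linarith
          by_cases ht : t ∈ Icc (t₀ - w) (t₀ + w)
          · rw [indicator_of_mem ht]
            simp_rw [indicator_of_mem ((hmem _).2 ht)]
            exact lintegral_line_enorm_fourierInv_sq_le he hΩ hL hslice hh t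
          · rw [indicator_of_notMem ht]
            simp_rw [indicator_of_notMem (fun h' => ht ((hmem _).1 h'))]
            simp
      _ = ENNReal.ofReal (2 * w) * (L * ∫⁻ ξ, ‖h ξ‖ₑ ^ 2) := by
          rw [lintegral_indicator_const measurableSet_Icc, Real.volume_Icc, mul_comm]
          congr 2
          ring
  · exact ((hgm.indicator (measurableSet_strip x e w)).comp P.symm.measurable).aemeasurable

/-- The part of a thin annulus away from the line spanned by `e` has short intersections with the
lines of direction `perp e`. -/
theorem volume_slice_annulus_le {r δ : ℝ} (hr : 4 ≤ r) (hδ : 0 < δ) {e : Plane} (he : ‖e‖ = 1)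
    (s : ℝ) :
    volume {t : ℝ | (frameEquiv he).symm (s, t) ∈
      annulus (2 / r) ∩ {ξ | δ / 40 ≤ |inner ℝ ξ (perp e)|}} ≤ ENNReal.ofReal (14 / (r * δ)) := by
  have hr0 : 0 < r := by linarith
  have hε : 2 / r ≤ 1 / 2 := by
    rw [div_le_div_iff₀ hr0 (by norm_num)]
    linarith
  set A := {t : ℝ | (frameEquiv he).symm (s, t) ∈
    annulus (2 / r) ∩ {ξ | δ / 40 ≤ |inner ℝ ξ (perp e)|}} with hA
  have hmem : ∀ t ∈ A, ∃ a : ℝ, |a - 1| ≤ 2 / r ∧ a ^ 2 = 4 * Real.pi ^ 2 * (s ^ 2 + t ^ 2) ∧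
      δ / 40 ≤ |t| := by
    rintro t ⟨h1, h2⟩
    refine ⟨_, mem_annulus.1 h1, ?_, ?_⟩
    · rw [mul_pow, ← inner_sq_add_inner_perp_sq he, (inner_frameEquiv_symm he _).1,
        (inner_frameEquiv_symm he _).2]
      ring
    · rw [mem_ofPred_eq, (inner_frameEquiv_symm he _).2] at h2
      exact h2
  -- For `t`, `t'` of the same sign `|t + t'| ≥ δ / 20`, while `4π² (t - t')(t + t')` is the
  -- difference of two squared radii in the annulus and hence `O(1/r)`.
  have hclose : ∀ t ∈ A, ∀ t' ∈ A, 0 < t * t' → |t - t'| ≤ 7 / (r * δ) := by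
    intro t ht t' ht' hpos
    obtain ⟨a, ha, hat, htδ⟩ := hmem t ht
    obtain ⟨b, hb, hbt, htδ'⟩ := hmem t' ht'
    have ha' := abs_le.1 ha
    have hb' := abs_le.1 hb
    have h1 : |t + t'| = |t| + |t'| := abs_add_eq_add_abs_iff _ _ |>.2 (by
      rcases pos_and_pos_or_neg_and_neg_of_mul_pos hpos with h | h
      · exact Or.inl ⟨h.1.le, h.2.le⟩
      · exact Or.inr ⟨h.1.le, h.2.le⟩)
    have hab : |a ^ 2 - b ^ 2| ≤ 12 / r := by
      have h1 : |a - b| ≤ 4 / r := by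
        have e4 : 4 / r = 2 / r + 2 / r := by ring
        rw [abs_le]
        constructor <;> linarith
      have h2 : |a + b| ≤ 3 := by
        rw [abs_le]
        constructor <;> linarith
      calc |a ^ 2 - b ^ 2| = |a - b| * |a + b| := by
            rw [← abs_mul]
            congr 1
            ring
        _ ≤ 4 / r * 3 := mul_le_mul h1 h2 (abs_nonneg _) (by positivity)
        _ = 12 / r := by ring
    have h3 : a ^ 2 - b ^ 2 = 4 * Real.pi ^ 2 * ((t - t') * (t + t')) := by
      rw [hat, hbt]
      ring
    rw [h3, abs_mul, abs_mul (t - t'), h1, abs_of_pos (by positivity : 0 < 4 * Real.pi ^ 2)] at hab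
    have h4 : 36 * (|t - t'| * (δ / 20)) ≤ 12 / r := by
      refine le_trans ?_ hab
      have := Real.pi_gt_three
      gcongr
      · nlinarith
      · linarith
    rw [le_div_iff₀ hr0] at h4
    rw [le_div_iff₀ (by positivity)]
    nlinarith
  have hsplit : A ⊆ (A ∩ Ioi 0) ∪ (A ∩ Iio 0) := by
    intro t ht
    obtain ⟨a, -, -, htδ⟩ := hmem t ht
    have : t ≠ 0 := by
      rintro rfl
      rw [abs_zero] at htδ
      linarith
    rcases this.lt_or_gt with h | h
    · exact Or.inr ⟨ht, h⟩
    · exact Or.inl ⟨ht, h⟩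
  have hhalf : ∀ B ⊆ A, (∀ t ∈ B, ∀ t' ∈ B, 0 < t * t') →
      volume B ≤ ENNReal.ofReal (7 / (r * δ)) := by
    intro B hB hpos
    refine (Real.volume_le_diam B).trans (Metric.ediam_le fun t ht t' ht' => ?_)
    rw [edist_dist, Real.dist_eq]
    exact ENNReal.ofReal_le_ofReal (hclose t (hB ht) t' (hB ht') (hpos t ht t' ht'))
  calc volume A ≤ volume (A ∩ Ioi 0) + volume (A ∩ Iio 0) :=
        (measure_mono hsplit).trans (measure_union_le _ _)
    _ ≤ ENNReal.ofReal (7 / (r * δ)) + ENNReal.ofReal (7 / (r * δ)) := by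
        refine add_le_add (hhalf _ inter_subset_left ?_) (hhalf _ inter_subset_left ?_)
        · exact fun t ht t' ht' => mul_pos ht.2 ht'.2
        · exact fun t ht t' ht' => mul_pos_of_neg_of_neg ht.2 ht'.2
    _ = ENNReal.ofReal (14 / (r * δ)) := by
        rw [← ENNReal.ofReal_add (by positivity) (by positivity)]
        congr 1
        ring

/-- The constant in the estimates for sums of bumps. -/
def bumpConst : ℝ≥0∞ := 324 * bumpDecay * tailMass

theorem bumpConst_ne_top : bumpConst ≠ ⊤ := by
  have := bumpDecay_ne_top
  have := tailMass_lt_top.ne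
  unfold bumpConst
  finiteness

/-- The estimate for sums of bumps, applied to the measure with density `‖g‖²`: it reduces mass on
many cubes to mass on translates of `P`. -/
theorem sum_lintegral_gridBump_mul_le {g : Plane → ℂ} (hg : Measurable g) {ρ : ℝ} (hρ : 0 < ρ)
    {P : Set Plane} (hP : MeasurableSet P) (S : Finset (Fin 2 → ℤ))
    (hS : ∀ m ∈ S, ENNReal.ofReal (ρ ^ 2 / 4) ≤ volume (P ∩ gridCube ρ m)) {Λ : ℝ≥0∞}
    (hΛ : ∀ z, ∫⁻ x in {x | x - z ∈ P}, ‖g x‖ₑ ^ 2 ≤ Λ) :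
    ∑ m ∈ S, ∫⁻ x, ‖gridBump bumpPhys ρ m x‖ₑ ^ 2 * ‖g x‖ₑ ^ 2 ≤ bumpConst * Λ := by
  have hgm : Measurable fun x => ‖g x‖ₑ ^ 2 := hg.enorm.pow_const 2
  have hterm : ∀ m, Measurable fun x => ‖gridBump bumpPhys ρ m x‖ₑ ^ 2 := fun m =>
    (measurable_gridBump ρ m).enorm.pow_const 2
  have h := lintegral_sum_gridBump_le enorm_bumpPhys_sq_le hρ hP S hS
    (volume.withDensity fun x => ‖g x‖ₑ ^ 2) (Λ := Λ) fun z => by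
      have hm : MeasurableSet {x : Plane | x - z ∈ P} :=
        measurableSet_preimage (measurable_id.sub_const z) hP
      rw [withDensity_apply _ hm]
      exact hΛ z
  rw [lintegral_withDensity_eq_lintegral_mul _ hgm
    (Finset.measurable_fun_sum S fun m _ => hterm m)] at h
  refine le_trans (le_of_eq ?_) h
  rw [← lintegral_finsetSum (f := fun m x => ‖gridBump bumpPhys ρ m x‖ₑ ^ 2 * ‖g x‖ₑ ^ 2) _
    fun m _ => (hterm m).mul hgm]
  congr with x
  rw [Pi.mul_apply, Finset.mul_sum]
  exact Finset.sum_congr rfl fun m _ => mul_comm _ _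

theorem setOf_sub_mem_thickening_tube_subset {r : ℝ} {x e : Plane} (he : ‖e‖ = 1) (z : Plane) :
    {y | y - z ∈ Metric.thickening (Real.sqrt r) (tube r x e)} ⊆
      strip (x + z) e (3 / 2 * Real.sqrt r) := by
  intro y hy
  have hy' : y - z ∈ Metric.thickening (Real.sqrt r) (tube r x e) := hy
  obtain ⟨u, ⟨-, h1⟩, hd⟩ := Metric.mem_thickening_iff.1 hy'
  have h2 : |inner ℝ (y - z - u) (perp e)| ≤ Real.sqrt r := by
    have h := abs_real_inner_le_norm (y - z - u) (perp e)
    rw [norm_perp he, mul_one, ← dist_eq_norm] at h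
    exact h.trans hd.le
  have h3 : y - (x + z) = (y - z - u) + (u - x) := by abel
  rw [strip, mem_ofPred_eq, h3, inner_add_left]
  refine (abs_add_le _ _).trans ?_
  linarith

/-- A function whose frequencies near the circle are transversal to a tube has a small part of its
mass near that tube. -/
theorem sum_lintegral_gridBump_le_of_transversal {r δ : ℝ} (hr : 4 ≤ r) (hδ : 0 < δ)
    {x e : Plane} (he : ‖e‖ = 1) {Ω : Set Plane} (hΩ : Ω ⊆ annulus (2 / r))
    (htrans : 10 ≤ δ * r → ∀ ξ ∈ Ω, δ / 40 ≤ |inner ℝ ξ (perp e)|)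
    (S : Finset (Fin 2 → ℤ)) (hS : ∀ m ∈ S, (gridCube (Real.sqrt r) m ∩ tube r x e).Nonempty)
    {h : Plane → ℂ} (hh : SupportedIn Ω h) :
    ∑ m ∈ S, ∫⁻ y, ‖gridBump bumpPhys (Real.sqrt r) m y‖ₑ ^ 2 * ‖𝓕⁻ h y‖ₑ ^ 2 ≤
      bumpConst * ENNReal.ofReal (42 / (δ * Real.sqrt r)) * ∫⁻ ξ, ‖h ξ‖ₑ ^ 2 := by
  have hr0 : 0 < r := by linarith
  set ρ := Real.sqrt r with hρ
  have hρ2 : ρ ^ 2 = r := Real.sq_sqrt hr0.le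
  have hρ0 : 2 ≤ ρ := Real.le_sqrt_of_sq_le (by linarith)
  have hΩb : Bornology.IsBounded Ω := (isBounded_annulus _).subset hΩ
  have hgm : Measurable (𝓕⁻ h) :=
    (continuous_fourierInv_of_integrable (hh.integrable hΩb)).measurable
  rw [mul_assoc]
  -- For `δ r < 10` the blur `1/r` may destroy the transversality. But `√r ≥ 2` then gives `δ √r <
  -- 5`, so the claimed gain exceeds `1` and Plancherel suffices, with `P` the whole plane.
  rcases le_or_gt 10 (δ * r) with hδr | hδr
  · refine sum_lintegral_gridBump_mul_le hgm (by linarith)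
      (P := Metric.thickening ρ (tube r x e)) Metric.isOpen_thickening.measurableSet S
      (fun m hm => le_volume_thickening_inter_gridCube (by linarith) le_rfl (hS m hm))
      fun z => ?_
    have hsl : ∀ s : ℝ, volume {t : ℝ | (frameEquiv he).symm (s, t) ∈ Ω} ≤
        ENNReal.ofReal (14 / (r * δ)) := by
      intro s
      have hsub : Ω ⊆ annulus (2 / r) ∩ {ξ | δ / 40 ≤ |inner ℝ ξ (perp e)|} := fun ξ hξ =>
        ⟨hΩ hξ, htrans hδr ξ hξ⟩
      exact (measure_mono (preimage_mono hsub)).trans (volume_slice_annulus_le hr hδ he s)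
    calc ∫⁻ y in {y | y - z ∈ Metric.thickening ρ (tube r x e)}, ‖𝓕⁻ h y‖ₑ ^ 2
        ≤ ∫⁻ y in strip (x + z) e (3 / 2 * ρ), ‖𝓕⁻ h y‖ₑ ^ 2 := 
          lintegral_mono_set (setOf_sub_mem_thickening_tube_subset he z)
      _ ≤ ENNReal.ofReal (2 * (3 / 2 * ρ)) *
            (ENNReal.ofReal (14 / (r * δ)) * ∫⁻ ξ, ‖h ξ‖ₑ ^ 2) :=
          lintegral_strip_enorm_fourierInv_sq_le he hΩb ENNReal.ofReal_ne_top hsl hh _ _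
      _ = ENNReal.ofReal (42 / (δ * ρ)) * ∫⁻ ξ, ‖h ξ‖ₑ ^ 2 := by
          rw [← mul_assoc, ← ENNReal.ofReal_mul (by positivity), ← hρ2]
          congr 2
          field_simp
          norm_num
  · refine sum_lintegral_gridBump_mul_le hgm (by linarith) MeasurableSet.univ S
      (fun m _ => ?_) fun z => ?_
    · rw [univ_inter, gridCube_eq_square, volume_square _ (by linarith)]
      apply ENNReal.ofReal_le_ofReal
      nlinarith
    · simp only [mem_univ, ofPred_true, Measure.restrict_univ]
      rw [hh.plancherel hΩb]
      refine le_mul_of_one_le_left' (ENNReal.one_le_ofReal.2 ?_)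
      rw [le_div_iff₀ (by positivity)]
      nlinarith

/-! ### Induction on scales -/

theorem sum_setLIntegral_le_of_overlap {𝓑 : Finset (Set Plane)} (hm : ∀ B ∈ 𝓑, MeasurableSet B)
    {A : ℝ} (hA : ∀ x : Plane, ({B ∈ (𝓑 : Set (Set Plane)) | x ∈ B}.ncard : ℝ) ≤ A)
    {f : Plane → ℝ≥0∞} (hf : Measurable f) :
    ∑ B ∈ 𝓑, ∫⁻ x in B, f x ≤ ENNReal.ofReal A * ∫⁻ x, f x := by
  classical
  calc ∑ B ∈ 𝓑, ∫⁻ x in B, f x = ∑ B ∈ 𝓑, ∫⁻ x, B.indicator f x :=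
        Finset.sum_congr rfl fun B hB => (lintegral_indicator (hm B hB) f).symm
    _ = ∫⁻ x, ∑ B ∈ 𝓑, B.indicator f x :=
        (lintegral_finsetSum' _ fun B hB => (hf.indicator (hm B hB)).aemeasurable).symm
    _ ≤ ∫⁻ x, ENNReal.ofReal A * f x := by
        refine lintegral_mono fun x => ?_
        have e1 : ∑ B ∈ 𝓑, B.indicator f x = ∑ B ∈ 𝓑 with x ∈ B, f x := by
          rw [Finset.sum_filter]
          exact Finset.sum_congr rfl fun B _ => by by_cases h : x ∈ B <;> simp [h]
        have e2 : {B ∈ (𝓑 : Set (Set Plane)) | x ∈ B} = ((𝓑.filter (x ∈ ·) : Finset _) : Set _) := by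
          ext B
          simp
        have h := hA x
        rw [e2, ncard_coe_finset] at h
        rw [e1, Finset.sum_const, nsmul_eq_mul]
        gcongr
        rw [← ENNReal.ofReal_natCast]
        exact ENNReal.ofReal_le_ofReal h
    _ = _ := lintegral_const_mul _ hf

/-- Bookkeeping for the induction: frequencies blurred by `1/(2πr)` and then localized at scale `√r`
are blurred by at most `1/(2π√r)`, so no constant accumulates over the scales. -/
theorem inv_add_inv_sqrt_le {r : ℝ} (hr : 4 ≤ r) :
    1 / 100 / Real.sqrt r + (2 * Real.pi * r)⁻¹ ≤ (2 * Real.pi * Real.sqrt r)⁻¹ := by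
  set ρ := Real.sqrt r with hρ
  have hρ2 : r = ρ ^ 2 := (Real.sq_sqrt (by linarith)).symm
  have hρ0 : 2 ≤ ρ := Real.le_sqrt_of_sq_le (by linarith)
  have hpi := Real.pi_pos
  rw [hρ2, ← sub_nonneg]
  have : (2 * Real.pi * ρ)⁻¹ - (1 / 100 / ρ + (2 * Real.pi * ρ ^ 2)⁻¹) =
      (50 * (ρ - 1) - Real.pi * ρ) / (100 * Real.pi * ρ ^ 2) := by
    field_simp
    ring
  rw [this]
  apply div_nonneg _ (by positivity)
  nlinarith [Real.pi_lt_four]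

/-- Induction on scales: local estimates at each of the scales `r (k + 1)`, for the passage to the
scale `r k`, combine to an estimate on the smallest scale. -/
theorem sum_setLIntegral_le_prod {r : ℕ → ℝ} {n : ℕ} (hr : ∀ k ≤ n, 4 ≤ r k)
    (hmono : ∀ k ≤ n, r 0 ≤ r k) (hsqrt : ∀ k < n, r k = Real.sqrt (r (k + 1)))
    {Ω : Set Plane} (hΩ : Bornology.IsBounded Ω) {𝓑 : Finset (Set Plane)} {p : Set Plane → Plane}
    (hp : ∀ B ∈ 𝓑, ∀ y ∈ B, ‖y - p B‖ ≤ 3 / 2 * r 0) (hm : ∀ B ∈ 𝓑, MeasurableSet B)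
    {A : ℝ} (hA : ∀ x : Plane, ({B ∈ (𝓑 : Set (Set Plane)) | x ∈ B}.ncard : ℝ) ≤ A)
    {β : ℕ → ℝ≥0∞}
    (step : ∀ k < n, ∀ (m : Fin 2 → ℤ) (S : Finset (Fin 2 → ℤ)) (h : Plane → ℂ),
      SupportedIn (fatten (2 * Real.pi * r (k + 1))⁻¹ Ω) h →
      (∀ m' ∈ S, ∃ B ∈ 𝓑, p B ∈ gridCube (r k) m' ∧ p B ∈ gridCube (r (k + 1)) m) →
      ∑ m' ∈ S, ∫⁻ x, ‖gridBump bumpPhys (r k) m' x‖ₑ ^ 2 * ‖𝓕⁻ h x‖ₑ ^ 2 ≤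
        β (k + 1) * ∫⁻ ξ, ‖h ξ‖ₑ ^ 2)
    {k : ℕ} (hk : k ≤ n) (m : Fin 2 → ℤ) {h : Plane → ℂ}
    (hh : SupportedIn (fatten (2 * Real.pi * r k)⁻¹ Ω) h)
    (𝓒 : Finset (Set Plane)) (h𝓒 : ∀ B ∈ 𝓒, B ∈ 𝓑 ∧ p B ∈ gridCube (r k) m) :
    ∑ B ∈ 𝓒, ∫⁻ x in B, ‖𝓕⁻ h x‖ₑ ^ 2 ≤
      ENNReal.ofReal A * (∏ j ∈ Finset.Icc 1 k, β j) * ∫⁻ ξ, ‖h ξ‖ₑ ^ 2 := by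
  classical
  induction k generalizing m h 𝓒 with
  | zero =>
    have hb := isBounded_fatten (δ := (2 * Real.pi * r 0)⁻¹) hΩ
    have hgm : Measurable fun y => ‖𝓕⁻ h y‖ₑ ^ 2 :=
      (continuous_fourierInv_of_integrable (hh.integrable hb)).enorm.measurable.pow_const 2
    have h1 := sum_setLIntegral_le_of_overlap hm hA hgm
    rw [hh.plancherel hb] at h1
    simp only [Finset.Icc_eq_empty_of_lt zero_lt_one, Finset.prod_empty, mul_one]
    exact (Finset.sum_le_sum_of_subset fun B hB => (h𝓒 B hB).1).trans h1
  | succ k ih =>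
    have hkn : k < n := hk
    have hρ0 : 0 < r k := by linarith [hr k hkn.le]
    have hb := isBounded_fatten (δ := (2 * Real.pi * r (k + 1))⁻¹) hΩ
    choose idx hidx using exists_mem_gridCube hρ0
    set S := 𝓒.image fun B => idx (p B) with hS
    -- The localized function satisfies the frequency hypothesis of the next smaller scale, so the
    -- induction hypothesis applies to it.
    have hloc : ∀ m', SupportedIn (fatten (2 * Real.pi * r k)⁻¹ Ω) (localize (r k) m' h) := by
      intro m'
      refine (hh.localize hρ0 m' hb).mono ((fatten_fatten_subset _ _ _).trans (fatten_mono ?_ _))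
      rw [hsqrt k hkn]
      exact inv_add_inv_sqrt_le (hr (k + 1) hk)
    -- A point of `B` is within `3/2 · r 0` of `p B`, which is within `3/2 · r k` of the corner of
    -- its cube. The sum is at most `3 · r k`, well inside the region where the bump is at least
    -- `1`.
    have hbig : ∀ B ∈ 𝓑, ∀ y ∈ B, 1 ≤ ‖gridBump bumpPhys (r k) (idx (p B)) y‖ₑ ^ 2 := by
      intro B hB y hy
      refine one_le_enorm_bumpPhys ?_
      rw [norm_smul, norm_inv, Real.norm_eq_abs, abs_of_pos hρ0, inv_mul_le_iff₀ hρ0]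
      have h1 := hp B hB y hy
      have h2 := dist_le_of_mem_gridCube (hidx (p B)) (gridCorner_mem hρ0 (idx (p B)))
      have h3 := norm_add_le (y - p B) (p B - gridCorner (r k) (idx (p B)))
      rw [sub_add_sub_cancel] at h3
      linarith [hmono k hkn.le]
    have hpl : ∀ m', ∫⁻ ξ, ‖localize (r k) m' h ξ‖ₑ ^ 2 =
        ∫⁻ x, ‖gridBump bumpPhys (r k) m' x‖ₑ ^ 2 * ‖𝓕⁻ h x‖ₑ ^ 2 := by
      intro m'
      rw [← (hloc m').plancherel (isBounded_fatten hΩ)]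
      congr with x
      rw [fourierInv_localize hρ0 m' (hh.integrable hb), enorm_mul, mul_pow]
    calc ∑ B ∈ 𝓒, ∫⁻ x in B, ‖𝓕⁻ h x‖ₑ ^ 2
        = ∑ m' ∈ S, ∑ B ∈ 𝓒 with idx (p B) = m', ∫⁻ x in B, ‖𝓕⁻ h x‖ₑ ^ 2 :=
          (Finset.sum_fiberwise_of_maps_to (fun B hB => Finset.mem_image_of_mem _ hB) _).symm
      _ ≤ ∑ m' ∈ S, ∑ B ∈ 𝓒 with idx (p B) = m',
            ∫⁻ x in B, ‖𝓕⁻ (localize (r k) m' h) x‖ₑ ^ 2 := by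
          refine Finset.sum_le_sum fun m' _ => Finset.sum_le_sum fun B hB => ?_
          obtain ⟨hB𝓒, rfl⟩ := Finset.mem_filter.1 hB
          refine setLIntegral_mono' (hm B (h𝓒 B hB𝓒).1) fun x hx => ?_
          rw [fourierInv_localize hρ0 _ (hh.integrable hb), enorm_mul, mul_pow]
          exact le_mul_of_one_le_left' (hbig B (h𝓒 B hB𝓒).1 x hx)
      _ ≤ ∑ m' ∈ S, ENNReal.ofReal A * (∏ j ∈ Finset.Icc 1 k, β j) *
            ∫⁻ ξ, ‖localize (r k) m' h ξ‖ₑ ^ 2 := by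
          refine Finset.sum_le_sum fun m' _ => ih hkn.le m' (hloc m') _ fun B hB => ?_
          obtain ⟨hB𝓒, rfl⟩ := Finset.mem_filter.1 hB
          exact ⟨(h𝓒 B hB𝓒).1, hidx _⟩
      _ ≤ ENNReal.ofReal A * (∏ j ∈ Finset.Icc 1 k, β j) *
            (β (k + 1) * ∫⁻ ξ, ‖h ξ‖ₑ ^ 2) := by
          rw [← Finset.mul_sum]
          simp only [hpl]
          gcongr
          refine step k hkn m S h hh fun m' hm' => ?_
          obtain ⟨B, hB, rfl⟩ := Finset.mem_image.1 hm'
          exact ⟨B, (h𝓒 B hB).1, hidx _, (h𝓒 B hB).2⟩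
      _ = _ := by
          rw [Finset.prod_Icc_succ_top (by omega)]
          ring

/-! ### Frequency supports -/

theorem fatten_subset_annulus {r R : ℝ} (hr : 0 < r) (hrR : r ≤ R) {Ω : Set Plane}
    (hΩ : Ω ⊆ annulus (1 / R)) : fatten (2 * Real.pi * r)⁻¹ Ω ⊆ annulus (2 / r) := by
  rintro ξ ⟨ζ, hζ, hd⟩
  have h1 := abs_le.1 (mem_annulus.1 (hΩ hζ))
  have h2 : |‖ξ‖ - ‖ζ‖| ≤ (2 * Real.pi * r)⁻¹ := (abs_norm_sub_norm_le _ _).trans hd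
  have h3 : 1 / R ≤ 1 / r := one_div_le_one_div_of_le hr hrR
  have hpi := Real.pi_pos
  have hc : 2 * Real.pi * (2 * Real.pi * r)⁻¹ = 1 / r := by field_simp
  have h2' := abs_le.1 h2
  have h6 := mul_le_mul_of_nonneg_left h2'.1 (by positivity : 0 ≤ 2 * Real.pi)
  have h7 := mul_le_mul_of_nonneg_left h2'.2 (by positivity : 0 ≤ 2 * Real.pi)
  rw [mul_neg, hc] at h6
  rw [hc] at h7
  have h5 : 2 / r = 1 / r + 1 / r := by ring
  rw [mem_annulus, abs_le]
  constructor <;> linarith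

/-- A unit vector away from `e` and `-e` has a large component perpendicular to `e`. -/
theorem le_abs_inner_perp {δ : ℝ} (hδ : 0 ≤ δ) {e u : Plane} (he : ‖e‖ = 1) (hu : ‖u‖ = 1)
    (h1 : δ ≤ ‖u - e‖) (h2 : δ ≤ ‖u + e‖) : 7 / 10 * δ ≤ |inner ℝ u (perp e)| := by
  have e1 := norm_sub_sq_real u e
  have e2 := norm_add_sq_real u e
  have e3 := inner_sq_add_inner_perp_sq he u
  rw [hu, he] at e1 e2
  rw [hu] at e3
  have h1' := pow_le_pow_left₀ hδ h1 2
  have h2' := pow_le_pow_left₀ hδ h2 2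
  set a : ℝ := inner ℝ u e
  set b : ℝ := inner ℝ u (perp e)
  have h3 : a ^ 2 ≤ (1 - δ ^ 2 / 2) ^ 2 := by
    rw [sq_le_sq, abs_of_nonneg (by linarith : 0 ≤ 1 - δ ^ 2 / 2), abs_le]
    constructor <;> linarith
  have h4 : (7 / 10 * δ) ^ 2 ≤ b ^ 2 := by nlinarith [sq_nonneg δ]
  rw [sq_le_sq, abs_of_nonneg (by positivity)] at h4
  exact h4

/-- The points whose direction stays at distance at least `δ` from `e` and `-e`. -/
def transversalCone (δ : ℝ) (e : Plane) : Set Plane :=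
  {ξ | δ ≤ ‖‖ξ‖⁻¹ • ξ - e‖ ∧ δ ≤ ‖‖ξ‖⁻¹ • ξ + e‖}

/-- Before blurring, the transversal component is at least `7δ/100`, since `‖ζ‖ ≥ 1/10`; the
condition `10 ≤ δ r` makes the blur at most `δ/60`. -/
theorem le_abs_inner_perp_of_mem_fatten {r R δ : ℝ} (hr : 4 ≤ r) (hrR : r ≤ R) (hδ : 0 < δ)
    (hδr : 10 ≤ δ * r) {e : Plane} (he : ‖e‖ = 1) {Ω : Set Plane} (hΩ : Ω ⊆ annulus (1 / R))
    (hΩ' : Ω ⊆ transversalCone δ e) {ξ : Plane} (hξ : ξ ∈ fatten (2 * Real.pi * r)⁻¹ Ω) :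
    δ / 40 ≤ |inner ℝ ξ (perp e)| := by
  obtain ⟨ζ, hζ, hd⟩ := hξ
  have h1 := abs_le.1 (mem_annulus.1 (hΩ hζ))
  have hR : 1 / R ≤ 1 / 4 := one_div_le_one_div_of_le (by norm_num) (hr.trans hrR)
  have hn : 1 / 10 ≤ ‖ζ‖ := by nlinarith [Real.pi_lt_d2, Real.pi_gt_three, norm_nonneg ζ]
  have hζ0 : ζ ≠ 0 := norm_ne_zero_iff.1 (by linarith)
  have h2 := le_abs_inner_perp hδ.le he (norm_smul_inv_norm (𝕜 := ℝ) hζ0) (hΩ' hζ).1 (hΩ' hζ).2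
  simp only [RCLike.ofReal_real_eq_id, id_eq] at h2
  rw [inner_smul_left, abs_mul, conj_trivial, abs_inv, abs_norm, le_inv_mul_iff₀ (by linarith)]
    at h2
  have h3 : |inner ℝ (ξ - ζ) (perp e)| ≤ δ / 60 := by
    refine (abs_real_inner_le_norm _ _).trans ?_
    rw [norm_perp he, mul_one]
    refine hd.trans ?_
    rw [inv_le_comm₀ (by positivity) (by positivity), inv_div, div_le_iff₀ hδ]
    nlinarith [Real.pi_gt_three]
  have h4 : inner ℝ ζ (perp e) = inner ℝ ξ (perp e) - inner ℝ (ξ - ζ) (perp e) := by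
    rw [inner_sub_left]
    ring
  have h5 : |inner ℝ ζ (perp e)| ≤ |inner ℝ ξ (perp e)| + |inner ℝ (ξ - ζ) (perp e)| := by
    rw [h4]
    exact abs_sub _ _
  nlinarith

/-! ### Regular families of balls -/

theorem scale_mono {R : ℝ} (hR : 1 ≤ R) (n : ℕ) {j k : ℕ} (hjk : j ≤ k) :
    scale R n j ≤ scale R n k := by
  refine Real.rpow_le_rpow_of_exponent_le hR ?_
  exact pow_le_pow_of_le_one (by norm_num) (by norm_num) (by omega)

theorem scale_le {R : ℝ} (hR : 1 ≤ R) (n k : ℕ) : scale R n k ≤ R := by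
  rcases le_total k n with h | h
  · exact (scale_mono hR n h).trans (scale_self R n).le
  · rw [scale, Nat.sub_eq_zero_of_le h]
    simp

/-- A finite family `𝓑` of discs or squares of size `scale R n 0` with a choice of points
`p B ∈ B`, whose union is regular. -/
structure IsRegularFamily (A R : ℝ) (n : ℕ) (κ : ℕ → ℝ) (𝓑 : Finset (Set Plane))
    (p : Set Plane → Plane) : Prop where
  one_lt : 1 < R
  four_le : 4 ≤ scale R n 0
  mem : ∀ B ∈ 𝓑, p B ∈ B
  norm_sub_le : ∀ B ∈ 𝓑, ∀ y ∈ B, ‖y - p B‖ ≤ 3 / 2 * scale R n 0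
  measurableSet : ∀ B ∈ 𝓑, MeasurableSet B
  le_volume : ∀ B ∈ 𝓑, ENNReal.ofReal (scale R n 0 ^ 2) ≤ volume B
  overlap : ∀ x : Plane, ({B ∈ (𝓑 : Set (Set Plane)) | x ∈ B}.ncard : ℝ) ≤ A
  near : ∃ c : Plane, ∀ B ∈ 𝓑, ‖p B - c‖ ≤ 2 * R
  regular : IsRegularWithFactors A R n κ (⋃ B ∈ 𝓑, B)

namespace IsRegularFamily

variable {A R : ℝ} {n : ℕ} {κ : ℕ → ℝ} {𝓑 : Finset (Set Plane)} {p : Set Plane → Plane}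

theorem mem_iUnion (H : IsRegularFamily A R n κ 𝓑 p) {B : Set Plane} (hB : B ∈ 𝓑) :
    p B ∈ ⋃ B ∈ 𝓑, B := mem_biUnion hB (H.mem B hB)

theorem four_le_scale (H : IsRegularFamily A R n κ 𝓑 p) (k : ℕ) : 4 ≤ scale R n k :=
  H.four_le.trans (scale_mono H.one_lt.le n (Nat.zero_le k))

theorem scale_pos (H : IsRegularFamily A R n κ 𝓑 p) (k : ℕ) : 0 < scale R n k := by
  linarith [H.four_le_scale k]

theorem scale_eq (H : IsRegularFamily A R n κ 𝓑 p) {k : ℕ} (hk : k < n) :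
    scale R n k = Real.sqrt (scale R n (k + 1)) :=
  scale_eq_sqrt (zero_le_one.trans H.one_lt.le) hk

theorem kappa_pos (H : IsRegularFamily A R n κ 𝓑 p) {k : ℕ} (hk : k ∈ Finset.Icc 1 n) : 0 < κ k :=
  (Real.rpow_pos_of_pos (H.scale_pos k) _).trans_le (H.regular.kappa_mem k hk).1

theorem isBounded (H : IsRegularFamily A R n κ 𝓑 p) : Bornology.IsBounded (⋃ B ∈ 𝓑, B) := by
  refine (Bornology.isBounded_biUnion_finset 𝓑).2 fun B hB => ?_
  refine (Metric.isBounded_closedBall (x := p B) (r := 3 / 2 * scale R n 0)).subset fun y hy => ?_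
  rw [Metric.mem_closedBall, dist_eq_norm]
  exact H.norm_sub_le B hB y hy

/-- All points `p B` lie in boundedly many `R`-cubes, which costs the factor `36`. The subfamily `𝓖`
and the set `Ω` are free, so that one cap can be treated together with just the balls to which it is
transversal. -/
theorem sum_setLIntegral_le (H : IsRegularFamily A R n κ 𝓑 p) {𝓖 : Finset (Set Plane)}
    (h𝓖 : 𝓖 ⊆ 𝓑) {Ω : Set Plane} (hΩ : Bornology.IsBounded Ω) {β : ℕ → ℝ≥0∞}
    (step : ∀ k < n, ∀ (m : Fin 2 → ℤ) (S : Finset (Fin 2 → ℤ)) (h : Plane → ℂ),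
      SupportedIn (fatten (2 * Real.pi * scale R n (k + 1))⁻¹ Ω) h →
      (∀ m' ∈ S, ∃ B ∈ 𝓖, p B ∈ gridCube (scale R n k) m' ∧
        p B ∈ gridCube (scale R n (k + 1)) m) →
      ∑ m' ∈ S, ∫⁻ x, ‖gridBump bumpPhys (scale R n k) m' x‖ₑ ^ 2 * ‖𝓕⁻ h x‖ₑ ^ 2 ≤
        β (k + 1) * ∫⁻ ξ, ‖h ξ‖ₑ ^ 2)
    {h : Plane → ℂ} (hh : SupportedIn Ω h) :
    ∑ B ∈ 𝓖, ∫⁻ x in B, ‖𝓕⁻ h x‖ₑ ^ 2 ≤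
      36 * ENNReal.ofReal A * (∏ j ∈ Finset.Icc 1 n, β j) * ∫⁻ ξ, ‖h ξ‖ₑ ^ 2 := by
  classical
  have hR : 0 < R := by linarith [H.one_lt]
  obtain ⟨c, hc⟩ := H.near
  choose idx hidx using exists_mem_gridCube hR
  have hmaps : ∀ B ∈ 𝓖, idx (p B) ∈ nearbyIndices R c (2 * R) := fun B hB =>
    mem_nearbyIndices hR (hidx _) (hc B (h𝓖 hB))
  have hoverlap : ∀ x : Plane, ({B ∈ (𝓖 : Set (Set Plane)) | x ∈ B}.ncard : ℝ) ≤ A := by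
    intro x
    refine le_trans ?_ (H.overlap x)
    have : {B ∈ (𝓖 : Set (Set Plane)) | x ∈ B} ⊆ {B ∈ (𝓑 : Set (Set Plane)) | x ∈ B} :=
      fun B hB => ⟨h𝓖 hB.1, hB.2⟩
    exact_mod_cast ncard_le_ncard this (𝓑.finite_toSet.subset (sep_subset _ _))
  calc ∑ B ∈ 𝓖, ∫⁻ x in B, ‖𝓕⁻ h x‖ₑ ^ 2
      = ∑ m ∈ nearbyIndices R c (2 * R), ∑ B ∈ 𝓖 with idx (p B) = m,
          ∫⁻ x in B, ‖𝓕⁻ h x‖ₑ ^ 2 := (Finset.sum_fiberwise_of_maps_to hmaps _).symm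
    _ ≤ ∑ m ∈ nearbyIndices R c (2 * R),
          ENNReal.ofReal A * (∏ j ∈ Finset.Icc 1 n, β j) * ∫⁻ ξ, ‖h ξ‖ₑ ^ 2 := by
        refine Finset.sum_le_sum fun m _ => ?_
        refine sum_setLIntegral_le_prod (r := scale R n) (n := n)
          (fun k _ => H.four_le_scale k) (fun k _ => scale_mono H.one_lt.le n (Nat.zero_le k))
          (fun k hk => H.scale_eq hk) hΩ (𝓑 := 𝓖) (p := p)
          (fun B hB => H.norm_sub_le B (h𝓖 hB)) (fun B hB => H.measurableSet B (h𝓖 hB))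
          hoverlap step le_rfl m (hh.mono (subset_fatten ?_ _)) _ fun B hB => ?_
        · have := H.scale_pos n
          positivity
        · obtain ⟨hB1, rfl⟩ := Finset.mem_filter.1 hB
          rw [scale_self]
          exact ⟨hB1, hidx _⟩
    _ ≤ _ := by
        rw [Finset.sum_const, nsmul_eq_mul, mul_assoc 36, mul_assoc 36]
        gcongr
        exact_mod_cast card_nearbyIndices_le hR c

/-- The estimate by the densities of a regular set in tubes. -/
theorem sum_setLIntegral_le_of_density (H : IsRegularFamily A R n κ 𝓑 p) {h : Plane → ℂ}
    (hh : SupportedIn (annulus (1 / R)) h) :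
    ∑ B ∈ 𝓑, ∫⁻ x in B, ‖𝓕⁻ h x‖ₑ ^ 2 ≤
      36 * ENNReal.ofReal A *
        (∏ j ∈ Finset.Icc 1 n, densityConst * ENNReal.ofReal (A * κ j)) *
        ∫⁻ ξ, ‖h ξ‖ₑ ^ 2 := by
  refine H.sum_setLIntegral_le subset_rfl (isBounded_annulus _) (fun k hk m S u hu hS => ?_) hh
  rcases S.eq_empty_or_nonempty with rfl | ⟨m₀, hm₀⟩
  · simp
  have hk1 : k + 1 ∈ Finset.Icc 1 n := Finset.mem_Icc.2 ⟨by omega, hk⟩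
  set r := scale R n (k + 1) with hr
  have hr0 : 0 < r := H.scale_pos _
  rw [H.scale_eq hk, ← hr] at hS ⊢
  set F := ⋃ B ∈ 𝓑, B with hF
  have hne : (gridCube r m ∩ F).Nonempty := by
    obtain ⟨B, hB, -, hB2⟩ := hS m₀ hm₀
    exact ⟨p B, hB2, H.mem_iUnion hB⟩
  have hreg := H.regular.kappa_regular (k + 1) hk1 m hne
  refine sum_lintegral_gridBump_le_of_density (H.four_le_scale _) (E := F ∩ gridCube r m) ?_ S ?_
    (hu.mono (fatten_subset_annulus hr0 (scale_le H.one_lt.le n _) subset_rfl))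
  · rintro T ⟨x, e, he, rfl⟩
    have hb := hreg.tube_bound _ ⟨x, e, he, rfl⟩
    have hfin : volume (Metric.thickening (Real.sqrt r) (F ∩ gridCube r m) ∩ tube r x e) ≠ ⊤ :=
      ((H.isBounded.subset inter_subset_left).thickening.subset
        inter_subset_left).measure_lt_top.ne
    have hvol : volume.real (tube r x e) = r * Real.sqrt r := by
      rw [tube_eq_rectangle, measureReal_def, volume_rectangle he x (by positivity),
        ENNReal.toReal_ofReal (by positivity)]
      ring
    rw [hvol, ← mul_assoc] at hb
    rw [← ENNReal.ofReal_mul' (by positivity), ← ENNReal.ofReal_toReal hfin]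
    exact ENNReal.ofReal_le_ofReal hb
  · intro m' hm'
    obtain ⟨B, hB, hB1, hB2⟩ := hS m' hm'
    exact ⟨p B, hB1, H.mem_iUnion hB, hB2⟩

/-- Choice of a covering of a regular set by tubes at each scale, and of the direction of a tube
through each of the points `p B`. -/
theorem exists_tube_directions (H : IsRegularFamily A R n κ 𝓑 p) :
    ∃ (𝕋 : ℕ → (Fin 2 → ℤ) → Finset (Set Plane)) (e : ℕ → Set Plane → Plane),
      (∀ k ∈ Finset.Icc 1 n, ∀ m, (gridCube (scale R n k) m ∩ ⋃ B ∈ 𝓑, B).Nonempty →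
        ((𝕋 k m).card : ℝ) ≤ A * (volume.real (Metric.thickening (Real.sqrt (scale R n k))
          ((⋃ B ∈ 𝓑, B) ∩ gridCube (scale R n k) m)) / (κ k * scale R n k ^ (3 / 2 : ℝ)))) ∧
      ∀ k ∈ Finset.Icc 1 n, ∀ B ∈ 𝓑, ‖e k B‖ = 1 ∧
        ∀ m, p B ∈ gridCube (scale R n k) m → ∃ x, tube (scale R n k) x (e k B) ∈ 𝕋 k m ∧
          p B ∈ tube (scale R n k) x (e k B) := by
  classical
  set F := ⋃ B ∈ 𝓑, B with hF
  have h1 : ∀ k m, ∃ T : Finset (Set Plane), k ∈ Finset.Icc 1 n →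
      (gridCube (scale R n k) m ∩ F).Nonempty → (∀ t ∈ T, IsTube (scale R n k) t) ∧
        (T.card : ℝ) ≤ A * (volume.real (Metric.thickening (Real.sqrt (scale R n k))
          (F ∩ gridCube (scale R n k) m)) / (κ k * scale R n k ^ (3 / 2 : ℝ))) ∧
        F ∩ gridCube (scale R n k) m ⊆ ⋃ t ∈ T, t := by
    intro k m
    by_cases hk : k ∈ Finset.Icc 1 n
    · by_cases hne : (gridCube (scale R n k) m ∩ F).Nonempty
      · obtain ⟨T, hT⟩ := (H.regular.kappa_regular k hk m hne).tube_cover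
        exact ⟨T, fun _ _ => hT⟩
      · exact ⟨∅, fun _ h => absurd h hne⟩
    · exact ⟨∅, fun h => absurd h hk⟩
  choose 𝕋 h𝕋 using h1
  have h2 : ∀ k B, ∃ e : Plane, k ∈ Finset.Icc 1 n → B ∈ 𝓑 → ‖e‖ = 1 ∧
      ∀ m, p B ∈ gridCube (scale R n k) m → ∃ x, tube (scale R n k) x e ∈ 𝕋 k m ∧
        p B ∈ tube (scale R n k) x e := by
    intro k B
    by_cases hk : k ∈ Finset.Icc 1 n
    · by_cases hB : B ∈ 𝓑
      · obtain ⟨m, hm⟩ := exists_mem_gridCube (H.scale_pos k) (p B)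
        obtain ⟨ht, -, hcov⟩ := h𝕋 k m hk ⟨p B, hm, H.mem_iUnion hB⟩
        obtain ⟨T, hT, hpT⟩ := mem_iUnion₂.1 (hcov ⟨H.mem_iUnion hB, hm⟩)
        obtain ⟨x, e, he, rfl⟩ := ht T hT
        refine ⟨e, fun _ _ => ⟨he, fun m' hm' => ?_⟩⟩
        obtain rfl := gridCube_index_unique (H.scale_pos k) hm hm'
        exact ⟨x, hT, hpT⟩
      · exact ⟨0, fun _ h => absurd h hB⟩
    · exact ⟨0, fun h => absurd h hk⟩
  choose e he using h2
  exact ⟨𝕋, e, fun k hk m hne => (h𝕋 k m hk hne).2.1, fun k hk B hB => he k B hk hB⟩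

/-- The estimate for frequencies transversal to the tubes which cover a regular set. -/
theorem sum_setLIntegral_le_of_transversal (H : IsRegularFamily A R n κ 𝓑 p)
    {𝕋 : ℕ → (Fin 2 → ℤ) → Finset (Set Plane)} {e : ℕ → Set Plane → Plane}
    {τ : ℕ → ℝ} (h𝕋 : ∀ k ∈ Finset.Icc 1 n, ∀ m,
      (gridCube (scale R n k) m ∩ ⋃ B ∈ 𝓑, B).Nonempty → ((𝕋 k m).card : ℝ) ≤ τ k)
    (he : ∀ k ∈ Finset.Icc 1 n, ∀ B ∈ 𝓑, ‖e k B‖ = 1 ∧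
      ∀ m, p B ∈ gridCube (scale R n k) m → ∃ x, tube (scale R n k) x (e k B) ∈ 𝕋 k m ∧
        p B ∈ tube (scale R n k) x (e k B))
    {δ : ℝ} (hδ : 0 < δ) {𝓖 : Finset (Set Plane)} (h𝓖 : 𝓖 ⊆ 𝓑) {Ω : Set Plane}
    (hΩ : Ω ⊆ annulus (1 / R))
    (htrans : ∀ B ∈ 𝓖, ∀ k ∈ Finset.Icc 1 n, Ω ⊆ transversalCone δ (e k B))
    {h : Plane → ℂ} (hh : SupportedIn Ω h) :
    ∑ B ∈ 𝓖, ∫⁻ x in B, ‖𝓕⁻ h x‖ₑ ^ 2 ≤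
      36 * ENNReal.ofReal A *
        (∏ j ∈ Finset.Icc 1 n, bumpConst *
          ENNReal.ofReal (τ j * (42 / (δ * Real.sqrt (scale R n j))))) *
        ∫⁻ ξ, ‖h ξ‖ₑ ^ 2 := by
  classical
  refine H.sum_setLIntegral_le h𝓖 ((isBounded_annulus _).subset hΩ)
    (fun k hk m S u hu hS => ?_) hh
  rcases S.eq_empty_or_nonempty with rfl | ⟨m₀, hm₀⟩
  · simp
  have hk1 : k + 1 ∈ Finset.Icc 1 n := Finset.mem_Icc.2 ⟨by omega, hk⟩
  set r := scale R n (k + 1) with hr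
  have hr0 : 0 < r := H.scale_pos _
  have hrR : r ≤ R := scale_le H.one_lt.le n _
  rw [H.scale_eq hk, ← hr] at hS ⊢
  have hne : (gridCube r m ∩ ⋃ B ∈ 𝓑, B).Nonempty := by
    obtain ⟨B, hB, -, hB2⟩ := hS m₀ hm₀
    exact ⟨p B, hB2, H.mem_iUnion (h𝓖 hB)⟩
  -- Transversality is known only for the directions chosen for balls of `𝓖`, so other covering
  -- tubes are discarded. Each cube of `S` still meets a remaining tube, namely the one through its
  -- point `p B`.
  set 𝕋' := (𝕋 (k + 1) m).filter fun T =>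
    ∃ B ∈ 𝓖, ∃ x, T = tube r x (e (k + 1) B) with h𝕋'
  set D := bumpConst * ENNReal.ofReal (42 / (δ * Real.sqrt r)) * ∫⁻ ξ, ‖u ξ‖ₑ ^ 2 with hD
  calc ∑ m' ∈ S, ∫⁻ x, ‖gridBump bumpPhys (Real.sqrt r) m' x‖ₑ ^ 2 * ‖𝓕⁻ u x‖ₑ ^ 2
      ≤ ∑ m' ∈ S, ∑ T ∈ 𝕋' with (gridCube (Real.sqrt r) m' ∩ T).Nonempty,
          ∫⁻ x, ‖gridBump bumpPhys (Real.sqrt r) m' x‖ₑ ^ 2 * ‖𝓕⁻ u x‖ₑ ^ 2 := by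
        refine Finset.sum_le_sum fun m' hm' => ?_
        obtain ⟨B, hB, hB1, hB2⟩ := hS m' hm'
        obtain ⟨x, hx, hpx⟩ := (he (k + 1) hk1 B (h𝓖 hB)).2 m hB2
        refine Finset.single_le_sum (f := fun _ : Set Plane =>
          ∫⁻ x, ‖gridBump bumpPhys (Real.sqrt r) m' x‖ₑ ^ 2 * ‖𝓕⁻ u x‖ₑ ^ 2)
          (fun _ _ => zero_le) (a := tube r x (e (k + 1) B)) ?_
        exact Finset.mem_filter.2 ⟨Finset.mem_filter.2 ⟨hx, B, hB, x, rfl⟩, p B, hB1, hpx⟩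
    _ = ∑ T ∈ 𝕋', ∑ m' ∈ S with (gridCube (Real.sqrt r) m' ∩ T).Nonempty,
          ∫⁻ x, ‖gridBump bumpPhys (Real.sqrt r) m' x‖ₑ ^ 2 * ‖𝓕⁻ u x‖ₑ ^ 2 := by
        simp only [Finset.sum_filter]
        exact Finset.sum_comm
    _ ≤ ∑ T ∈ 𝕋', D := by
        refine Finset.sum_le_sum fun T hT => ?_
        obtain ⟨-, B, hB, x, rfl⟩ := Finset.mem_filter.1 hT
        have hB1 := (he (k + 1) hk1 B (h𝓖 hB)).1
        exact sum_lintegral_gridBump_le_of_transversal (H.four_le_scale _) hδ hB1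
          (fatten_subset_annulus hr0 hrR hΩ)
          (fun hδr ξ hξ => le_abs_inner_perp_of_mem_fatten (H.four_le_scale _) hrR hδ hδr hB1 hΩ
            (htrans B hB _ hk1) hξ) _ (fun m' hm' => (Finset.mem_filter.1 hm').2) hu
    _ ≤ ENNReal.ofReal (τ (k + 1)) * D := by
        rw [Finset.sum_const, nsmul_eq_mul]
        gcongr
        rw [← ENNReal.ofReal_natCast]
        refine ENNReal.ofReal_le_ofReal ((Nat.cast_le.2 ?_).trans (h𝕋 (k + 1) hk1 m hne))
        exact Finset.card_filter_le _ _
    _ = _ := by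
        rw [hD, ENNReal.ofReal_mul' (by positivity)]
        ring

end IsRegularFamily

/-! ### The volume of a regular set -/

/-- The part of the neighbourhood that spills out of the cube is controlled by the part inside: near
every point of `E` a fixed proportion of the `ρ`-ball stays in the cube. -/
theorem volume_thickening_le_of_subset_gridCube {ρ r : ℝ} (hρ : 0 < ρ) (hr : ρ ≤ r)
    {E : Set Plane} {m : Fin 2 → ℤ} (hE : E ⊆ gridCube r m) :
    volume (Metric.thickening ρ E) ≤ 64 * volume (Metric.thickening ρ E ∩ gridCube r m) := by
  have h := mul_volume_le_of_le_volume_inter_ball (P := Metric.thickening ρ E)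
    (S := Metric.thickening ρ E ∩ gridCube r m) (α := ENNReal.ofReal (ρ ^ 2 / 4)) (ρ := 2 * ρ)
    Metric.isOpen_thickening.measurableSet fun z hz => by
      obtain ⟨x, hx, hd⟩ := Metric.mem_thickening_iff.1 hz
      refine (le_volume_gridCube_inter_ball hρ hr (hE hx)).trans (measure_mono ?_)
      rintro y ⟨hy1, hy2⟩
      refine ⟨⟨Metric.ball_subset_thickening hx ρ hy2, hy1⟩, ?_⟩
      rw [Metric.mem_ball] at hy2 ⊢
      have := dist_triangle_right y z x
      linarith
  have ha0 : ENNReal.ofReal (ρ ^ 2 / 4) ≠ 0 := by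
    rw [Ne, ENNReal.ofReal_eq_zero, not_le]
    positivity
  refine (ENNReal.mul_le_mul_iff_right ha0 ENNReal.ofReal_ne_top).1 (h.trans ?_)
  rw [← mul_assoc]
  gcongr
  refine (volume_ball_le _ (by positivity)).trans (le_of_eq ?_)
  rw [← ENNReal.ofReal_ofNat 64, ← ENNReal.ofReal_mul (by positivity)]
  congr 1
  ring

namespace IsRegularFamily

variable {A R : ℝ} {n : ℕ} {κ : ℕ → ℝ} {𝓑 : Finset (Set Plane)} {p : Set Plane → Plane}

/-- The indices of the cubes of a grid which meet the union of the family. -/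
def cells (H : IsRegularFamily A R n κ 𝓑 p) (k : ℕ) : Finset (Fin 2 → ℤ) :=
  (finite_setOf_gridCube_inter_nonempty (H.scale_pos k) H.isBounded).toFinset

theorem mem_cells (H : IsRegularFamily A R n κ 𝓑 p) {k : ℕ} {m : Fin 2 → ℤ} :
    m ∈ H.cells k ↔ (gridCube (scale R n k) m ∩ ⋃ B ∈ 𝓑, B).Nonempty :=
  Finite.mem_toFinset _

/-- The volume of the neighbourhood of the union of the family at a scale. -/
def nhdVolume (_ : IsRegularFamily A R n κ 𝓑 p) (k : ℕ) : ℝ :=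
  volume.real (Metric.thickening (scale R n k) (⋃ B ∈ 𝓑, B))

theorem volume_thickening_ne_top (H : IsRegularFamily A R n κ 𝓑 p) (ρ : ℝ) :
    volume (Metric.thickening ρ (⋃ B ∈ 𝓑, B)) ≠ ⊤ := H.isBounded.thickening.measure_lt_top.ne

/-- Uniformity makes all occupied cells carry comparable mass, so the mass in one cell is at most
about the total divided by the number of cells. -/
theorem card_cells_mul_le (H : IsRegularFamily A R n κ 𝓑 p) {k : ℕ} (hk : k ∈ Finset.Icc 1 n)
    (hA : 0 ≤ A) {m : Fin 2 → ℤ} (hm : m ∈ H.cells k) :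
    ((H.cells k).card : ℝ) * volume.real (Metric.thickening (scale R n (k - 1)) (⋃ B ∈ 𝓑, B) ∩
      gridCube (scale R n k) m) ≤ A * H.nhdVolume (k - 1) := by
  set F := ⋃ B ∈ 𝓑, B with hF
  set N := Metric.thickening (scale R n (k - 1)) F with hN
  have hNt : volume N ≠ ⊤ := H.volume_thickening_ne_top _
  calc ((H.cells k).card : ℝ) * volume.real (N ∩ gridCube (scale R n k) m)
      = ∑ _m' ∈ H.cells k, volume.real (N ∩ gridCube (scale R n k) m) := by
        rw [Finset.sum_const, nsmul_eq_mul]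
    _ ≤ ∑ m' ∈ H.cells k, A * volume.real (N ∩ gridCube (scale R n k) m') :=
        Finset.sum_le_sum fun m' hm' =>
          H.regular.uniform k hk m m' (H.mem_cells.1 hm) (H.mem_cells.1 hm')
    _ = A * volume.real (⋃ m' ∈ H.cells k, N ∩ gridCube (scale R n k) m') := by
        rw [← Finset.mul_sum, measureReal_biUnion_finset]
        · intro m' _ m'' _ hne
          exact (pairwise_disjoint_gridCube (H.scale_pos k) hne).mono inter_subset_right
            inter_subset_right
        · exact fun m' _ => Metric.isOpen_thickening.measurableSet.inter
            (measurableSet_gridCube _ _)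
    _ ≤ A * H.nhdVolume (k - 1) := by
        gcongr
        exact measureReal_mono (iUnion₂_subset fun m' _ => inter_subset_left) hNt

theorem nhdVolume_le (H : IsRegularFamily A R n κ 𝓑 p) (k : ℕ) :
    H.nhdVolume k ≤ 25 * ((H.cells k).card * scale R n k ^ 2) := by
  set r := scale R n k with hr
  have hr0 : 0 < r := H.scale_pos k
  have hsub : Metric.thickening r (⋃ B ∈ 𝓑, B) ⊆
      ⋃ m ∈ H.cells k, Metric.ball (gridCorner r m) (5 / 2 * r) := by
    intro z hz
    obtain ⟨x, hx, hd⟩ := Metric.mem_thickening_iff.1 hz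
    obtain ⟨m, hm⟩ := exists_mem_gridCube hr0 x
    refine mem_iUnion₂.2 ⟨m, H.mem_cells.2 ⟨x, hm, hx⟩, ?_⟩
    have h1 := dist_le_of_mem_gridCube hm (gridCorner_mem hr0 m)
    rw [← dist_eq_norm] at h1
    rw [Metric.mem_ball]
    have := dist_triangle z x (gridCorner r m)
    linarith
  have hball : ∀ x : Plane, volume.real (Metric.ball x (5 / 2 * r)) ≤ 25 * r ^ 2 := by
    intro x
    refine ENNReal.toReal_le_of_le_ofReal (by positivity)
      ((volume_ball_le x (by positivity)).trans (le_of_eq ?_))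
    congr 1
    ring
  calc H.nhdVolume k ≤ volume.real (⋃ m ∈ H.cells k, Metric.ball (gridCorner r m) (5 / 2 * r)) :=
        measureReal_mono hsub
          ((Bornology.isBounded_biUnion_finset _).2 fun _ _ => Metric.isBounded_ball
            ).measure_lt_top.ne
    _ ≤ ∑ m ∈ H.cells k, volume.real (Metric.ball (gridCorner r m) (5 / 2 * r)) :=
        measureReal_biUnion_finset_le _ _
    _ ≤ ∑ _m ∈ H.cells k, 25 * r ^ 2 := Finset.sum_le_sum fun m _ => hball _
    _ = _ := by
        rw [Finset.sum_const, nsmul_eq_mul]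
        ring

/-- Each point of the neighbourhood has an entire ball or square of the family within distance `5K`,
so at the smallest scale thickening costs only a constant. -/
theorem nhdVolume_zero_le (H : IsRegularFamily A R n κ 𝓑 p) :
    H.nhdVolume 0 ≤ 100 * volume.real (⋃ B ∈ 𝓑, B) := by
  set K := scale R n 0 with hK
  have hK0 : 0 < K := H.scale_pos 0
  set F := ⋃ B ∈ 𝓑, B with hF
  have hFt : volume F ≠ ⊤ := H.isBounded.measure_lt_top.ne
  have h := mul_volume_le_of_le_volume_inter_ball (P := Metric.thickening K F)
    (S := F) (α := ENNReal.ofReal (K ^ 2)) (ρ := 5 * K)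
    Metric.isOpen_thickening.measurableSet fun z hz => by
      obtain ⟨x, hx, hd⟩ := Metric.mem_thickening_iff.1 hz
      obtain ⟨B, hB, hxB⟩ := mem_iUnion₂.1 hx
      refine (H.le_volume B hB).trans (measure_mono fun y hy => ⟨mem_biUnion hB hy, ?_⟩)
      have h1 := H.norm_sub_le B hB y hy
      have h2 := H.norm_sub_le B hB x hxB
      rw [← dist_eq_norm] at h1 h2
      have h3 := dist_triangle_right y x (p B)
      have h4 := dist_triangle_right y z x
      rw [Metric.mem_ball]
      linarith
  have ha0 : ENNReal.ofReal (K ^ 2) ≠ 0 := by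
    rw [Ne, ENNReal.ofReal_eq_zero, not_le]
    positivity
  have h2 : volume (Metric.thickening K F) ≤ 100 * volume F := by
    refine (ENNReal.mul_le_mul_iff_right ha0 ENNReal.ofReal_ne_top).1 (h.trans ?_)
    rw [← mul_assoc]
    gcongr
    refine (volume_ball_le _ (by positivity)).trans (le_of_eq ?_)
    rw [← ENNReal.ofReal_ofNat 100, ← ENNReal.ofReal_mul (by positivity)]
    congr 1
    ring
  have h3 := ENNReal.toReal_mono (ENNReal.mul_ne_top (by norm_num) hFt) h2
  rw [ENNReal.toReal_mul, ENNReal.toReal_ofNat] at h3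
  exact h3

theorem le_nhdVolume (H : IsRegularFamily A R n κ 𝓑 p) (h𝓑 : 𝓑.Nonempty) (k : ℕ) :
    scale R n k ^ 2 / 4 ≤ H.nhdVolume k := by
  obtain ⟨B, hB⟩ := h𝓑
  obtain ⟨m, hm⟩ := exists_mem_gridCube (H.scale_pos k) (p B)
  have h := (le_volume_thickening_inter_gridCube (H.scale_pos k) le_rfl
    ⟨p B, hm, H.mem_iUnion hB⟩).trans (measure_mono inter_subset_left)
  exact (ENNReal.ofReal_le_iff_le_toReal (H.volume_thickening_ne_top _)).1 h

theorem card_cells_pos (H : IsRegularFamily A R n κ 𝓑 p) (h𝓑 : 𝓑.Nonempty) (k : ℕ) :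
    0 < (H.cells k).card := by
  obtain ⟨B, hB⟩ := h𝓑
  obtain ⟨m, hm⟩ := exists_mem_gridCube (H.scale_pos k) (p B)
  exact Finset.card_pos.2 ⟨m, H.mem_cells.2 ⟨p B, hm, H.mem_iUnion hB⟩⟩

/-- The volumes of the neighbourhoods of the parts of the set in the cubes of a scale, relative to
the cubes, multiply to the relative volume of the set. -/
theorem exists_volume_bounds (H : IsRegularFamily A R n κ 𝓑 p) (hA : 0 ≤ A) (h𝓑 : 𝓑.Nonempty) :
    ∃ N : ℕ → ℝ, (∀ k, 0 ≤ N k) ∧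
      (∀ k ∈ Finset.Icc 1 n, ∀ m, (gridCube (scale R n k) m ∩ ⋃ B ∈ 𝓑, B).Nonempty →
        volume.real (Metric.thickening (Real.sqrt (scale R n k))
          ((⋃ B ∈ 𝓑, B) ∩ gridCube (scale R n k) m)) ≤ N k) ∧
      ∏ k ∈ Finset.Icc 1 n, N k / scale R n k ^ 2 ≤
        400 * (1600 * A) ^ n * (volume.real (⋃ B ∈ 𝓑, B) / R ^ 2) := by
  set F := ⋃ B ∈ 𝓑, B with hF
  have hν : ∀ k, (0 : ℝ) < (H.cells k).card := fun k => by exact_mod_cast H.card_cells_pos h𝓑 k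
  have ha : ∀ k, 0 < H.nhdVolume k := fun k => by
    have := H.le_nhdVolume h𝓑 k
    have := H.scale_pos k
    have : 0 < scale R n k ^ 2 / 4 := by positivity
    linarith
  -- This is the average mass per cell at scale `k`; `A` comes from uniformity and `64` from the
  -- mass spilling out of a cell.
  refine ⟨fun k => 64 * (A * H.nhdVolume (k - 1) / (H.cells k).card), fun k => ?_, ?_, ?_⟩
  · have := hν k
    have := ha (k - 1)
    positivity
  · intro k hk m hne
    have hk' := Finset.mem_Icc.1 hk
    have hsq : Real.sqrt (scale R n k) = scale R n (k - 1) := by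
      rw [H.scale_eq (by omega : k - 1 < n), Nat.sub_add_cancel hk'.1]
    rw [hsq]
    have h1 := volume_thickening_le_of_subset_gridCube (H.scale_pos (k - 1))
      (scale_mono H.one_lt.le n (Nat.sub_le k 1)) (E := F ∩ gridCube (scale R n k) m)
      inter_subset_right
    have h2 : volume (Metric.thickening (scale R n (k - 1)) (F ∩ gridCube (scale R n k) m) ∩
        gridCube (scale R n k) m) ≤
        volume (Metric.thickening (scale R n (k - 1)) F ∩ gridCube (scale R n k) m) :=
      measure_mono (inter_subset_inter_left _
        (Metric.thickening_subset_of_subset _ inter_subset_left))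
    have hfin : volume (Metric.thickening (scale R n (k - 1)) F ∩ gridCube (scale R n k) m) ≠ ⊤ :=
      measure_ne_top_of_subset inter_subset_left (H.volume_thickening_ne_top _)
    have h3 := ENNReal.toReal_mono (ENNReal.mul_ne_top (by norm_num) hfin)
      (h1.trans (mul_le_mul_right h2 64))
    rw [ENNReal.toReal_mul, ENNReal.toReal_ofNat] at h3
    refine h3.trans (mul_le_mul_of_nonneg_left ?_ (by norm_num))
    rw [le_div_iff₀ (hν k), mul_comm]
    exact H.card_cells_mul_le hk hA (H.mem_cells.2 hne)
  -- The occupied cells cover the neighbourhood at their own scale, so the factor at `k` is at most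
  -- `1600 A` times the ratio of the neighbourhood volumes at `k - 1` and `k`. The product
  -- telescopes.
  · have hstep : ∀ j, ∏ k ∈ Finset.Icc 1 j,
        64 * (A * H.nhdVolume (k - 1) / (H.cells k).card) / scale R n k ^ 2 ≤
          (1600 * A) ^ j * (H.nhdVolume 0 / H.nhdVolume j) := by
      intro j
      induction j with
      | zero => simp [(ha 0).ne']
      | succ j ih =>
        have h1 : 64 * (A * H.nhdVolume j / (H.cells (j + 1)).card) / scale R n (j + 1) ^ 2 ≤
            1600 * A * (H.nhdVolume j / H.nhdVolume (j + 1)) := by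
          have hs := H.scale_pos (j + 1)
          have hv := hν (j + 1)
          have haj := ha j
          have := H.nhdVolume_le (j + 1)
          calc _ = 1600 * A * H.nhdVolume j /
                (25 * ((H.cells (j + 1)).card * scale R n (j + 1) ^ 2)) := by
                field_simp
                ring
            _ ≤ 1600 * A * H.nhdVolume j / H.nhdVolume (j + 1) :=
                div_le_div_of_nonneg_left (by positivity) (ha _) this
            _ = _ := by ring
        rw [Finset.prod_Icc_succ_top (by omega), Nat.add_sub_cancel]
        calc _ ≤ (1600 * A) ^ j * (H.nhdVolume 0 / H.nhdVolume j) *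
              (1600 * A * (H.nhdVolume j / H.nhdVolume (j + 1))) := by
              refine mul_le_mul ih h1 ?_ ?_
              · have hv := hν (j + 1)
                have haj := ha j
                positivity
              · have haj := ha j
                have ha0 := ha 0
                positivity
          _ = _ := by
              have haj := ha j
              rw [pow_succ]
              field_simp
    refine (hstep n).trans ?_
    have hR : 0 < R := by linarith [H.one_lt]
    have hn := H.le_nhdVolume h𝓑 n
    rw [scale_self] at hn
    have h0 : H.nhdVolume 0 / H.nhdVolume n ≤ 400 * (volume.real F / R ^ 2) := by
      rw [mul_div_assoc', div_le_div_iff₀ (ha n) (by positivity)]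
      have hF0 : 0 ≤ volume.real F := measureReal_nonneg
      nlinarith [H.nhdVolume_zero_le, sq_nonneg R]
    calc _ ≤ (1600 * A) ^ n * (400 * (volume.real F / R ^ 2)) := by gcongr
      _ = _ := by ring

end IsRegularFamily

/-! ### Discs and squares -/

theorem IsBallOrCube.exists_center {r : ℝ} (hr : 0 < r) {B : Set Plane} (hB : IsBallOrCube r B) :
    ∃ p ∈ B, (∀ y ∈ B, ‖y - p‖ ≤ 3 / 2 * r) ∧ MeasurableSet B ∧
      ENNReal.ofReal (r ^ 2) ≤ volume B := by
  obtain ⟨c, rfl | rfl⟩ := hB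
  · refine ⟨c, Metric.mem_closedBall_self hr.le, fun y hy => ?_, measurableSet_closedBall, ?_⟩
    · rw [Metric.mem_closedBall, dist_eq_norm] at hy
      linarith
    · refine le_trans ?_ (measure_mono Metric.ball_subset_closedBall)
      rw [EuclideanSpace.volume_ball_fin_two, ← ENNReal.ofReal_pow hr.le,
        ← ENNReal.ofReal_mul (by positivity)]
      apply ENNReal.ofReal_le_ofReal
      have := Real.pi_gt_three
      nlinarith [sq_nonneg r]
  · have hc : c ∈ square c r := fun i => ⟨le_rfl, by linarith⟩
    exact ⟨c, hc, fun y hy => dist_le_of_mem_square hy hc, measurableSet_square c r,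
      (volume_square c hr.le).ge⟩

theorem IsRegularWithFactors.exists_isRegularFamily {A R : ℝ} {n : ℕ} {κ : ℕ → ℝ}
    {𝓑 : Finset (Set Plane)} {B_R : Set Plane} (hR : 1 < R) (hK : 4 ≤ scale R n 0)
    (h𝓑 : ∀ B ∈ 𝓑, IsBallOrCube (scale R n 0) B)
    (hA : ∀ x : Plane, ({B ∈ (𝓑 : Set (Set Plane)) | x ∈ B}.ncard : ℝ) ≤ A)
    (hB_R : IsBallOrCube R B_R) (hsub : (⋃ B ∈ 𝓑, B) ⊆ B_R)
    (hreg : IsRegularWithFactors A R n κ (⋃ B ∈ 𝓑, B)) :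
    ∃ p, IsRegularFamily A R n κ 𝓑 p := by
  have hK0 : 0 < scale R n 0 := by linarith
  choose! p hp using fun B hB => (h𝓑 B hB).exists_center hK0
  obtain ⟨c, -, hc, -⟩ := hB_R.exists_center (by linarith)
  refine ⟨p, hR, hK, fun B hB => (hp B hB).1, fun B hB => (hp B hB).2.1,
    fun B hB => (hp B hB).2.2.1, fun B hB => (hp B hB).2.2.2, hA, ⟨c, fun B hB => ?_⟩, hreg⟩
  have := hc _ (hsub (mem_biUnion hB (hp B hB).1))
  linarith

/-! ### The multiplier operators on the frequency side -/

theorem ae_eq_fourierInv_of_fourier_ae_eq {g : Lp ℂ 2 (volume : Measure Plane)} {h : Plane → ℂ}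
    (h2 : MemLp h 2 volume) (h1 : Integrable h)
    (hg : ((𝓕 g : Lp ℂ 2 (volume : Measure Plane)) : Plane → ℂ) =ᵐ[volume] h) :
    (g : Plane → ℂ) =ᵐ[volume] 𝓕⁻ h := by
  have e : (𝓕 g : Lp ℂ 2 (volume : Measure Plane)) = h2.toLp h :=
    Lp.ext (hg.trans h2.coeFn_toLp.symm)
  have := fourierInv_toLp_ae_eq h2 h1
  rwa [← e, FourierTransform.fourierInv_fourier_eq] at this

theorem SupportedIn.symbol_mul {m : Plane → ℝ} (hm : Measurable m) {C : ℝ} (hC : ∀ ξ, |m ξ| ≤ C)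
    {Ω : Set Plane} {h : Plane → ℂ} (hh : SupportedIn Ω h) :
    SupportedIn (Ω ∩ {ξ | m ((2 * Real.pi) • ξ) ≠ 0})
      fun ξ => (m ((2 * Real.pi) • ξ) : ℂ) * h ξ := by
  refine ⟨MemLp.of_le_mul (c := C) hh.memLp ?_ ?_, fun ξ hξ => ?_⟩
  · exact (Complex.measurable_ofReal.comp
      (hm.comp (measurable_const_smul (2 * Real.pi)))).aestronglyMeasurable.mul
      hh.memLp.aestronglyMeasurable
  · filter_upwards with ξ
    rw [norm_mul, Complex.norm_real, Real.norm_eq_abs]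
    exact mul_le_mul_of_nonneg_right (hC _) (norm_nonneg _)
  · rw [Function.mem_support] at hξ
    refine ⟨hh.support_subset (right_ne_zero_of_mul hξ), ?_⟩
    have := left_ne_zero_of_mul hξ
    exact_mod_cast this

theorem multiplierOp_ae_eq {m : Plane → ℝ} (hm : Measurable m) {C : ℝ} (hC : ∀ ξ, |m ξ| ≤ C)
    {Ω : Set Plane} (hΩ : Bornology.IsBounded Ω) {h : Plane → ℂ} (hh : SupportedIn Ω h)
    {g : Lp ℂ 2 (volume : Measure Plane)}
    (hg : ((𝓕 g : Lp ℂ 2 (volume : Measure Plane)) : Plane → ℂ) =ᵐ[volume] h) :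
    (multiplierOp m g : Plane → ℂ) =ᵐ[volume]
      𝓕⁻ fun ξ => (m ((2 * Real.pi) • ξ) : ℂ) * h ξ := by
  have hs := hh.symbol_mul hm hC
  refine ae_eq_fourierInv_of_fourier_ae_eq hs.memLp
    (hs.integrable (hΩ.subset inter_subset_left)) ?_
  filter_upwards [fourier_multiplierOp hm hC g, hg] with ξ h1 h2
  rw [h1, h2]

/-- The support of `a` in `[-1,1]` forces `|‖2πξ‖ - 1| ≤ 1/R`. A representative that vanishes
everywhere outside the annulus is provided, as the pointwise arguments require. -/
theorem exists_fourier_opS {a : ℝ → ℝ} (ha : IsBump a) {R : ℝ} (hR : 0 < R)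
    (f : Lp ℂ 2 (volume : Measure Plane)) :
    ∃ h, SupportedIn (annulus (1 / R)) h ∧
      ((𝓕 (opS a R f) : Lp ℂ 2 (volume : Measure Plane)) : Plane → ℂ) =ᵐ[volume] h := by
  have hcs : HasCompactSupport a := isCompact_Icc.of_isClosed_subset (isClosed_tsupport a) ha.support
  obtain ⟨C, hC⟩ := hcs.exists_bound_of_continuous ha.smooth.continuous
  set m : Plane → ℝ := fun ξ => a (R * (1 - ‖ξ‖)) with hm
  have hmeas : Measurable m := (ha.smooth.continuous.comp (by fun_prop)).measurable
  have hb : ∀ ξ, |m ξ| ≤ C := fun ξ => by simpa using hC (R * (1 - ‖ξ‖))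
  have h0 : SupportedIn univ ((𝓕 f : Lp ℂ 2 (volume : Measure Plane)) : Plane → ℂ) :=
    ⟨Lp.memLp _, subset_univ _⟩
  refine ⟨_, (h0.symbol_mul hmeas hb).mono ?_, fourier_multiplierOp hmeas hb f⟩
  rintro ξ ⟨-, hξ⟩
  have h1 : R * (1 - ‖(2 * Real.pi) • ξ‖) ∈ Icc (-1 : ℝ) 1 :=
    ha.support (subset_tsupport a hξ)
  have h2 : ‖(2 * Real.pi) • ξ‖ = 2 * Real.pi * ‖ξ‖ := by
    rw [norm_smul, Real.norm_of_nonneg (by positivity)]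
  rw [h2] at h1
  have h3 : |2 * Real.pi * ‖ξ‖ - 1| ≤ 1 / R := by
    rw [le_div_iff₀ hR, ← abs_of_pos hR, ← abs_mul, abs_le]
    constructor <;> nlinarith [h1.1, h1.2]
  exact mem_annulus.2 h3

theorem IsConicBump.measurable {σ : Set Plane} {b : Plane → ℝ} (hb : IsConicBump σ b) :
    Measurable b := by
  refine measurable_of_restrict_of_restrict_compl (s := {0}ᶜ)
    (measurableSet_singleton _).compl ?_ ?_
  · exact (continuousOn_iff_continuous_domRestrict.1 hb.smooth.continuousOn).measurable
  · have : Subsingleton ((({0}ᶜ : Set Plane)ᶜ : Set Plane)) := by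
      rw [compl_compl]
      infer_instance
    exact Subsingleton.measurable

theorem IsConicBump.abs_le_one {σ : Set Plane} {b : Plane → ℝ} (hb : IsConicBump σ b) (ξ : Plane) :
    |b ξ| ≤ 1 := by
  have := hb.range ξ
  rw [abs_of_nonneg this.1]
  exact this.2

theorem IsConicBump.mem_of_ne_zero {σ : Set Plane} {b : Plane → ℝ} (hb : IsConicBump σ b)
    {t : ℝ} (ht : 0 < t) {ξ : Plane} (h : b (t • ξ) ≠ 0) : ‖ξ‖⁻¹ • ξ ∈ σ := by
  have h1 : ‖t • ξ‖⁻¹ • (t • ξ) ∈ σ := hb.support h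
  rwa [norm_smul, Real.norm_of_nonneg ht.le, smul_smul, mul_inv, mul_right_comm,
    inv_mul_cancel₀ ht.ne', one_mul] at h1

theorem ne_zero_of_mem_annulus {ε : ℝ} (hε : ε < 1) {ξ : Plane} (hξ : ξ ∈ annulus ε) : ξ ≠ 0 := by
  rintro rfl
  have h : |2 * Real.pi * ‖(0 : Plane)‖ - 1| ≤ ε := mem_annulus.1 hξ
  rw [norm_zero, mul_zero, zero_sub, abs_neg, abs_one] at h
  linarith

/-- At each nonzero frequency at most `N` of the symbols are nonzero, because the corresponding caps
contain its direction; each symbol is at most `1`. -/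
theorem sum_lintegral_cap_le {A c ρ : ℝ} {N : ℕ} {Sig : Finset (Set Plane)}
    {b : Set Plane → Plane → ℝ} (hcρ : 0 < c * ρ) (hS : IsCapFamily A c N ρ Sig)
    (hb : ∀ σ ∈ Sig, IsConicBump σ (b σ)) {ε : ℝ} (hε : ε < 1) {h : Plane → ℂ}
    (hh : SupportedIn (annulus ε) h) :
    ∑ σ ∈ Sig, ∫⁻ ξ, ‖(b σ ((2 * Real.pi) • ξ) : ℂ) * h ξ‖ₑ ^ 2 ≤ N * ∫⁻ ξ, ‖h ξ‖ₑ ^ 2 := by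
  classical
  rw [← lintegral_finsetSum', ← lintegral_const_mul' _ _ (ENNReal.natCast_ne_top N)]
  · refine lintegral_mono fun ξ => ?_
    by_cases hξ : h ξ = 0
    · simp [hξ]
    have h0 := ne_zero_of_mem_annulus hε (hh.support_subset hξ)
    have he : ‖‖ξ‖⁻¹ • ξ‖ = 1 := norm_smul_inv_norm (𝕜 := ℝ) h0
    have hcard : (Sig.filter fun σ => b σ ((2 * Real.pi) • ξ) ≠ 0).card ≤ N := by
      refine le_trans ?_ (hS.overlap _ he)
      rw [← ncard_coe_finset]
      refine ncard_le_ncard (fun σ hσ => ?_) (Sig.finite_toSet.subset fun σ hσ => hσ.1)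
      rw [Finset.mem_coe, Finset.mem_filter] at hσ
      refine ⟨hσ.1, ‖ξ‖⁻¹ • ξ, (hb σ hσ.1).mem_of_ne_zero Real.two_pi_pos hσ.2, Or.inl ?_⟩
      simpa using hcρ
    calc ∑ σ ∈ Sig, ‖(b σ ((2 * Real.pi) • ξ) : ℂ) * h ξ‖ₑ ^ 2
        = ∑ σ ∈ Sig with b σ ((2 * Real.pi) • ξ) ≠ 0,
            ‖(b σ ((2 * Real.pi) • ξ) : ℂ) * h ξ‖ₑ ^ 2 := by
          refine (Finset.sum_filter_of_ne (p := fun σ => b σ ((2 * Real.pi) • ξ) ≠ 0)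
            fun σ _ hne h0 => hne ?_).symm
          simp [h0]
      _ ≤ ∑ σ ∈ Sig with b σ ((2 * Real.pi) • ξ) ≠ 0, ‖h ξ‖ₑ ^ 2 := by
          refine Finset.sum_le_sum fun σ hσ => ?_
          have h1 : ‖(b σ ((2 * Real.pi) • ξ) : ℂ)‖ₑ ≤ 1 := by
            rw [← ofReal_norm, Complex.norm_real, Real.norm_eq_abs]
            exact ENNReal.ofReal_le_one.2 ((hb σ (Finset.mem_filter.1 hσ).1).abs_le_one _)
          rw [enorm_mul]
          gcongr
          exact (mul_le_mul_left h1 _).trans (one_mul _).le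
      _ ≤ N * ‖h ξ‖ₑ ^ 2 := by
          rw [Finset.sum_const, nsmul_eq_mul]
          gcongr
  · intro σ hσ
    have := ((hh.symbol_mul (hb σ hσ).measurable (hb σ hσ).abs_le_one).memLp.aestronglyMeasurable)
    exact this.enorm.pow_const 2

/-! ### The broad norm -/

/-- The cap `σ` stays at distance `δ` from the lines in all the directions `e k B`, `1 ≤ k ≤ n`. -/
def IsTransversalCap (n : ℕ) (δ : ℝ) (e : ℕ → Set Plane → Plane) (B σ : Set Plane) : Prop :=
  ∀ k ∈ Finset.Icc 1 n, ¬ IsNearLine δ (e k B) σ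

/-- Pigeonhole: at most `N` caps are near each of the `n` lines, and `N n < (N + 1) n ≤ M` since `n
≥ 1`. -/
theorem exists_isTransversalCap {A c ρ : ℝ} {N n M : ℕ} {Sig : Finset (Set Plane)}
    (hS : IsCapFamily A c N ρ Sig) (hn : 1 ≤ n) (hM : (N + 1) * n ≤ M)
    {e : ℕ → Set Plane → Plane} {B : Set Plane} (he : ∀ k ∈ Finset.Icc 1 n, ‖e k B‖ = 1)
    {Sig' : Finset (Set Plane)} (hsub : Sig' ⊆ Sig) (hcard : Sig'.card = M) :
    ∃ σ ∈ Sig', IsTransversalCap n (c * ρ) e B σ := by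
  classical
  by_contra! hcon
  have hcov : Sig' ⊆ (Finset.Icc 1 n).biUnion fun k =>
      Sig.filter fun σ => IsNearLine (c * ρ) (e k B) σ := by
    intro σ hσ
    have := hcon σ hσ
    simp only [IsTransversalCap, not_forall, not_not] at this
    obtain ⟨k, hk, hnear⟩ := this
    exact Finset.mem_biUnion.2 ⟨k, hk, Finset.mem_filter.2 ⟨hsub hσ, hnear⟩⟩
  have h1 : Sig'.card ≤ (Finset.Icc 1 n).card * N := by
    refine (Finset.card_le_card hcov).trans (Finset.card_biUnion_le_card_mul _ _ _ fun k hk => ?_)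
    refine le_trans (le_of_eq ?_) (hS.overlap _ (he k hk))
    rw [← ncard_coe_finset]
    congr 1
    ext σ
    simp
  rw [Nat.card_Icc, hcard, Nat.add_sub_cancel] at h1
  nlinarith

-- At the maximizing subcollection the minimum is at most the value at a cap transversal to `B`.
-- That cap depends on `B`, so the sum runs over all transversal caps.
open Classical in
theorem broadNorm_sq_le {A c ρ : ℝ} {N n M : ℕ} {Sig : Finset (Set Plane)}
    (hS : IsCapFamily A c N ρ Sig) (hn : 1 ≤ n) (hM : (N + 1) * n ≤ M)
    {e : ℕ → Set Plane → Plane} {B : Set Plane} (he : ∀ k ∈ Finset.Icc 1 n, ‖e k B‖ = 1)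
    {b : Set Plane → Plane → ℝ} {g : Lp ℂ 2 (volume : Measure Plane)} {u : Set Plane → Plane → ℂ}
    (hu : ∀ σ ∈ Sig, (multiplierOp (b σ) g : Plane → ℂ) =ᵐ[volume] u σ) :
    broadNorm Sig b M g B ^ 2 ≤
      ∑ σ ∈ Sig with IsTransversalCap n (c * ρ) e B σ, ∫⁻ x in B, ‖u σ x‖ₑ ^ 2 := by
  rw [broadNorm]
  rcases (Sig.powersetCard M).eq_empty_or_nonempty with h0 | h0
  · simp [h0]
  obtain ⟨Sig', hSig', heq⟩ := Finset.exists_mem_eq_sup _ h0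
    fun Sig' => Sig'.inf fun σ => eLpNorm (multiplierOp (b σ) g) 2 (volume.restrict B)
  rw [heq]
  rw [Finset.mem_powersetCard] at hSig'
  obtain ⟨σ, hσ, ht⟩ := exists_isTransversalCap hS hn hM he hSig'.1 hSig'.2
  have h1 : (Sig'.inf fun σ => eLpNorm (multiplierOp (b σ) g) 2 (volume.restrict B)) ≤
      eLpNorm (multiplierOp (b σ) g) 2 (volume.restrict B) := Finset.inf_le hσ
  calc _ ≤ eLpNorm (multiplierOp (b σ) g) 2 (volume.restrict B) ^ 2 := by gcongr
    _ = ∫⁻ x in B, ‖u σ x‖ₑ ^ 2 := by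
        rw [eLpNorm_congr_ae (ae_restrict_of_ae (hu σ (hSig'.1 hσ))), eLpNorm_two_sq]
    _ ≤ _ := Finset.single_le_sum (f := fun σ => ∫⁻ x in B, ‖u σ x‖ₑ ^ 2)
        (fun _ _ => zero_le) (Finset.mem_filter.2 ⟨hSig'.1 hσ, ht⟩)

namespace IsRegularFamily

variable {A R : ℝ} {n : ℕ} {κ : ℕ → ℝ} {𝓑 : Finset (Set Plane)} {p : Set Plane → Plane}
  {c ρ : ℝ} {N M : ℕ} {Sig : Finset (Set Plane)} {b : Set Plane → Plane → ℝ} {h : Plane → ℂ}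
  {g : Lp ℂ 2 (volume : Measure Plane)}

theorem inv_lt_one (H : IsRegularFamily A R n κ 𝓑 p) : 1 / R < 1 := by
  rw [div_lt_one (zero_lt_one.trans H.one_lt)]
  exact H.one_lt

-- Interchanging the sums attaches to each cap the balls to which it is transversal, so the
-- multi-scale estimate can be applied to one function and one subfamily at a time.
open Classical in
theorem sum_broadNorm_sq_le (hS : IsCapFamily A c N ρ Sig)
    (hn : 1 ≤ n) (hM : (N + 1) * n ≤ M) (hb : ∀ σ ∈ Sig, IsConicBump σ (b σ))
    {Ω : Set Plane} (hΩ : Bornology.IsBounded Ω) (hh : SupportedIn Ω h)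
    (hg : ((𝓕 g : Lp ℂ 2 (volume : Measure Plane)) : Plane → ℂ) =ᵐ[volume] h)
    {e : ℕ → Set Plane → Plane} (he : ∀ k ∈ Finset.Icc 1 n, ∀ B ∈ 𝓑, ‖e k B‖ = 1) :
    ∑ B ∈ 𝓑, broadNorm Sig b M g B ^ 2 ≤
      ∑ σ ∈ Sig, ∑ B ∈ 𝓑 with IsTransversalCap n (c * ρ) e B σ,
        ∫⁻ x in B, ‖𝓕⁻ (fun ξ => (b σ ((2 * Real.pi) • ξ) : ℂ) * h ξ) x‖ₑ ^ 2 := by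
  refine (Finset.sum_le_sum fun B hB => broadNorm_sq_le hS hn hM (fun k hk => he k hk B hB)
    fun σ hσ => multiplierOp_ae_eq (hb σ hσ).measurable (hb σ hσ).abs_le_one hΩ hh hg).trans
    (le_of_eq ?_)
  simp only [Finset.sum_filter]
  exact Finset.sum_comm

theorem sum_broadNorm_sq_le_of_directions (H : IsRegularFamily A R n κ 𝓑 p)
    (hcρ : 0 < c * ρ) (hS : IsCapFamily A c N ρ Sig) (hn : 1 ≤ n) (hM : (N + 1) * n ≤ M)
    (hb : ∀ σ ∈ Sig, IsConicBump σ (b σ)) (hh : SupportedIn (annulus (1 / R)) h)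
    (hg : ((𝓕 g : Lp ℂ 2 (volume : Measure Plane)) : Plane → ℂ) =ᵐ[volume] h)
    {𝕋 : ℕ → (Fin 2 → ℤ) → Finset (Set Plane)} {e : ℕ → Set Plane → Plane} {τ : ℕ → ℝ}
    (h𝕋 : ∀ k ∈ Finset.Icc 1 n, ∀ m,
      (gridCube (scale R n k) m ∩ ⋃ B ∈ 𝓑, B).Nonempty → ((𝕋 k m).card : ℝ) ≤ τ k)
    (he : ∀ k ∈ Finset.Icc 1 n, ∀ B ∈ 𝓑, ‖e k B‖ = 1 ∧
      ∀ m, p B ∈ gridCube (scale R n k) m → ∃ x, tube (scale R n k) x (e k B) ∈ 𝕋 k m ∧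
        p B ∈ tube (scale R n k) x (e k B)) :
    ∑ B ∈ 𝓑, broadNorm Sig b M g B ^ 2 ≤
      36 * ENNReal.ofReal A *
        (∏ j ∈ Finset.Icc 1 n, bumpConst *
          ENNReal.ofReal (τ j * (42 / (c * ρ * Real.sqrt (scale R n j))))) *
        (N * ∫⁻ ξ, ‖h ξ‖ₑ ^ 2) := by
  classical
  refine (sum_broadNorm_sq_le hS hn hM hb (isBounded_annulus _) hh hg
    fun k hk B hB => (he k hk B hB).1).trans ?_
  refine le_trans (Finset.sum_le_sum fun σ hσ => ?_)
    (le_trans (Finset.mul_sum _ _ _).ge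
      (mul_le_mul_right (sum_lintegral_cap_le hcρ hS hb H.inv_lt_one hh) _))
  refine H.sum_setLIntegral_le_of_transversal h𝕋 he hcρ (Finset.filter_subset _ _)
    inter_subset_left (fun B hB k hk ξ hξ => ?_)
    (hh.symbol_mul (hb σ hσ).measurable (hb σ hσ).abs_le_one)
  have hσ' := (hb σ hσ).mem_of_ne_zero Real.two_pi_pos hξ.2
  have ht := (Finset.mem_filter.1 hB).2 k hk
  exact ⟨not_lt.1 fun h1 => ht ⟨_, hσ', Or.inl h1⟩, not_lt.1 fun h1 => ht ⟨_, hσ', Or.inr h1⟩⟩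

/-- After the reduction to single caps, transversality is dropped and the density estimate is
applied to each cap over all the balls. -/
theorem sum_broadNorm_sq_le_of_density (H : IsRegularFamily A R n κ 𝓑 p)
    (hcρ : 0 < c * ρ) (hS : IsCapFamily A c N ρ Sig) (hn : 1 ≤ n) (hM : (N + 1) * n ≤ M)
    (hb : ∀ σ ∈ Sig, IsConicBump σ (b σ)) (hh : SupportedIn (annulus (1 / R)) h)
    (hg : ((𝓕 g : Lp ℂ 2 (volume : Measure Plane)) : Plane → ℂ) =ᵐ[volume] h) :
    ∑ B ∈ 𝓑, broadNorm Sig b M g B ^ 2 ≤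
      36 * ENNReal.ofReal A *
        (∏ j ∈ Finset.Icc 1 n, densityConst * ENNReal.ofReal (A * κ j)) *
        (N * ∫⁻ ξ, ‖h ξ‖ₑ ^ 2) := by
  classical
  obtain ⟨_, e, -, he⟩ := H.exists_tube_directions
  refine (sum_broadNorm_sq_le hS hn hM hb (isBounded_annulus _) hh hg
    fun k hk B hB => (he k hk B hB).1).trans ?_
  refine le_trans (Finset.sum_le_sum fun σ hσ => ?_)
    (le_trans (Finset.mul_sum _ _ _).ge
      (mul_le_mul_right (sum_lintegral_cap_le hcρ hS hb H.inv_lt_one hh) _))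
  exact (Finset.sum_le_sum_of_subset (Finset.filter_subset _ _)).trans
    (H.sum_setLIntegral_le_of_density ((hh.symbol_mul (hb σ hσ).measurable
      (hb σ hσ).abs_le_one).mono inter_subset_left))

theorem prod_density_eq (H : IsRegularFamily A R n κ 𝓑 p) (hA : 0 ≤ A) :
    ∏ j ∈ Finset.Icc 1 n, densityConst * ENNReal.ofReal (A * κ j) =
      ENNReal.ofReal ((densityConst.toReal * A) ^ n * ∏ j ∈ Finset.Icc 1 n, κ j) := by
  rw [Finset.prod_congr rfl (g := fun j => ENNReal.ofReal (densityConst.toReal * A * κ j)),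
    ← ENNReal.ofReal_prod_of_nonneg, Finset.prod_mul_distrib, Finset.prod_const, Nat.card_Icc,
    Nat.add_sub_cancel]
  · intro j hj
    have := H.kappa_pos hj
    positivity
  · intro j hj
    rw [mul_assoc, ENNReal.ofReal_mul ENNReal.toReal_nonneg,
      ENNReal.ofReal_toReal densityConst_ne_top]

/-- The number of tubes times the transversal gain is, at each scale, a constant times `κ⁻¹ (c ρ)⁻¹`
times a relative volume; the relative volumes multiply to `|F| / R²`. -/
theorem sum_broadNorm_sq_le_of_volume (H : IsRegularFamily A R n κ 𝓑 p) (hA : 0 ≤ A)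
    (h𝓑 : 𝓑.Nonempty) (hcρ : 0 < c * ρ) (hS : IsCapFamily A c N ρ Sig) (hn : 1 ≤ n)
    (hM : (N + 1) * n ≤ M) (hb : ∀ σ ∈ Sig, IsConicBump σ (b σ))
    (hh : SupportedIn (annulus (1 / R)) h)
    (hg : ((𝓕 g : Lp ℂ 2 (volume : Measure Plane)) : Plane → ℂ) =ᵐ[volume] h) :
    ∑ B ∈ 𝓑, broadNorm Sig b M g B ^ 2 ≤
      36 * ENNReal.ofReal A *
        ENNReal.ofReal ((bumpConst.toReal * (42 * A) * (1600 * A) / (c * ρ)) ^ n *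
          (∏ j ∈ Finset.Icc 1 n, (κ j)⁻¹) * (400 * (volume.real (⋃ B ∈ 𝓑, B) / R ^ 2))) *
        (N * ∫⁻ ξ, ‖h ξ‖ₑ ^ 2) := by
  obtain ⟨𝕋, e, h𝕋, he⟩ := H.exists_tube_directions
  obtain ⟨V, hV0, hV, hprod⟩ := H.exists_volume_bounds hA h𝓑
  refine (H.sum_broadNorm_sq_le_of_directions hcρ hS hn hM hb hh hg (𝕋 := 𝕋)
    (τ := fun k => A * (V k / (κ k * scale R n k ^ (3 / 2 : ℝ)))) (fun k hk m hm => ?_) he).trans ?_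
  · have h1 := H.kappa_pos hk
    have h2 := H.scale_pos k
    refine (h𝕋 k hk m hm).trans ?_
    gcongr
    exact hV k hk m hm
  gcongr
  rw [Finset.prod_congr rfl (g := fun j => ENNReal.ofReal
      (bumpConst.toReal * (42 * A) / (c * ρ) * (κ j)⁻¹ * (V j / scale R n j ^ 2))),
    ← ENNReal.ofReal_prod_of_nonneg, Finset.prod_mul_distrib, Finset.prod_mul_distrib,
    Finset.prod_const, Nat.card_Icc, Nat.add_sub_cancel]
  · apply ENNReal.ofReal_le_ofReal
    have h1 : 0 ≤ ∏ j ∈ Finset.Icc 1 n, (κ j)⁻¹ :=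
      Finset.prod_nonneg fun j hj => (inv_pos.2 (H.kappa_pos hj)).le
    calc _ ≤ (bumpConst.toReal * (42 * A) / (c * ρ)) ^ n * (∏ j ∈ Finset.Icc 1 n, (κ j)⁻¹) *
          (400 * (1600 * A) ^ n * (volume.real (⋃ B ∈ 𝓑, B) / R ^ 2)) := by gcongr
      _ = _ := by
          rw [mul_div_right_comm _ (1600 * A), mul_pow _ (1600 * A)]
          ring
  · intro j hj
    have h1 := H.kappa_pos hj
    have h2 := H.scale_pos j
    have h3 := hV0 j
    positivity
  · intro j hj
    have h1 := H.kappa_pos hj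
    have h2 := H.scale_pos j
    have h4 : scale R n j ^ (3 / 2 : ℝ) = scale R n j * Real.sqrt (scale R n j) := by
      rw [Real.sqrt_eq_rpow, ← Real.rpow_one_add' h2.le (by norm_num)]
      norm_num
    have h5 : scale R n j = Real.sqrt (scale R n j) ^ 2 := (Real.sq_sqrt h2.le).symm
    have h6 : 0 < Real.sqrt (scale R n j) := Real.sqrt_pos.2 h2
    rw [h4, ← ENNReal.ofReal_toReal bumpConst_ne_top, ← ENNReal.ofReal_mul ENNReal.toReal_nonneg,
      ENNReal.toReal_ofReal ENNReal.toReal_nonneg]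
    congr 1
    have h7 : c * ρ ≠ 0 := hcρ.ne'
    generalize Real.sqrt (scale R n j) = s at *
    rw [h5]
    field_simp

end IsRegularFamily

/-! ### The three inequalities for a regular family. -/

/-- One of `α`, `β` is at most `γ`. This form of the geometric mean avoids square roots of extended
reals. -/
theorem ENNReal.le_ofReal_mul_of_mul_le_sq {X Y : ℝ≥0∞} {α β γ : ℝ} (hγ : 0 ≤ γ)
    (hα : X ≤ ENNReal.ofReal α * Y) (hβ : X ≤ ENNReal.ofReal β * Y) (h : α * β ≤ γ ^ 2) :
    X ≤ ENNReal.ofReal γ * Y := by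
  rcases le_total α γ with h1 | h1
  · exact hα.trans (mul_le_mul_left (ENNReal.ofReal_le_ofReal h1) _)
  · by_cases h2 : β ≤ γ
    · exact hβ.trans (mul_le_mul_left (ENNReal.ofReal_le_ofReal h2) _)
    · rw [not_le] at h2
      have h3 : α = γ := by
        by_contra h4
        have h5 : γ < α := lt_of_le_of_ne h1 (Ne.symm h4)
        nlinarith
      exact hα.trans (by rw [h3])

namespace IsRegularFamily

variable {A R : ℝ} {n : ℕ} {κ : ℕ → ℝ} {𝓑 : Finset (Set Plane)} {p : Set Plane → Plane}
  {c : ℝ} {N M : ℕ} {Sig : Finset (Set Plane)} {b : Set Plane → Plane → ℝ} {h : Plane → ℂ}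
  {g : Lp ℂ 2 (volume : Measure Plane)}

/-- Each scale contributes one logarithm from the angle `c / log R` and one that absorbs the
constant; `14400 = 36 · 400`. -/
theorem sum_broadNorm_sq_le_volume (H : IsRegularFamily A R n κ 𝓑 p) (hA : 0 ≤ A) (hc : 0 < c)
    (hL1 : 1 ≤ Real.log R) (hL : bumpConst.toReal * (42 * A) * (1600 * A) / c ≤ Real.log R)
    (hS : IsCapFamily A c N (Real.log R)⁻¹ Sig) (hn : 1 ≤ n)
    (hM : (N + 1) * n ≤ M) (hb : ∀ σ ∈ Sig, IsConicBump σ (b σ))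
    (hh : SupportedIn (annulus (1 / R)) h)
    (hg : ((𝓕 g : Lp ℂ 2 (volume : Measure Plane)) : Plane → ℂ) =ᵐ[volume] h) :
    ∑ B ∈ 𝓑, broadNorm Sig b M g B ^ 2 ≤
      ENNReal.ofReal (14400 * A * N * Real.log R ^ (2 * n) * (∏ j ∈ Finset.Icc 1 n, (κ j)⁻¹) *
        (volume.real (⋃ B ∈ 𝓑, B) / R ^ 2)) * ∫⁻ ξ, ‖h ξ‖ₑ ^ 2 := by
  rcases 𝓑.eq_empty_or_nonempty with rfl | h𝓑
  · simp
  have hP : 0 ≤ ∏ j ∈ Finset.Icc 1 n, (κ j)⁻¹ :=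
    Finset.prod_nonneg fun j hj => (inv_pos.2 (H.kappa_pos hj)).le
  have hL0 : 0 < Real.log R := by linarith
  refine (H.sum_broadNorm_sq_le_of_volume hA h𝓑 (mul_pos hc (inv_pos.2 hL0)) hS hn hM hb hh
    hg).trans ?_
  rw [← ENNReal.ofReal_natCast, ← mul_assoc, ← ENNReal.ofReal_ofNat, ← ENNReal.ofReal_mul (by simp),
    ← ENNReal.ofReal_mul (by positivity), ← ENNReal.ofReal_mul (by positivity)]
  refine mul_le_mul_left (ENNReal.ofReal_le_ofReal ?_) _
  rw [← div_eq_mul_inv, div_div_eq_mul_div, mul_div_right_comm, mul_pow]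
  set D := bumpConst.toReal * (42 * A) * (1600 * A) / c with hD
  have hD0 : 0 ≤ D := by positivity
  calc _ ≤ 36 * A * (Real.log R ^ n * Real.log R ^ n * (∏ j ∈ Finset.Icc 1 n, (κ j)⁻¹) *
        (400 * (volume.real (⋃ B ∈ 𝓑, B) / R ^ 2))) * N := by gcongr
    _ = _ := by ring

theorem sum_broadNorm_sq_le_kappa (H : IsRegularFamily A R n κ 𝓑 p) (hA : 0 ≤ A) (hc : 0 < c)
    (hL1 : 1 ≤ Real.log R) (hL : densityConst.toReal * A ≤ Real.log R)
    (hS : IsCapFamily A c N (Real.log R)⁻¹ Sig) (hn : 1 ≤ n)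
    (hM : (N + 1) * n ≤ M) (hb : ∀ σ ∈ Sig, IsConicBump σ (b σ))
    (hh : SupportedIn (annulus (1 / R)) h)
    (hg : ((𝓕 g : Lp ℂ 2 (volume : Measure Plane)) : Plane → ℂ) =ᵐ[volume] h) :
    ∑ B ∈ 𝓑, broadNorm Sig b M g B ^ 2 ≤
      ENNReal.ofReal (36 * A * N * Real.log R ^ n * ∏ j ∈ Finset.Icc 1 n, κ j) *
        ∫⁻ ξ, ‖h ξ‖ₑ ^ 2 := by
  have hP : 0 ≤ ∏ j ∈ Finset.Icc 1 n, κ j :=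
    Finset.prod_nonneg fun j hj => (H.kappa_pos hj).le
  have hL0 : 0 < Real.log R := by linarith
  refine (H.sum_broadNorm_sq_le_of_density (mul_pos hc (inv_pos.2 hL0)) hS hn hM hb hh
    hg).trans ?_
  rw [H.prod_density_eq hA, ← ENNReal.ofReal_natCast, ← mul_assoc, ← ENNReal.ofReal_ofNat,
    ← ENNReal.ofReal_mul (by simp), ← ENNReal.ofReal_mul (by positivity),
    ← ENNReal.ofReal_mul (by positivity)]
  refine mul_le_mul_left (ENNReal.ofReal_le_ofReal ?_) _
  calc _ ≤ 36 * A * (Real.log R ^ n * ∏ j ∈ Finset.Icc 1 n, κ j) * N := by gcongr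
    _ = _ := by ring

/-- In the product of the two bounds for the broad sum the factors `κ` cancel, leaving `log R ^ (3
n)` and the relative volume to the first power. -/
theorem sum_broadNorm_sq_le_sqrt_volume (H : IsRegularFamily A R n κ 𝓑 p) (hA : 0 ≤ A)
    (hc : 0 < c) (hL1 : 1 ≤ Real.log R)
    (hL : bumpConst.toReal * (42 * A) * (1600 * A) / c ≤ Real.log R)
    (hL' : densityConst.toReal * A ≤ Real.log R)
    (hS : IsCapFamily A c N (Real.log R)⁻¹ Sig) (hn : 1 ≤ n)
    (hM : (N + 1) * n ≤ M) (hb : ∀ σ ∈ Sig, IsConicBump σ (b σ))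
    (hh : SupportedIn (annulus (1 / R)) h)
    (hg : ((𝓕 g : Lp ℂ 2 (volume : Measure Plane)) : Plane → ℂ) =ᵐ[volume] h) :
    ∑ B ∈ 𝓑, broadNorm Sig b M g B ^ 2 ≤
      ENNReal.ofReal (14400 * A * N * Real.log R ^ (2 * n) *
        (volume.real (⋃ B ∈ 𝓑, B) / R ^ 2) ^ (1 / 2 : ℝ)) * ∫⁻ ξ, ‖h ξ‖ₑ ^ 2 := by
  have hv : 0 ≤ volume.real (⋃ B ∈ 𝓑, B) / R ^ 2 := by positivity
  have hL0 : 0 < Real.log R := by linarith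
  refine ENNReal.le_ofReal_mul_of_mul_le_sq (by positivity)
    (H.sum_broadNorm_sq_le_volume hA hc hL1 hL hS hn hM hb hh hg)
    (H.sum_broadNorm_sq_le_kappa hA hc hL1 hL' hS hn hM hb hh hg) ?_
  rw [← Real.sqrt_eq_rpow, mul_pow _ (Real.sqrt _), Real.sq_sqrt hv]
  set v := volume.real (⋃ B ∈ 𝓑, B) / R ^ 2
  have hP : (∏ j ∈ Finset.Icc 1 n, (κ j)⁻¹) * ∏ j ∈ Finset.Icc 1 n, κ j = 1 := by
    rw [← Finset.prod_mul_distrib]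
    exact Finset.prod_eq_one fun j hj => inv_mul_cancel₀ (H.kappa_pos hj).ne'
  calc _ = 14400 * A * N * (36 * A * N) * Real.log R ^ (3 * n) * v *
        ((∏ j ∈ Finset.Icc 1 n, (κ j)⁻¹) * ∏ j ∈ Finset.Icc 1 n, κ j) := by ring
    _ ≤ 14400 * A * N * (14400 * A * N) * Real.log R ^ (4 * n) * v := by
        rw [hP, mul_one]
        gcongr <;> norm_num
    _ = _ := by ring

theorem setLIntegral_iUnion_le (H : IsRegularFamily A R n κ 𝓑 p) (hA : 1 ≤ A) (hn : 1 ≤ n)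
    (hh : SupportedIn (annulus (1 / R)) h) :
    ∫⁻ x in ⋃ B ∈ 𝓑, B, ‖𝓕⁻ h x‖ₑ ^ 2 ≤
      ENNReal.ofReal ((36 * A * (densityConst.toReal * A)) ^ n * ∏ j ∈ Finset.Icc 1 n, κ j) *
        ∫⁻ ξ, ‖h ξ‖ₑ ^ 2 := by
  have hA0 : 0 ≤ A := by linarith
  have hP : 0 ≤ ∏ j ∈ Finset.Icc 1 n, κ j :=
    Finset.prod_nonneg fun j hj => (H.kappa_pos hj).le
  have h1 : ∫⁻ x in ⋃ B ∈ 𝓑, B, ‖𝓕⁻ h x‖ₑ ^ 2 ≤ ∑ B ∈ 𝓑, ∫⁻ x in B, ‖𝓕⁻ h x‖ₑ ^ 2 := by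
    classical
    clear hP H
    induction 𝓑 using Finset.induction_on with
    | empty => simp
    | insert B s hB ih =>
      rw [Finset.set_biUnion_insert, Finset.sum_insert hB]
      exact (lintegral_union_le _ _ _).trans (add_le_add_right ih _)
  refine (h1.trans (H.sum_setLIntegral_le_of_density hh)).trans ?_
  rw [H.prod_density_eq hA0, ← ENNReal.ofReal_ofNat, ← ENNReal.ofReal_mul (by simp),
    ← ENNReal.ofReal_mul (by positivity)]
  refine mul_le_mul_left (ENNReal.ofReal_le_ofReal ?_) _
  rw [mul_pow (36 * A), ← mul_assoc]
  gcongr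
  -- Since `36 A ≥ 1` and `n ≥ 1`, the single factor `36 A` goes into the `n`-th power; no logarithm
  -- is lost.
  exact le_self_pow₀ (by linarith) (by omega)

end IsRegularFamily

end

/-! ### The proposition and the choice of its constants. -/

theorem proposition1p10 (A c : ℝ) (hA : 1 ≤ A) (hc : 0 < c) (N : ℕ) :
    ∃ C K₀ : ℝ, 1 ≤ C ∧ 1 < K₀ ∧
      ∀ (n M : ℕ) (K R : ℝ) (κ : ℕ → ℝ) (𝓑 : Finset (Set Plane)) (F B_R : Set Plane)
        (a : ℝ → ℝ) (Sig : Finset (Set Plane)) (b : Set Plane → Plane → ℝ)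
        (f : Lp ℂ 2 (volume : Measure Plane)),
        1 ≤ n → K₀ ≤ K → 1 < R → K = R ^ ((2 : ℝ)⁻¹ ^ n) → (N + 1) * n ≤ M →
        (∀ B ∈ 𝓑, IsBallOrCube K B) →
        (∀ x : Plane, ({B ∈ (𝓑 : Set (Set Plane)) | x ∈ B}.ncard : ℝ) ≤ A) →
        F = ⋃ B ∈ 𝓑, B →
        IsBallOrCube R B_R → F ⊆ B_R →
        IsRegularWithFactors A R n κ F →
        IsBump a →
        IsCapFamily A c N (Real.log R)⁻¹ Sig →
        (∀ σ ∈ Sig, IsConicBump σ (b σ)) →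
        (∑ B ∈ 𝓑, broadNorm Sig b M (opS a R f) B ^ 2 ≤
            ENNReal.ofReal (C * (Real.log R) ^ (5 * n) * (∏ k ∈ Finset.Icc 1 n, (κ k)⁻¹) *
              (volume.real F / R ^ 2)) * eLpNorm (opS a R f) 2 volume ^ 2) ∧
        (eLpNorm (opS a R f) 2 (volume.restrict F) ^ 2 ≤
            ENNReal.ofReal (C ^ n * ∏ k ∈ Finset.Icc 1 n, κ k) *
              eLpNorm (opS a R f) 2 volume ^ 2) ∧
        (∑ B ∈ 𝓑, broadNorm Sig b M (opS a R f) B ^ 2 ≤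
            ENNReal.ofReal (C * (Real.log R) ^ (5 * n) * (volume.real F / R ^ 2) ^ (1 / 2 : ℝ)) *
              eLpNorm (opS a R f) 2 volume ^ 2) := by
  have hA0 : 0 < A := by linarith
  set d := densityConst.toReal * A with hd
  set D := bumpConst.toReal * (42 * A) * (1600 * A) / c with hD
  have hd0 : 0 ≤ d := by positivity
  have hD0 : 0 ≤ D := by positivity
  have hAd : 0 ≤ 36 * A * d := by positivity
  have hAN : 0 ≤ A * N := by positivity
  -- The first summand serves the broad inequalities, with `N + 1` so that `C ≥ 1` even for `N = 0`;
  -- the second serves the `n`-th power. In `K₀`, the `4` makes all scales at least `4`, and the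
  -- exponential makes `log R` exceed `1` and the constants `D`, `d`.
  refine ⟨14400 * A * (N + 1) + 36 * A * d, 4 + Real.exp (1 + D + d), by nlinarith,
    by linarith [Real.exp_pos (1 + D + d)], ?_⟩
  set C := 14400 * A * (N + 1) + 36 * A * d with hC
  have hCN : 14400 * A * N ≤ C := by nlinarith
  have hCd : 36 * A * d ≤ C := by nlinarith
  have hC0 : 0 ≤ C := hAd.trans hCd
  intro n M K R κ 𝓑 F B_R a Sig b f hn hK hR hKR hM h𝓑 hover hF hB_R hFB hreg ha hSig hb
  have hscale : scale R n 0 = K := by rw [scale, Nat.sub_zero, hKR]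
  have hKle : K ≤ R := hscale ▸ scale_le hR.le n 0
  have hexp := Real.exp_pos (1 + D + d)
  have hL : 1 + D + d ≤ Real.log R :=
    (Real.le_log_iff_exp_le (by linarith)).2 (by linarith)
  have hL1 : 1 ≤ Real.log R := by linarith
  subst hF
  obtain ⟨p, H⟩ := hreg.exists_isRegularFamily hR (by linarith) (hscale.symm ▸ h𝓑) hover hB_R hFB
  obtain ⟨h, hh, hg⟩ := exists_fourier_opS ha (zero_lt_one.trans hR) f
  have hS := ae_eq_fourierInv_of_fourier_ae_eq hh.memLp (hh.integrable (isBounded_annulus _)) hg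
  have hY : eLpNorm (opS a R f) 2 volume ^ 2 = ∫⁻ ξ, ‖h ξ‖ₑ ^ 2 := by
    rw [eLpNorm_congr_ae hS, eLpNorm_two_sq, hh.plancherel (isBounded_annulus _)]
  have hP : 0 ≤ ∏ j ∈ Finset.Icc 1 n, κ j :=
    Finset.prod_nonneg fun j hj => (H.kappa_pos hj).le
  have hP' : 0 ≤ ∏ j ∈ Finset.Icc 1 n, (κ j)⁻¹ :=
    Finset.prod_nonneg fun j hj => (inv_pos.2 (H.kappa_pos hj)).le
  have hpow : Real.log R ^ (2 * n) ≤ Real.log R ^ (5 * n) := pow_le_pow_right₀ hL1 (by omega)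
  rw [hY]
  refine ⟨?_, ?_, ?_⟩
  · refine (H.sum_broadNorm_sq_le_volume hA0.le hc hL1 (by linarith) hSig hn hM hb hh hg).trans
      (mul_le_mul_left (ENNReal.ofReal_le_ofReal ?_) _)
    gcongr
  · rw [eLpNorm_congr_ae (ae_restrict_of_ae hS), eLpNorm_two_sq]
    refine (H.setLIntegral_iUnion_le hA hn hh).trans
      (mul_le_mul_left (ENNReal.ofReal_le_ofReal ?_) _)
    gcongr
  · refine (H.sum_broadNorm_sq_le_sqrt_volume hA0.le hc hL1 (by linarith) (by linarith) hSig hn hM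
      hb hh hg).trans (mul_le_mul_left (ENNReal.ofReal_le_ofReal ?_) _)
    gcongr
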